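/- Let $d\in\{1,2,3\}$ and $\mathbb T^d=\mathbb R^d/\mathbb Z^d$, with Lebesgue measure of total mass one and $\hat g(k)=\int_{\mathbb T^d}g(x)e^{-2\pi i k\cdot x}\,dx$. For an integer $N\ge 2$ let $X_N$ be the real span of $\cos(2\pi k\cdot x),\ \sin(2\pi k\cdot x)$, $k\in\mathbb Z^d$, $|k|_\infty\le N$, and let $\Pi_N$ be the $L^2$ projection onto $X_N$, i.e. truncation of the Fourier series to the modes $|k|_\infty\le N$. Let $f(z)=z^3-z$, $\nu>0$, $\tau>0$. Let $u_0\in H^1(\mathbb T^d)$ be real-valued with mean zero, and let $u^n\in X_N$ ($n\ge 0$) be given by the first-order semi-implicit Fourier-spectral scheme for the Cahn–Hilliard equation $$\frac{u^{n+1}-u^n}{\tau}=-\nu\Delta^2u^{n+1}+\Delta\Pi_N\bigl(f(u^n)\bigr)\quad(n\ge 0),\qquad u^0=\Pi_Nu_0 .$$ Put $$\mathcal E(u)=\int_{\mathbb T^d}\Bigl(\tfrac{\nu}{2}|\nabla u|^2+\tfrac14(u^2-1)^2\Bigr)dx,\qquad E_0=\mathcal E(u^0),\qquad L_0=\|u^0\|_{L^\infty(\mathbb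 T^d)} .$$ For a function $T=T(\nu,E_0)$, say that the scheme is *energy stable under $T$ in dimension $d$* if, for all $\nu,\tau,N,u_0$ as above, $$0<\tau\le\min\Bigl\{\frac{8\nu}{9L_0^4},\,T(\nu,E_0)\Bigr\}\quad\Longrightarrow\quad \mathcal E(u^{n+1})\le\mathcal E(u^n)\ \text{ for all } n\ge 0,$$ where $8\nu/(9L_0^4)$ is read as $+\infty$ if $L_0=0$. **Theorem.** (a) There are constants $C_1,C_2,C_3>0$ depending only on $E_0$ such that the scheme is energy stable under $C_1\nu^{5/3}$ if $d=1$, under $C_2\nu^3$ if $d=2$, and under $C_3\nu^7$ if $d=3$. (b) Let $d=1$ and $(a,b)=(\tfrac1{16},\tfrac{11}{16})$, or $d=2$ and $(a,b)=(\tfrac18,\tfrac78)$. Call $B_1,B_2>0$ *admissible* if for all $\nu,\tau>0$ and $N\ge2$ $$\|(1+\nu\tau\Delta^2)^{-1}g\|_\infty\le B_1(\nu\tau)^{-a}\|g\|_4\quad\text{for all mean-zero } g\in L^4(\mathbb T^d),$$ $$\|\tau\Delta(1+\nu\tau\Delta^2)^{-1}\Pi_Ng\|_\infty\le B_2\,\tau(\nu\tau)^{-b}\|g\|_{4/3}\quad\text{for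 all } g\in L^{4/3}(\mathbb T^d),$$ where $(1+\beta\Delta^2)^{-1}$ is the Fourier multiplier $(1+\beta(2\pi|k|)^4)^{-1}$. Admissible pairs exist, and for every admissible pair, with $\beta_1=B_1\sqrt{1+2\sqrt{E_0}}$ and $\beta_2=2B_2\sqrt{E_0}\sqrt{1+2\sqrt{E_0}}$, the scheme is energy stable under $$0.118\,\nu^{5/3}\min\{\beta_1^{-16/3},\beta_2^{-16/9}\}\quad(d=1),\qquad 0.04\,\nu^{3}\min\{\beta_1^{-8},\beta_2^{-8/3}\}\quad(d=2).$$ (c) Let $d=3$. There are absolute constants $B_3,B_4,B_5>0$ such that, with $\beta_3=B_3\sqrt{E_0}$, $\beta_4=B_4E_0^{3/2}$ and $\beta_5=B_5(1+E_0)^{1/4}$, the scheme is energy stable under $$0.0007\,\nu^7\min\{\beta_3^{-8},\beta_4^{-8/3},\beta_5^{-8}\}.$$ -/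

import Mathlib

open MeasureTheory
open scoped ENNReal

noncomputable section

namespace CahnHilliard

/-- The torus `𝕋^d = (ℝ/ℤ)^d`. -/
abbrev Torus (d : ℕ) : Type := UnitAddTorus (Fin d)

/-- Lebesgue measure on `𝕋^d`, of total mass one. -/
def torusVol (d : ℕ) : Measure (Torus d) :=
  Measure.pi fun _ : Fin d => (AddCircle.haarAddCircle : Measure UnitAddCircle)

/-- The Fourier coefficient `û(k) = ∫ u(x) e^{-2πi k·x} dx` of a real function on `𝕋^d`. -/
def coeff {d : ℕ} (u : Torus d → ℝ) (k : Fin d → ℤ) : ℂ :=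
  UnitAddTorus.mFourierCoeff (fun x => (u x : ℂ)) k

theorem coeff_eq_integral {d : ℕ} (u : Torus d → ℝ) (k : Fin d → ℤ) :
    coeff u k = ∫ x, UnitAddTorus.mFourier (-k) x * (u x : ℂ) ∂(torusVol d) := rfl

/-- `(2π|k|)²`, where `|k|` is the Euclidean norm. -/
def freqSq {d : ℕ} (k : Fin d → ℤ) : ℝ :=
  (2 * Real.pi) ^ 2 * ∑ i, (k i : ℝ) ^ 2

/-- The Sobolev space `H¹(𝕋^d)` (real-valued functions), with
`‖u‖_{H¹}² = ∑_k (1 + (2π|k|)²) |û(k)|²`. -/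
def MemH1 {d : ℕ} (u : Torus d → ℝ) : Prop :=
  MemLp u 2 (torusVol d) ∧ Summable fun k : Fin d → ℤ => (1 + freqSq k) * ‖coeff u k‖ ^ 2

/-- The classical partial derivative `∂_i u` on `𝕋^d`. -/
def pderiv {d : ℕ} (i : Fin d) (u : Torus d → ℝ) (x : Torus d) : ℝ :=
  deriv (fun t : ℝ => u (x + Pi.single i (t : UnitAddCircle))) 0

/-- The Laplacian `Δ u = ∑_i ∂_i ∂_i u`. -/
def lap {d : ℕ} (u : Torus d → ℝ) (x : Torus d) : ℝ :=
  ∑ i, pderiv i (pderiv i u) x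

/-- The set of frequencies `k ∈ ℤ^d` with `|k|_∞ ≤ N`. -/
def freqBox (d N : ℕ) : Finset (Fin d → ℤ) :=
  Fintype.piFinset fun _ => Finset.Icc (-(N : ℤ)) (N : ℤ)

/-- `X_N`: the real span of `cos (2π k·x)` and `sin (2π k·x)` with `|k|_∞ ≤ N`. These are the real
and imaginary parts of `UnitAddTorus.mFourier k x = e^{2πi k·x}`. -/
def trigSpace (d N : ℕ) : Submodule ℝ (Torus d → ℝ) :=
  Submodule.span ℝ
    {φ | ∃ k ∈ freqBox d N,
      φ = (fun x => (UnitAddTorus.mFourier k x).re) ∨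
      φ = (fun x => (UnitAddTorus.mFourier k x).im)}

/-- `Π_N`: truncation of the Fourier series to the modes `|k|_∞ ≤ N`. For real `u` the truncated
series is real; `piN_mem` and `piN_orthogonal` say that `Π_N` is the `L²` projection onto `X_N`. -/
def piN {d : ℕ} (N : ℕ) (u : Torus d → ℝ) (x : Torus d) : ℝ :=
  (∑ k ∈ freqBox d N, coeff u k * UnitAddTorus.mFourier k x).re

instance instIsProbabilityMeasureTorusVol (d : ℕ) : IsProbabilityMeasure (torusVol d) := by
  unfold torusVol; infer_instance

theorem piN_mem {d : ℕ} (N : ℕ) (u : Torus d → ℝ) : piN N u ∈ trigSpace d N := by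
  have h : piN N u = ∑ k ∈ freqBox d N,
      ((coeff u k).re • (fun x : Torus d => (UnitAddTorus.mFourier k x).re) -
        (coeff u k).im • (fun x : Torus d => (UnitAddTorus.mFourier k x).im)) := by
    funext x
    simp [piN, Complex.re_sum, Finset.sum_apply]
  rw [h]
  exact Submodule.sum_mem _ fun k hk => Submodule.sub_mem _
    (Submodule.smul_mem _ _ (Submodule.subset_span ⟨k, hk, Or.inl rfl⟩))
    (Submodule.smul_mem _ _ (Submodule.subset_span ⟨k, hk, Or.inr rfl⟩))

theorem neg_mem_freqBox {d N : ℕ} {k : Fin d → ℤ} (hk : k ∈ freqBox d N) : -k ∈ freqBox d N := by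
  simp only [freqBox, Fintype.mem_piFinset, Finset.mem_Icc, Pi.neg_apply] at hk ⊢
  exact fun i => ⟨by linarith [(hk i).2], by linarith [(hk i).1]⟩

theorem integral_mFourier {d : ℕ} (k : Fin d → ℤ) :
    ∫ x, UnitAddTorus.mFourier k x ∂(torusVol d) = if k = 0 then 1 else 0 := by
  have h := orthonormal_iff_ite.mp (UnitAddTorus.orthonormal_mFourier (d := Fin d)) 0 k
  rw [ContinuousMap.inner_toLp] at h
  simp only [UnitAddTorus.mFourier_zero] at h
  simp only [eq_comm (a := k)]
  rw [← h]
  simp [torusVol, volume]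

theorem coeff_neg {d : ℕ} (u : Torus d → ℝ) (k : Fin d → ℤ) :
    coeff u (-k) = (starRingEnd ℂ) (coeff u k) := by
  simp only [coeff_eq_integral, ← integral_conj, map_mul, Complex.conj_ofReal,
    ← UnitAddTorus.mFourier_neg]

theorem ofReal_piN {d : ℕ} (N : ℕ) (u : Torus d → ℝ) (x : Torus d) :
    (piN N u x : ℂ) = ∑ k ∈ freqBox d N, coeff u k * UnitAddTorus.mFourier k x := by
  refine Complex.conj_eq_iff_re.mp ?_
  rw [map_sum]
  refine Finset.sum_nbij' (fun k => -k) (fun k => -k) (fun k hk => neg_mem_freqBox hk)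
    (fun k hk => neg_mem_freqBox hk) (by simp) (by simp) fun k _ => ?_
  rw [map_mul, ← coeff_neg, ← UnitAddTorus.mFourier_neg]

theorem integrable_mul_mFourier {d : ℕ} {u : Torus d → ℝ} (hu : Integrable u (torusVol d))
    (j : Fin d → ℤ) :
    Integrable (fun x => UnitAddTorus.mFourier j x * (u x : ℂ)) (torusVol d) := by
  refine (hu.ofReal (𝕜 := ℂ)).bdd_mul (c := 1)
    (UnitAddTorus.mFourier j).continuous.aestronglyMeasurable (Filter.Eventually.of_forall ?_)
  intro x
  exact (ContinuousMap.norm_coe_le_norm _ x).trans UnitAddTorus.mFourier_norm.le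

theorem continuous_piN {d : ℕ} (N : ℕ) (u : Torus d → ℝ) : Continuous (piN N u) := by
  unfold piN; fun_prop

theorem integrable_piN {d : ℕ} (N : ℕ) (u : Torus d → ℝ) :
    Integrable (piN N u) (torusVol d) :=
  (continuous_piN N u).integrable_of_hasCompactSupport (HasCompactSupport.of_compactSpace _)

theorem coeff_piN {d : ℕ} (N : ℕ) (u : Torus d → ℝ) {j : Fin d → ℤ} (hj : j ∈ freqBox d N) :
    coeff (piN N u) j = coeff u j := by
  rw [coeff_eq_integral]
  simp only [ofReal_piN, Finset.mul_sum]
  rw [integral_finsetSum]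
  · rw [Finset.sum_eq_single_of_mem j hj]
    · have : ∀ x : Torus d, UnitAddTorus.mFourier (-j) x * (coeff u j * UnitAddTorus.mFourier j x) =
          coeff u j * UnitAddTorus.mFourier (-j + j) x := fun x => by
        rw [UnitAddTorus.mFourier_add]; ring
      simp only [this]
      rw [integral_const_mul, integral_mFourier]; simp
    · intro k _ hkj
      have : ∀ x : Torus d, UnitAddTorus.mFourier (-j) x * (coeff u k * UnitAddTorus.mFourier k x) =
          coeff u k * UnitAddTorus.mFourier (-j + k) x := fun x => by
        rw [UnitAddTorus.mFourier_add]; ring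
      simp only [this]
      rw [integral_const_mul, integral_mFourier, if_neg, mul_zero]
      intro h
      exact hkj (by rw [neg_add_eq_zero] at h; exact h.symm)
  · intro k _
    refine Continuous.integrable_of_hasCompactSupport (by fun_prop)
      (HasCompactSupport.of_compactSpace _)

theorem piN_orthogonal {d : ℕ} (N : ℕ) {u : Torus d → ℝ} (hu : Integrable u (torusVol d))
    {φ : Torus d → ℝ} (hφ : φ ∈ trigSpace d N) :
    ∫ x, (piN N u x - u x) * φ x ∂(torusVol d) = 0 := by
  have hw : Integrable (fun x => piN N u x - u x) (torusVol d) := (integrable_piN N u).sub hu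
  have key : ∀ j ∈ freqBox d N,
      ∫ x, UnitAddTorus.mFourier j x * ((piN N u x - u x : ℝ) : ℂ) ∂(torusVol d) = 0 := by
    intro j hj
    have h1 := coeff_piN N u (neg_mem_freqBox hj)
    simp only [coeff_eq_integral, neg_neg] at h1
    simp only [Complex.ofReal_sub, mul_sub]
    rw [integral_sub (integrable_mul_mFourier (integrable_piN N u) j)
      (integrable_mul_mFourier hu j), h1, sub_self]
  have hint := fun j => integrable_mul_mFourier hw j
  suffices h : Integrable (fun x => (piN N u x - u x) * φ x) (torusVol d) ∧
      ∫ x, (piN N u x - u x) * φ x ∂(torusVol d) = 0 from h.2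
  induction hφ using Submodule.span_induction with
  | mem φ h =>
    obtain ⟨j, hj, rfl | rfl⟩ := h
    · have e : ∀ x : Torus d, (piN N u x - u x) * (UnitAddTorus.mFourier j x).re =
          RCLike.re (UnitAddTorus.mFourier j x * ((piN N u x - u x : ℝ) : ℂ)) := fun x => by
        rw [RCLike.re_eq_complex_re, Complex.re_mul_ofReal, mul_comm]
      simp only [e]
      exact ⟨(hint j).re, by rw [integral_re (hint j), key j hj]; simp⟩
    · have e : ∀ x : Torus d, (piN N u x - u x) * (UnitAddTorus.mFourier j x).im =
          RCLike.im (UnitAddTorus.mFourier j x * ((piN N u x - u x : ℝ) : ℂ)) := fun x => by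
        rw [RCLike.im_eq_complex_im, Complex.im_mul_ofReal, mul_comm]
      simp only [e]
      exact ⟨(hint j).im, by rw [integral_im (hint j), key j hj]; simp⟩
  | zero => simp
  | add f g _ _ hf hg =>
    simp only [Pi.add_apply, mul_add]
    exact ⟨hf.1.add hg.1, by rw [integral_add hf.1 hg.1, hf.2, hg.2, add_zero]⟩
  | smul c f _ hf =>
    have e : ∀ x, (piN N u x - u x) * (c • f) x = c * ((piN N u x - u x) * f x) := fun x => by
      simp only [Pi.smul_apply, smul_eq_mul]; ring
    simp only [e]
    exact ⟨hf.1.const_mul c, by rw [integral_const_mul, hf.2, mul_zero]⟩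

/-- The resolvent `(1 + β Δ²)⁻¹ g`, i.e. the function with Fourier coefficients
`ĝ(k) / (1 + β (2π|k|)⁴)`. For `d ≤ 3`, `β > 0` and integrable `g` the series converges
absolutely, and its sum is real. -/
def resolvent {d : ℕ} (β : ℝ) (g : Torus d → ℝ) (x : Torus d) : ℝ :=
  (∑' k : Fin d → ℤ,
    (((1 + β * freqSq k ^ 2)⁻¹ : ℝ) : ℂ) * coeff g k * UnitAddTorus.mFourier k x).re

/-- The derivative `f(z) = z³ - z` of the double-well potential. -/
def nonlin (z : ℝ) : ℝ := z ^ 3 - z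

/-- The energy `𝓔(u) = ∫ (ν/2 |∇u|² + (u² - 1)²/4) dx`. -/
def energy {d : ℕ} (ν : ℝ) (u : Torus d → ℝ) : ℝ :=
  ∫ x, (1 / 2 * ν * ∑ i, pderiv i u x ^ 2 + 1 / 4 * (u x ^ 2 - 1) ^ 2) ∂(torusVol d)

/-- `u 0, u 1, …` in `X_N` are the iterates of the semi-implicit Fourier-spectral scheme
`(u^{n+1} - u^n)/τ = -ν Δ² u^{n+1} + Δ Π_N f(u^n)`, `u^0 = Π_N u₀`. -/
structure IsSchemeSolution {d : ℕ} (ν τ : ℝ) (N : ℕ) (u₀ : Torus d → ℝ)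
    (u : ℕ → Torus d → ℝ) : Prop where
  init : u 0 = piN N u₀
  mem : ∀ n, u n ∈ trigSpace d N
  step : ∀ n x, (u (n + 1) x - u n x) / τ =
    -ν * lap (lap (u (n + 1))) x + lap (piN N (fun y => nonlin (u n y))) x

/-- Conditional energy stability in dimension `d`: the energy of the scheme is non-increasing
whenever `0 < τ ≤ min {8ν/(9 L₀⁴), T ν E₀}`, where `L₀ = ‖u^0‖_∞` and `E₀ = 𝓔(u^0)`.
If `L₀ = 0`, the first bound is read as `+∞`. -/
def ConditionallyEnergyStable (d : ℕ) (T : ℝ → ℝ → ℝ) : Prop :=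
  ∀ (ν τ : ℝ) (N : ℕ), 0 < ν → 0 < τ → 2 ≤ N →
  ∀ u₀ : Torus d → ℝ, MemH1 u₀ → ∫ x, u₀ x ∂(torusVol d) = 0 →
  ∀ u : ℕ → Torus d → ℝ, IsSchemeSolution ν τ N u₀ u →
  ∀ L₀ : ℝ, 0 ≤ L₀ → eLpNorm (u 0) ∞ (torusVol d) = ENNReal.ofReal L₀ →
    (L₀ ≠ 0 → τ ≤ 8 * ν / (9 * L₀ ^ 4)) →
    τ ≤ T ν (energy ν (u 0)) →
    ∀ n, energy ν (u (n + 1)) ≤ energy ν (u n)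

/-- `A` and `B` are admissible constants in the smoothing estimates
`‖(1 + ντΔ²)⁻¹ g‖_∞ ≤ A (ντ)^{-a} ‖g‖_4` for mean-zero `g ∈ L⁴(𝕋^d)`, and
`‖τ Δ (1 + ντΔ²)⁻¹ Π_N g‖_∞ ≤ B τ (ντ)^{-b} ‖g‖_{4/3}` for `g ∈ L^{4/3}(𝕋^d)`,
uniformly in `ν, τ > 0` and `N ≥ 2`. -/
def KernelBounds (d : ℕ) (a b A B : ℝ) : Prop :=
  ∀ (ν τ : ℝ) (N : ℕ), 0 < ν → 0 < τ → 2 ≤ N →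
    (∀ g : Torus d → ℝ, MemLp g 4 (torusVol d) → ∫ x, g x ∂(torusVol d) = 0 →
      eLpNorm (resolvent (ν * τ) g) ∞ (torusVol d) ≤
        ENNReal.ofReal (A * (ν * τ) ^ (-a)) * eLpNorm g 4 (torusVol d)) ∧
    (∀ g : Torus d → ℝ, MemLp g (4 / 3) (torusVol d) →
      eLpNorm (fun x => τ * lap (resolvent (ν * τ) (piN N g)) x) ∞ (torusVol d) ≤
        ENNReal.ofReal (B * τ * (ν * τ) ^ (-b)) * eLpNorm g (4 / 3) (torusVol d))

end CahnHilliard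

end

open CahnHilliard

noncomputable section

namespace CahnHilliard

open UnitAddTorus

variable {d N : ℕ}

/-! Write `v` and `w` for consecutive iterates and `δ = w - v`. Testing the scheme with `(-Δ)⁻¹δ`,
mode by mode, gives a dissipation of at least `R‖δ‖₂²` with `R = √(2ν/τ)`, by AM-GM between
`|δ̂|²/(τq)` and `νq|δ̂|²/2`, where `q = (2π|k|)²` (`mode_energy_le`). The potential exceeds its
linearisation at `v` by at most `(3/2)L²‖δ‖₂²` when `|v|, |w| ≤ L`. So the energy decreases as soon
as both iterates are bounded by the `L` with `9L⁴τ = 8ν` (`energy_le_of_bounded`). This `L` depends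
on `ν` and `τ` only and is at least `L₀` by the first step restriction. It remains to propagate the
bound `L` and `𝓔 ≤ E₀` together by induction (`conditionallyEnergyStable_of_step`).

For the sup bound, solve one step: `w = (1+ντΔ²)⁻¹v + τΔ(1+ντΔ²)⁻¹Π_N f(v)`. For `d = 1, 2` the
energy controls `‖v‖₄` and `‖f(v)‖_{4/3} ≤ ‖v‖₄‖v²-1‖₂`. An admissible pair then bounds `‖w‖_∞` in
terms of `E₀` alone, and the second step restriction makes the bound at most `L`. For `d = 3` the
two terms are estimated by Cauchy–Schwarz in Fourier space, using `‖∇v‖₂² ≤ 2E/ν` and `‖f(v)‖₂ ≤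
2L√E`. The second estimate is linear in `L`, so `L` cancels and one condition `E⁴τ ≲ ν⁷` serves both
terms (`bounded_of_step_three`).

The existence of admissible pairs is harmonic analysis with `c¹² = ντ`; the kernel of the resolvent
lives at length scale `c³`. All lattice sums reduce to products of a one-dimensional summable
`profile`. The `L^{4/3} → L^∞` bound needs the kernel in `L⁴`, which follows from an `ℓ^{4/3}` bound
on its coefficients by squaring the kernel and applying Young's inequality. The `L⁴ → L^∞` bound
needs the kernel in `L^{4/3}`, which sizes of coefficients do not control. There a weighted `L²`
estimate is used: multiplication by `1 - e^{2πi y_i}` differences the coefficients, and the symbol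
varies slowly. -/

/-! ### Trigonometric polynomials, their derivatives and Fourier coefficients. -/

/-- The real part of the trigonometric polynomial `∑_{|k|_∞ ≤ N} a_k e^{2πi k·x}`. -/
def trigPoly {d : ℕ} (N : ℕ) (a : (Fin d → ℤ) → ℂ) (x : Torus d) : ℝ :=
  (∑ k ∈ freqBox d N, a k * mFourier k x).re

theorem piN_eq_trigPoly (u : Torus d → ℝ) : piN N u = trigPoly N (coeff u) := rfl

theorem continuous_trigPoly (a : (Fin d → ℤ) → ℂ) : Continuous (trigPoly N a) := by
  unfold trigPoly; fun_prop

theorem norm_mFourier_apply (k : Fin d → ℤ) (x : Torus d) : ‖mFourier k x‖ = 1 := by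
  simp only [mFourier, fourier_apply, ContinuousMap.coe_mk, norm_prod, Circle.norm_coe,
    Finset.prod_const_one]

theorem mFourier_apply_add (k : Fin d → ℤ) (x y : Torus d) :
    mFourier k (x + y) = mFourier k x * mFourier k y := by
  simp [mFourier, fourier_apply, smul_add, AddCircle.toCircle_add, Finset.prod_mul_distrib]

theorem mFourier_apply_single (k : Fin d → ℤ) (i : Fin d) (t : ℝ) :
    mFourier k (Pi.single i (t : UnitAddCircle)) =
      Complex.exp (2 * Real.pi * Complex.I * k i * t) := by
  simp only [mFourier, ContinuousMap.coe_mk]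
  rw [Finset.prod_eq_single i]
  · rw [Pi.single_eq_same, fourier_coe_apply]; simp
  · intro j _ hj; rw [Pi.single_eq_of_ne hj, fourier_eval_zero]
  · simp

theorem pderiv_trigPoly (i : Fin d) (a : (Fin d → ℤ) → ℂ) :
    pderiv i (trigPoly N a) = trigPoly N fun k => 2 * Real.pi * Complex.I * k i * a k := by
  funext x
  have h : ∀ k : Fin d → ℤ, HasDerivAt
      (fun t : ℝ => a k * mFourier k (x + Pi.single i (t : UnitAddCircle)))
      (2 * Real.pi * Complex.I * k i * a k * mFourier k x) 0 := by
    intro k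
    simp only [mFourier_apply_add, mFourier_apply_single]
    have h1 : HasDerivAt (fun t : ℝ => 2 * Real.pi * Complex.I * k i * (t : ℂ))
        (2 * Real.pi * Complex.I * k i) 0 := by
      simpa using (Complex.ofRealCLM.hasDerivAt (x := (0 : ℝ))).const_mul
        (2 * Real.pi * Complex.I * k i)
    have h2 := ((h1.cexp.const_mul (mFourier k x)).const_mul (a k))
    simp only [Complex.ofReal_zero, mul_zero, Complex.exp_zero, one_mul] at h2
    exact h2.congr_deriv (by ring)
  have hs := HasDerivAt.fun_sum (u := freqBox d N) fun k _ => h k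
  have hr := (Complex.reCLM.hasFDerivAt.comp_hasDerivAt (0 : ℝ) hs)
  exact hr.deriv

theorem lap_trigPoly (a : (Fin d → ℤ) → ℂ) :
    lap (trigPoly N a) = trigPoly N fun k => -(freqSq k : ℂ) * a k := by
  funext x
  simp only [lap, pderiv_trigPoly, trigPoly]
  rw [← Complex.re_sum, Finset.sum_comm]
  congr 1
  refine Finset.sum_congr rfl fun k _ => ?_
  rw [← Finset.sum_mul]
  congr 1
  have : ∀ i : Fin d, 2 * (Real.pi : ℂ) * Complex.I * k i * (2 * Real.pi * Complex.I * k i * a k) =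
      -((2 * Real.pi) ^ 2 * (k i) ^ 2) * a k := by
    intro i
    linear_combination (2 * Real.pi * k i : ℂ) ^ 2 * a k * Complex.I_sq
  simp only [this]
  rw [← Finset.sum_mul, Finset.sum_neg_distrib, ← Finset.mul_sum]
  simp [freqSq]

/-- The symmetry `a_{-k} = conj a_k` of the Fourier coefficients of real functions. -/
def Hermitian {d : ℕ} (a : (Fin d → ℤ) → ℂ) : Prop :=
  ∀ k, a (-k) = (starRingEnd ℂ) (a k)

theorem hermitian_coeff (u : Torus d → ℝ) : Hermitian (coeff u) := coeff_neg u

theorem Hermitian.real_mul {a : (Fin d → ℤ) → ℂ} (ha : Hermitian a) {r : (Fin d → ℤ) → ℝ}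
    (hr : ∀ k, r (-k) = r k) : Hermitian fun k => (r k : ℂ) * a k := by
  intro k; simp [hr, ha k]

theorem freqSq_neg (k : Fin d → ℤ) : freqSq (-k) = freqSq k := by simp [freqSq]

theorem freqSq_nonneg (k : Fin d → ℤ) : 0 ≤ freqSq k := by unfold freqSq; positivity

theorem freqSq_zero : freqSq (0 : Fin d → ℤ) = 0 := by simp [freqSq]

theorem sq_le_freqSq (k : Fin d → ℤ) (i : Fin d) : (k i : ℝ) ^ 2 ≤ freqSq k := by
  unfold freqSq
  have h1 : (k i : ℝ) ^ 2 ≤ ∑ i, (k i : ℝ) ^ 2 :=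
    Finset.single_le_sum (f := fun i => (k i : ℝ) ^ 2) (fun _ _ => sq_nonneg _) (Finset.mem_univ i)
  have h2 : (1 : ℝ) ≤ (2 * Real.pi) ^ 2 := by nlinarith [Real.pi_gt_three]
  nlinarith [sq_nonneg (k i : ℝ)]

theorem one_le_freqSq {k : Fin d → ℤ} (hk : k ≠ 0) : 1 ≤ freqSq k := by
  obtain ⟨i, hi⟩ := Function.ne_iff.mp hk
  refine le_trans ?_ (sq_le_freqSq k i)
  have : 1 ≤ |k i| := Int.one_le_abs hi
  have h2 : (1 : ℝ) ≤ |(k i : ℝ)| := by exact_mod_cast this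
  rw [← sq_abs]
  nlinarith

/-- Pairing `k` with `-k` shows the sum is already real, so taking the real part loses nothing and
the coefficients can be recovered. -/
theorem ofReal_trigPoly {a : (Fin d → ℤ) → ℂ} (ha : Hermitian a) (x : Torus d) :
    (trigPoly N a x : ℂ) = ∑ k ∈ freqBox d N, a k * mFourier k x := by
  refine Complex.conj_eq_iff_re.mp ?_
  rw [map_sum]
  refine Finset.sum_nbij' (fun k => -k) (fun k => -k) (fun k hk => neg_mem_freqBox hk)
    (fun k hk => neg_mem_freqBox hk) (by simp) (by simp) fun k _ => ?_
  rw [map_mul, ← ha, ← mFourier_neg]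

theorem integrable_of_continuous {E : Type*} [NormedAddCommGroup E] {f : Torus d → E}
    (hf : Continuous f) : Integrable f (torusVol d) := by
  obtain ⟨C, hC⟩ := (isCompact_range hf).isBounded.exists_norm_le
  refine Integrable.of_bound hf.aestronglyMeasurable_of_compactSpace C ?_
  exact Filter.Eventually.of_forall fun x => hC _ ⟨x, rfl⟩

theorem coeff_trigPoly_eq_ite {a : (Fin d → ℤ) → ℂ} (ha : Hermitian a) (j : Fin d → ℤ) :
    coeff (trigPoly N a) j = if j ∈ freqBox d N then a j else 0 := by
  rw [coeff_eq_integral]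
  simp only [ofReal_trigPoly ha, Finset.mul_sum]
  rw [integral_finsetSum _ fun k _ => integrable_of_continuous (by fun_prop)]
  have h : ∀ (k : Fin d → ℤ) (x : Torus d), mFourier (-j) x * (a k * mFourier k x) =
      a k * mFourier (-j + k) x := fun k x => by rw [mFourier_add]; ring
  simp only [h, integral_const_mul, integral_mFourier, neg_add_eq_zero, mul_ite, mul_one, mul_zero,
    Finset.sum_ite_eq]

theorem coeff_trigPoly {a : (Fin d → ℤ) → ℂ} (ha : Hermitian a) {j : Fin d → ℤ}
    (hj : j ∈ freqBox d N) : coeff (trigPoly N a) j = a j := by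
  rw [coeff_trigPoly_eq_ite ha, if_pos hj]

/-- By linearity it is enough to treat the generators, each a combination of the modes `k` and `-k`,
both of which lie in the box. Elements of `X_N` are thereby determined by their coefficients on the
box. -/
theorem piN_eq_of_mem {φ : Torus d → ℝ} (hφ : φ ∈ trigSpace d N) : piN N φ = φ := by
  have re_eq : ∀ (k : Fin d → ℤ) (x : Torus d), ((mFourier k x).re : ℂ) =
      2⁻¹ * mFourier k x + 2⁻¹ * mFourier (-k) x := fun k x => by
    rw [mFourier_neg, Complex.re_eq_add_conj]; ring
  have im_eq : ∀ (k : Fin d → ℤ) (x : Torus d), ((mFourier k x).im : ℂ) =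
      (2 * Complex.I)⁻¹ * mFourier k x + -(2 * Complex.I)⁻¹ * mFourier (-k) x := fun k x => by
    rw [mFourier_neg, Complex.im_eq_sub_conj]; ring
  have key : ∀ (k : Fin d → ℤ), k ∈ freqBox d N → ∀ (α β : ℂ) (φ : Torus d → ℝ),
      (∀ x, (φ x : ℂ) = α * mFourier k x + β * mFourier (-k) x) → piN N φ = φ := by
    intro k hk α β φ h
    have hc : ∀ j, coeff φ j = (if k = j then α else 0) + (if -k = j then β else 0) := by
      intro j
      rw [coeff_eq_integral]
      simp only [h, mul_add]
      rw [integral_add (integrable_of_continuous (by fun_prop))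
        (integrable_of_continuous (by fun_prop))]
      have e : ∀ (γ : ℂ) (l : Fin d → ℤ) (x : Torus d), mFourier (-j) x * (γ * mFourier l x) =
        γ * mFourier (-j + l) x := fun γ l x => by rw [mFourier_add]; ring
      simp only [e, integral_const_mul, integral_mFourier, neg_add_eq_zero, mul_ite, mul_one,
        mul_zero, eq_comm (a := j)]
    funext x
    have := ofReal_piN N φ x
    simp only [hc, add_mul, Finset.sum_add_distrib, ite_mul, zero_mul] at this
    rw [Finset.sum_ite_eq, Finset.sum_ite_eq, if_pos hk, if_pos (neg_mem_freqBox hk), ← h] at this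
    exact_mod_cast this
  suffices h : Continuous φ ∧ piN N φ = φ from h.2
  induction hφ using Submodule.span_induction with
  | mem φ h =>
    obtain ⟨k, hk, rfl | rfl⟩ := h
    · exact ⟨by fun_prop, key k hk _ _ _ (re_eq k)⟩
    · exact ⟨by fun_prop, key k hk _ _ _ (im_eq k)⟩
  | zero =>
    refine ⟨continuous_const, ?_⟩
    funext x; simp [piN, coeff_eq_integral]
  | add f g _ _ hf hg =>
    refine ⟨hf.1.add hg.1, ?_⟩
    have : ∀ k, coeff (f + g) k = coeff f k + coeff g k := fun k => by
      simp only [coeff_eq_integral, Pi.add_apply, Complex.ofReal_add, mul_add]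
      exact integral_add (integrable_mul_mFourier (integrable_of_continuous hf.1) _)
        (integrable_mul_mFourier (integrable_of_continuous hg.1) _)
    funext x
    rw [Pi.add_apply, ← congrFun hf.2 x, ← congrFun hg.2 x]
    simp only [piN, this, add_mul, Finset.sum_add_distrib, Complex.add_re]
  | smul c f _ hf =>
    refine ⟨hf.1.const_smul c, ?_⟩
    have : ∀ k, coeff (c • f) k = c * coeff f k := fun k => by
      simp only [coeff_eq_integral, Pi.smul_apply, smul_eq_mul, Complex.ofReal_mul]
      rw [← integral_const_mul]
      congr 1; funext x; ring
    funext x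
    rw [Pi.smul_apply, ← congrFun hf.2 x]
    simp only [piN, this, mul_assoc, ← Finset.mul_sum, smul_eq_mul, Complex.re_ofReal_mul]

theorem eq_trigPoly_of_mem {φ : Torus d → ℝ} (hφ : φ ∈ trigSpace d N) :
    φ = trigPoly N (coeff φ) := (piN_eq_of_mem hφ).symm

theorem continuous_of_mem {φ : Torus d → ℝ} (hφ : φ ∈ trigSpace d N) : Continuous φ := by
  rw [← piN_eq_of_mem hφ]; exact continuous_piN N φ

theorem trigPoly_mem (a : (Fin d → ℤ) → ℂ) : trigPoly N a ∈ trigSpace d N := by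
  have h : trigPoly N a = ∑ k ∈ freqBox d N,
      ((a k).re • (fun x : Torus d => (mFourier k x).re) -
        (a k).im • (fun x : Torus d => (mFourier k x).im)) := by
    funext x
    simp [trigPoly, Complex.re_sum, Finset.sum_apply]
  rw [h]
  exact Submodule.sum_mem _ fun k hk => Submodule.sub_mem _
    (Submodule.smul_mem _ _ (Submodule.subset_span ⟨k, hk, Or.inl rfl⟩))
    (Submodule.smul_mem _ _ (Submodule.subset_span ⟨k, hk, Or.inr rfl⟩))

theorem integral_mFourier_mul (ψ : Torus d → ℝ) (k : Fin d → ℤ) :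
    ∫ x, mFourier k x * (ψ x : ℂ) ∂(torusVol d) = (starRingEnd ℂ) (coeff ψ k) := by
  rw [← coeff_neg, coeff_eq_integral, neg_neg]

theorem coeff_sub {u v : Torus d → ℝ} (hu : Integrable u (torusVol d))
    (hv : Integrable v (torusVol d)) (k : Fin d → ℤ) :
    coeff (fun x => u x - v x) k = coeff u k - coeff v k := by
  simp only [coeff_eq_integral, Complex.ofReal_sub, mul_sub]
  exact integral_sub (integrable_mul_mFourier hu _) (integrable_mul_mFourier hv _)

/-- Parseval's identity against a trigonometric polynomial. -/
theorem integral_mul_of_mem {φ ψ : Torus d → ℝ} (hφ : φ ∈ trigSpace d N)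
    (hψ : Integrable ψ (torusVol d)) :
    ∫ x, φ x * ψ x ∂(torusVol d) =
      ∑ k ∈ freqBox d N, (coeff φ k * (starRingEnd ℂ) (coeff ψ k)).re := by
  have h : ((∫ x, φ x * ψ x ∂(torusVol d) : ℝ) : ℂ) =
      ∑ k ∈ freqBox d N, coeff φ k * (starRingEnd ℂ) (coeff ψ k) := by
    rw [← integral_complex_ofReal]
    have e : ∀ x, ((φ x * ψ x : ℝ) : ℂ) =
        ∑ k ∈ freqBox d N, coeff φ k * (mFourier k x * (ψ x : ℂ)) := by
      intro x
      rw [Complex.ofReal_mul]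
      conv_lhs => rw [← piN_eq_of_mem hφ, ofReal_piN, Finset.sum_mul]
      exact Finset.sum_congr rfl fun k _ => by ring
    simp only [e]
    rw [integral_finsetSum _ fun k _ => (integrable_mul_mFourier hψ k).const_mul _]
    simp only [integral_const_mul, integral_mFourier_mul]
  rw [← Complex.ofReal_re (∫ x, φ x * ψ x ∂(torusVol d)), h, Complex.re_sum]

theorem integral_sq_of_mem {φ : Torus d → ℝ} (hφ : φ ∈ trigSpace d N) :
    ∫ x, φ x ^ 2 ∂(torusVol d) = ∑ k ∈ freqBox d N, ‖coeff φ k‖ ^ 2 := by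
  simp only [pow_two (φ _)]
  rw [integral_mul_of_mem hφ (integrable_of_continuous (continuous_of_mem hφ))]
  refine Finset.sum_congr rfl fun k _ => ?_
  rw [Complex.mul_conj, Complex.ofReal_re, Complex.normSq_eq_norm_sq]

/-- Bessel's inequality on the frequency box. -/
theorem sum_sq_coeff_le {ψ : Torus d → ℝ} (hψ : MemLp ψ 2 (torusVol d)) :
    ∑ k ∈ freqBox d N, ‖coeff ψ k‖ ^ 2 ≤ ∫ x, ψ x ^ 2 ∂(torusVol d) := by
  have hi : Integrable ψ (torusVol d) := hψ.integrable (by norm_num)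
  have hp : ∑ k ∈ freqBox d N, ‖coeff ψ k‖ ^ 2 = ∫ x, piN N ψ x ^ 2 ∂(torusVol d) := by
    rw [integral_sq_of_mem (piN_mem N ψ)]
    exact Finset.sum_congr rfl fun k hk => by rw [coeff_piN N ψ hk]
  have h0 := piN_orthogonal N hi (piN_mem N ψ)
  have hc := continuous_piN N ψ
  have h2 : MemLp (piN N ψ) 2 (torusVol d) :=
    hc.memLp_of_hasCompactSupport (HasCompactSupport.of_compactSpace _)
  have hpp : Integrable (fun x => piN N ψ x ^ 2) (torusVol d) := h2.integrable_sq
  have hpm : Integrable (fun x => piN N ψ x * ψ x) (torusVol d) := h2.integrable_mul hψ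
  have h1 : ∫ x, (ψ x - piN N ψ x) ^ 2 ∂(torusVol d) =
      ∫ x, ψ x ^ 2 ∂(torusVol d) - ∫ x, piN N ψ x ^ 2 ∂(torusVol d) := by
    have e : ∀ x, (ψ x - piN N ψ x) ^ 2 =
        (ψ x ^ 2 - piN N ψ x ^ 2) + 2 * ((piN N ψ x - ψ x) * piN N ψ x) := fun x => by ring
    simp only [e]
    have h3 : Integrable (fun x => (piN N ψ x - ψ x) * piN N ψ x) (torusVol d) := by
      have : (fun x => (piN N ψ x - ψ x) * piN N ψ x) =
          fun x => piN N ψ x ^ 2 - piN N ψ x * ψ x := by funext x; ring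
      rw [this]; exact hpp.sub hpm
    rw [integral_add (f := fun x => ψ x ^ 2 - piN N ψ x ^ 2) (hψ.integrable_sq.sub hpp)
      (h3.const_mul 2), integral_const_mul, h0,
      integral_sub hψ.integrable_sq hpp]
    ring
  have h4 : 0 ≤ ∫ x, (ψ x - piN N ψ x) ^ 2 ∂(torusVol d) := integral_nonneg fun x => sq_nonneg _
  rw [hp]; linarith

theorem trigPoly_sub (a b : (Fin d → ℤ) → ℂ) (x : Torus d) :
    trigPoly N a x - trigPoly N b x = trigPoly N (fun k => a k - b k) x := by
  simp [trigPoly, sub_mul, Finset.sum_sub_distrib]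

theorem mul_trigPoly (r : ℝ) (a : (Fin d → ℤ) → ℂ) (x : Torus d) :
    r * trigPoly N a x = trigPoly N (fun k => r * a k) x := by
  simp only [trigPoly, mul_assoc, ← Finset.mul_sum, Complex.re_ofReal_mul]

theorem Hermitian.sub {a b : (Fin d → ℤ) → ℂ} (ha : Hermitian a) (hb : Hermitian b) :
    Hermitian fun k => a k - b k := by
  intro k; simp [ha k, hb k]

/-! ### The energy in Fourier variables and its decay over one step. -/

theorem integral_pderiv_sq {u : Torus d → ℝ} (hu : u ∈ trigSpace d N) (i : Fin d) :
    ∫ x, pderiv i u x ^ 2 ∂(torusVol d) =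
      ∑ k ∈ freqBox d N, (2 * Real.pi) ^ 2 * (k i : ℝ) ^ 2 * ‖coeff u k‖ ^ 2 := by
  have hh : Hermitian fun k : Fin d → ℤ => 2 * Real.pi * Complex.I * k i * coeff u k := by
    intro k
    simp [hermitian_coeff u k, Complex.conj_ofNat]
  have h1 : pderiv i u = trigPoly N fun k => 2 * Real.pi * Complex.I * k i * coeff u k := by
    conv_lhs => rw [eq_trigPoly_of_mem hu]
    exact pderiv_trigPoly i _
  rw [h1, integral_sq_of_mem (trigPoly_mem _)]
  refine Finset.sum_congr rfl fun k hk => ?_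
  rw [coeff_trigPoly hh hk]
  simp only [norm_mul, Complex.norm_I, Complex.norm_real, Complex.norm_intCast, mul_pow, sq_abs,
    Real.norm_eq_abs, Complex.norm_ofNat]
  ring

theorem continuous_pderiv {u : Torus d → ℝ} (hu : u ∈ trigSpace d N) (i : Fin d) :
    Continuous (pderiv i u) := by
  rw [eq_trigPoly_of_mem hu, pderiv_trigPoly]
  exact continuous_trigPoly _

/-- The energy of a trigonometric polynomial in terms of its Fourier coefficients. -/
theorem energy_eq (ν : ℝ) {u : Torus d → ℝ} (hu : u ∈ trigSpace d N) :
    energy ν u = 1 / 2 * ν * ∑ k ∈ freqBox d N, freqSq k * ‖coeff u k‖ ^ 2 +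
      1 / 4 * ∫ x, (u x ^ 2 - 1) ^ 2 ∂(torusVol d) := by
  have hc := continuous_of_mem hu
  have hp := continuous_pderiv hu
  unfold energy
  rw [integral_add (integrable_of_continuous (by fun_prop))
    (integrable_of_continuous (by fun_prop)), integral_const_mul, integral_const_mul,
    integral_finsetSum _ fun i _ => integrable_of_continuous (by fun_prop)]
  simp only [integral_pderiv_sq hu]
  rw [Finset.sum_comm]
  congr 2
  refine Finset.sum_congr rfl fun k _ => ?_
  rw [freqSq, Finset.mul_sum, Finset.sum_mul]

theorem continuous_nonlin : Continuous nonlin := by unfold nonlin; fun_prop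

/-- One step of the scheme in Fourier variables. -/
theorem IsSchemeSolution.coeff_step {ν τ : ℝ} (hτ : 0 < τ) {u₀ : Torus d → ℝ}
    {u : ℕ → Torus d → ℝ} (h : IsSchemeSolution ν τ N u₀ u) (n : ℕ) {k : Fin d → ℤ}
    (hk : k ∈ freqBox d N) :
    coeff (u (n + 1)) k - coeff (u n) k =
      ((-(τ * ν * freqSq k ^ 2) : ℝ) : ℂ) * coeff (u (n + 1)) k -
        ((τ * freqSq k : ℝ) : ℂ) * coeff (fun y => nonlin (u n y)) k := by
  have hw := eq_trigPoly_of_mem (h.mem (n + 1))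
  have e : (fun x => u (n + 1) x - u n x) = trigPoly N fun k =>
      ((-(τ * ν * freqSq k ^ 2) : ℝ) : ℂ) * coeff (u (n + 1)) k -
        ((τ * freqSq k : ℝ) : ℂ) * coeff (fun y => nonlin (u n y)) k := by
    funext x
    have hs := h.step n x
    rw [div_eq_iff hτ.ne'] at hs
    rw [hs, piN_eq_trigPoly, lap_trigPoly]
    conv_lhs => rw [hw]
    rw [lap_trigPoly, lap_trigPoly, mul_trigPoly, mul_comm, mul_add, mul_trigPoly, mul_trigPoly,
      ← trigPoly_sub, sub_eq_add_neg, ← neg_one_mul (trigPoly N (fun k : Fin d → ℤ =>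
        ((τ * freqSq k : ℝ) : ℂ) * coeff (fun y => nonlin (u n y)) k) x), mul_trigPoly]
    congr 2
    · funext k; push_cast; ring
    · funext k; push_cast; ring
  rw [← coeff_sub (integrable_of_continuous (continuous_of_mem (h.mem (n + 1))))
    (integrable_of_continuous (continuous_of_mem (h.mem n))), e, coeff_trigPoly _ hk]
  refine ((hermitian_coeff _).real_mul ?_).sub ((hermitian_coeff _).real_mul ?_)
  · intro k; rw [freqSq_neg]
  · intro k; rw [freqSq_neg]

/-- For `q ≥ 1`, eliminating `f` turns the left side into exactly `-|a - b|² (1/(τq) + νq/2)`, and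
AM-GM bounds the bracket below by `√(2ν/τ) = R`. The defect is the square `(1 - Rτq/2)²` appearing
below. For `q = 0` the mode does not move. -/
theorem mode_energy_le {ν τ R q : ℝ} (hτ : 0 < τ) (hq : q = 0 ∨ 1 ≤ q) (hR : R ^ 2 * τ = 2 * ν)
    {a b f : ℂ} (h : a - b = ((-(τ * ν * q ^ 2) : ℝ) : ℂ) * a - ((τ * q : ℝ) : ℂ) * f) :
    1 / 2 * ν * (q * ‖a‖ ^ 2) - 1 / 2 * ν * (q * ‖b‖ ^ 2) +
      ((a - b) * (starRingEnd ℂ) f).re ≤ -R * ‖a - b‖ ^ 2 := by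
  rcases hq with rfl | hq
  · have : a - b = 0 := by simpa using h
    simp [this]
  have h1 := congrArg Complex.re h
  have h2 := congrArg Complex.im h
  simp only [Complex.sub_re, Complex.sub_im, Complex.re_ofReal_mul, Complex.im_ofReal_mul] at h1 h2
  simp only [← Complex.normSq_eq_norm_sq, Complex.normSq_apply, Complex.mul_re, Complex.sub_re,
    Complex.sub_im, Complex.conj_re, Complex.conj_im]
  have hτq : 0 < τ * q := by positivity
  refine le_of_mul_le_mul_left ?_ hτq
  set x := a.re - b.re with hx
  set y := a.im - b.im with hy
  have hb1 : b.re = a.re - x := by rw [hx]; ring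
  have hb2 : b.im = a.im - y := by rw [hy]; ring
  rw [hb1, hb2]
  have hν : ν = R ^ 2 * τ / 2 := by linarith
  have key : 0 ≤ (x * x + y * y) * (1 - R * τ * q / 2) ^ 2 :=
    mul_nonneg (add_nonneg (mul_self_nonneg x) (mul_self_nonneg y)) (sq_nonneg _)
  have hf1 : τ * q * f.re = -(τ * ν * q ^ 2) * a.re - x := by linarith
  have hf2 : τ * q * f.im = -(τ * ν * q ^ 2) * a.im - y := by linarith
  have : τ * q * (1 / 2 * ν * (q * (a.re * a.re + a.im * a.im)) - 1 / 2 * ν *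
      (q * ((a.re - x) * (a.re - x) + (a.im - y) * (a.im - y))) + (x * f.re - y * -f.im)) -
      τ * q * (-R * (x * x + y * y)) = -((x * x + y * y) * (1 - R * τ * q / 2) ^ 2) := by
    rw [hν] at hf1 hf2 ⊢
    linear_combination x * hf1 + y * hf2
  linarith

/-- One step of the scheme does not increase the energy if `3/2 ‖u‖_∞² ≤ √(2ν/τ)` holds before and
after the step. -/
theorem energy_le_of_bounded {ν τ L : ℝ} (hν : 0 < ν) (hτ : 0 < τ)
    {v w : Torus d → ℝ} (hv : v ∈ trigSpace d N) (hw : w ∈ trigSpace d N)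
    (hstep : ∀ k ∈ freqBox d N, coeff w k - coeff v k =
      ((-(τ * ν * freqSq k ^ 2) : ℝ) : ℂ) * coeff w k -
        ((τ * freqSq k : ℝ) : ℂ) * coeff (fun y => nonlin (v y)) k)
    (hvL : ∀ᵐ x ∂(torusVol d), |v x| ≤ L) (hwL : ∀ᵐ x ∂(torusVol d), |w x| ≤ L)
    (hL : 9 * L ^ 4 * τ ≤ 8 * ν) : energy ν w ≤ energy ν v := by
  have cv := continuous_of_mem hv
  have cw := continuous_of_mem hw
  have hδ : (fun x => w x - v x) ∈ trigSpace d N := Submodule.sub_mem _ hw hv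
  have cf : Continuous fun y => nonlin (v y) := continuous_nonlin.comp cv
  set R := √(2 * ν / τ) with hR
  have hR2 : R ^ 2 * τ = 2 * ν := by
    rw [hR, Real.sq_sqrt (by positivity)]; field_simp
  have hLR : 3 / 2 * L ^ 2 ≤ R := by
    refine Real.le_sqrt_of_sq_le ?_
    rw [le_div_iff₀ hτ]; nlinarith
  have hcoeff : ∀ k, coeff (fun x => w x - v x) k = coeff w k - coeff v k :=
    coeff_sub (integrable_of_continuous cw) (integrable_of_continuous cv)
  have h1 := Finset.sum_le_sum fun k hk => mode_energy_le (R := R) hτ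
    (by by_cases h : k = 0
        · exact Or.inl (by rw [h, freqSq_zero])
        · exact Or.inr (one_le_freqSq h)) hR2 (hstep k hk)
  rw [Finset.sum_add_distrib, Finset.sum_sub_distrib, ← Finset.mul_sum, ← Finset.mul_sum,
    ← Finset.mul_sum] at h1
  simp only [← hcoeff] at h1
  rw [← integral_mul_of_mem hδ (integrable_of_continuous cf), ← integral_sq_of_mem hδ] at h1
  have h2 : ∫ x, (1 / 4 * (w x ^ 2 - 1) ^ 2 - 1 / 4 * (v x ^ 2 - 1) ^ 2) ∂(torusVol d) ≤
      ∫ x, ((w x - v x) * nonlin (v x) + R * (w x - v x) ^ 2) ∂(torusVol d) := by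
    refine integral_mono_ae (integrable_of_continuous (by fun_prop))
      (integrable_of_continuous (by fun_prop)) ?_
    filter_upwards [hvL, hwL] with x h1 h2
    -- This is the quotient of the Taylor remainder of `(z² - 1)²/4` by `(w - v)²`. Its coefficients
    -- add up to `3/2`, so it is at most `(3/2)L² ≤ R`.
    have hG : 3 / 4 * v x ^ 2 + 1 / 2 * (v x * w x) + 1 / 4 * w x ^ 2 - 1 / 2 ≤ R := by
      have e1 : v x ^ 2 ≤ L ^ 2 := sq_le_sq.mpr (h1.trans (le_abs_self L))
      have e2 : w x ^ 2 ≤ L ^ 2 := sq_le_sq.mpr (h2.trans (le_abs_self L))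
      nlinarith [sq_nonneg (v x - w x)]
    have := mul_le_mul_of_nonneg_right hG (sq_nonneg (w x - v x))
    have e : 1 / 4 * (w x ^ 2 - 1) ^ 2 - 1 / 4 * (v x ^ 2 - 1) ^ 2 = (w x - v x) * nonlin (v x) +
        (3 / 4 * v x ^ 2 + 1 / 2 * (v x * w x) + 1 / 4 * w x ^ 2 - 1 / 2) * (w x - v x) ^ 2 := by
      unfold nonlin; ring
    linarith
  rw [integral_sub (integrable_of_continuous (by fun_prop))
    (integrable_of_continuous (by fun_prop)), integral_const_mul, integral_const_mul,
    integral_add (integrable_of_continuous (by fun_prop))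
    (integrable_of_continuous (by fun_prop)), integral_const_mul] at h2
  rw [energy_eq ν hw, energy_eq ν hv]
  linarith

/-! ### Induction over the time steps. -/

/-- Both multipliers of the scheme vanish at `k = 0`, so the mean is conserved. The smoothing bounds
rely on this. -/
theorem IsSchemeSolution.coeff_zero {ν τ : ℝ} (hτ : 0 < τ) {u₀ : Torus d → ℝ}
    {u : ℕ → Torus d → ℝ} (h : IsSchemeSolution ν τ N u₀ u)
    (h0 : ∫ x, u₀ x ∂(torusVol d) = 0) (n : ℕ) : coeff (u n) 0 = 0 := by
  have hbox : (0 : Fin d → ℤ) ∈ freqBox d N := by simp [freqBox]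
  induction n with
  | zero =>
    rw [h.init, coeff_piN N u₀ hbox, coeff_eq_integral]
    simp [mFourier_zero, h0, integral_complex_ofReal]
  | succ n ih =>
    have := h.coeff_step hτ n hbox
    simpa [freqSq_zero, ih] using this

theorem bounded_of_eLpNorm_top_le {u : Torus d → ℝ} {L : ℝ} (hL : 0 ≤ L)
    (h : eLpNorm u ∞ (torusVol d) ≤ ENNReal.ofReal L) : ∀ᵐ x ∂(torusVol d), |u x| ≤ L := by
  rw [eLpNorm_exponent_top] at h
  filter_upwards [enorm_ae_le_eLpNormEssSup u (torusVol d)] with x hx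
  have := hx.trans h
  rw [← ofReal_norm, ENNReal.ofReal_le_ofReal_iff hL] at this
  simpa using this

/-- Energy stability follows if one step of the scheme preserves the bound `9 L⁴ τ = 8 ν`, for
data whose energy does not exceed the initial energy. -/
theorem conditionallyEnergyStable_of_step {T : ℝ → ℝ → ℝ}
    (H : ∀ (ν τ L E : ℝ) (N : ℕ), 0 < ν → 0 < τ → 2 ≤ N → 0 < L → 9 * L ^ 4 * τ = 8 * ν → 0 ≤ E →
      τ ≤ T ν E → ∀ v w : Torus d → ℝ, v ∈ trigSpace d N → w ∈ trigSpace d N → coeff v 0 = 0 →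
      (∀ k ∈ freqBox d N, coeff w k - coeff v k =
        ((-(τ * ν * freqSq k ^ 2) : ℝ) : ℂ) * coeff w k -
        ((τ * freqSq k : ℝ) : ℂ) * coeff (fun y => nonlin (v y)) k) →
      (∀ᵐ x ∂(torusVol d), |v x| ≤ L) → energy ν v ≤ E → ∀ᵐ x ∂(torusVol d), |w x| ≤ L) :
    ConditionallyEnergyStable d T := by
  intro ν τ N hν hτ hN u₀ _ hmean u hu L₀ hL₀ hLinf hτL hτT
  -- `L` is the largest sup bound compatible with the energy estimate at the given `τ`, rather than
  -- `L₀`: the sup norm may grow, but not beyond this level.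
  obtain ⟨L, hL, hL4⟩ : ∃ L : ℝ, 0 < L ∧ 9 * L ^ 4 * τ = 8 * ν := by
    refine ⟨(8 * ν / (9 * τ)) ^ (1 / 4 : ℝ), by positivity, ?_⟩
    rw [← Real.rpow_natCast, ← Real.rpow_mul (by positivity)]
    norm_num
    field_simp
  have hE : 0 ≤ energy ν (u 0) := integral_nonneg fun x => by positivity
  have h00 : L₀ ≤ L := by
    by_cases h : L₀ = 0
    · rw [h]; exact hL.le
    have h1 := hτL h
    rw [le_div_iff₀ (by positivity)] at h1
    refine le_of_pow_le_pow_left₀ (n := 4) (by norm_num) hL.le ?_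
    nlinarith
  have key : ∀ n, (∀ᵐ x ∂(torusVol d), |u n x| ≤ L) ∧ energy ν (u n) ≤ energy ν (u 0) := by
    intro n
    induction n with
    | zero =>
      refine ⟨?_, le_rfl⟩
      filter_upwards [bounded_of_eLpNorm_top_le hL₀ hLinf.le] with x hx using hx.trans h00
    | succ n ih =>
      have hw := H ν τ L _ N hν hτ hN hL hL4 hE hτT (u n) (u (n + 1)) (hu.mem n) (hu.mem (n + 1))
        (hu.coeff_zero hτ hmean n) (fun k hk => hu.coeff_step hτ n hk) ih.1 ih.2
      exact ⟨hw, (energy_le_of_bounded hν hτ (hu.mem n) (hu.mem (n + 1))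
        (fun k hk => hu.coeff_step hτ n hk) ih.1 hw hL4.le).trans ih.2⟩
  intro n
  exact energy_le_of_bounded hν hτ (hu.mem n) (hu.mem (n + 1))
    (fun k hk => hu.coeff_step hτ n hk) (key n).1 (key (n + 1)).1 hL4.le

/-! ### Lattice sums dominated by products of one-dimensional profiles. -/

/-- The cube root of `max |j| 1`. -/
def cbrtAbs (j : ℤ) : ℝ := (max |(j : ℝ)| 1) ^ (1 / 3 : ℝ)

/-- The summable profile `t⁻² (1 + c t)⁻²` with `t = (max |j| 1)^{1/3}`. -/
def profile (c : ℝ) (j : ℤ) : ℝ := (cbrtAbs j ^ 2 * (1 + c * cbrtAbs j) ^ 2)⁻¹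

theorem cbrtAbs_pow_three (j : ℤ) : cbrtAbs j ^ 3 = max |(j : ℝ)| 1 := by
  rw [cbrtAbs, ← Real.rpow_natCast, ← Real.rpow_mul (by positivity)]
  norm_num

theorem one_le_cbrtAbs (j : ℤ) : 1 ≤ cbrtAbs j :=
  Real.one_le_rpow (le_max_right _ _) (by norm_num)

theorem profile_nonneg (c : ℝ) (j : ℤ) : 0 ≤ profile c j := by
  unfold profile; positivity

/-- The maximum with `1` in `cbrtAbs` is harmless because a nonzero frequency has `freqSq k ≥ 1`
even when its `i`-th entry is zero. -/
theorem cbrtAbs_pow_six_le {k : Fin d → ℤ} (hk : k ≠ 0) (i : Fin d) :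
    cbrtAbs (k i) ^ 6 ≤ freqSq k := by
  have : cbrtAbs (k i) ^ 6 = (max |(k i : ℝ)| 1) ^ 2 := by rw [← cbrtAbs_pow_three]; ring
  rw [this]
  rcases max_cases |(k i : ℝ)| 1 with ⟨h, _⟩ | ⟨h, _⟩
  · rw [h, sq_abs]; exact sq_le_freqSq k i
  · rw [h, one_pow]; exact one_le_freqSq hk

/-- With `t = n^{1/3}` one has `dn = 3t² dt`, so the sum is comparable to `∫ 3 dt/(1+ct)² = 3/c`.
The discrete version telescopes against `(3/c)·ct/(1+ct)`. -/
theorem sum_range_profile_le {c : ℝ} (hc : 0 < c) (M : ℕ) :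
    ∑ n ∈ Finset.range M, profile c ((n : ℤ) + 1) ≤ 3 / c := by
  set t : ℕ → ℝ := fun n => (n : ℝ) ^ (1 / 3 : ℝ) with ht
  have ht0 : ∀ n, 0 ≤ t n := fun n => by positivity
  have ht3 : ∀ n, t n ^ 3 = n := fun n => by
    rw [ht]; dsimp only
    rw [← Real.rpow_natCast, ← Real.rpow_mul (by positivity)]; norm_num
  have hst : ∀ n : ℕ, cbrtAbs ((n : ℤ) + 1) = t (n + 1) := fun n => by
    rw [cbrtAbs, ht]
    congr 1
    push_cast
    rw [abs_of_nonneg (by positivity), max_eq_left (by linarith [n.cast_nonneg (α := ℝ)])]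
  have key : ∑ n ∈ Finset.range M, profile c ((n : ℤ) + 1) ≤ 3 / c * (c * t M / (1 + c * t M)) := by
    induction M with
    | zero => simp only [Finset.range_zero, Finset.sum_empty]; have := ht0 0; positivity
    | succ n ih =>
      rw [Finset.sum_range_succ]
      refine (add_le_add_left ih _).trans ?_
      have h1 : 1 ≤ t (n + 1) := by rw [← hst]; exact one_le_cbrtAbs _
      have h2 := ht0 n
      have h3 : t (n + 1) ^ 3 - t n ^ 3 = 1 := by rw [ht3, ht3]; push_cast; ring
      rw [profile, hst]
      generalize t (n + 1) = x at *
      generalize t n = y at *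
      have hyx : y ≤ x := by
        by_contra! h
        have := pow_lt_pow_left₀ h (by linarith) (n := 3) (by norm_num)
        linarith
      have hx : 0 < x := by linarith
      -- Here `x³ - y³ = 1`, the discrete form of `dn = 3t² dt`.
      have h5 : 1 ≤ 3 * x ^ 2 * (x - y) := by
        have : 1 = (x ^ 2 + x * y + y ^ 2) * (x - y) := by rw [← h3]; ring
        rw [this]
        refine mul_le_mul_of_nonneg_right ?_ (by linarith)
        nlinarith
      have h6 : (x ^ 2 * (1 + c * x) ^ 2)⁻¹ ≤ 3 * (x - y) / (1 + c * x) ^ 2 := by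
        rw [inv_eq_one_div, div_le_div_iff₀ (by positivity) (by positivity), one_mul]
        have : 0 < (1 + c * x) ^ 2 := by positivity
        nlinarith
      have h7 : 3 * (x - y) / (1 + c * x) ^ 2 ≤ 3 * (x - y) / ((1 + c * x) * (1 + c * y)) := by
        refine div_le_div_of_nonneg_left (by linarith) (by positivity) ?_
        rw [pow_two]
        gcongr
      have h8 : 3 / c * (c * x / (1 + c * x)) - 3 / c * (c * y / (1 + c * y)) =
          3 * (x - y) / ((1 + c * x) * (1 + c * y)) := by
        field_simp
        ring
      linarith
  refine key.trans ?_
  have h0 := ht0 M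
  have : c * t M / (1 + c * t M) ≤ 1 := by
    rw [div_le_one (by positivity)]; linarith
  have h3 : 0 < 3 / c := by positivity
  nlinarith

theorem profile_neg (c : ℝ) (j : ℤ) : profile c (-j) = profile c j := by
  simp [profile, cbrtAbs]

theorem sum_Icc_profile_le {c : ℝ} (hc : 0 < c) (N : ℕ) :
    ∑ j ∈ Finset.Icc (-(N : ℤ)) N, profile c j ≤ 9 / c := by
  have h : ∑ j ∈ Finset.Icc (-(N : ℤ)) N, profile c j =
      profile c 0 + 2 * ∑ n ∈ Finset.range N, profile c ((n : ℤ) + 1) := by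
    induction N with
    | zero => simp
    | succ n ih =>
      have e : Finset.Icc (-((n + 1 : ℕ) : ℤ)) ((n + 1 : ℕ) : ℤ) =
          insert (-((n : ℤ) + 1)) (insert ((n : ℤ) + 1) (Finset.Icc (-(n : ℤ)) n)) := by
        ext j; simp only [Finset.mem_Icc, Finset.mem_insert]; push_cast; omega
      rw [e, Finset.sum_insert, Finset.sum_insert, ih, Finset.sum_range_succ, profile_neg]
      · ring
      · simp
      · simp only [Finset.mem_insert, Finset.mem_Icc, not_or]; omega
  -- The profile takes the same value at `0` and at `1`, so the central term costs one more `3/c`.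
  have h0 : profile c 0 ≤ 3 / c := by
    refine le_trans (le_of_eq ?_) (sum_range_profile_le hc 1)
    simp [profile, cbrtAbs]
  have h1 := sum_range_profile_le hc N
  have : 9 / c = 3 / c + 2 * (3 / c) := by ring
  rw [h]; linarith

/-- A lattice sum whose terms are dominated by a product of profiles. -/
theorem sum_erase_le_of_le_prod {c A : ℝ} (hc : 0 < c) (hA : 0 ≤ A) {F : (Fin d → ℤ) → ℝ}
    (hF : ∀ k ≠ 0, F k ≤ ∏ i, A * profile c (k i)) (N : ℕ) :
    ∑ k ∈ (freqBox d N).erase 0, F k ≤ (9 * A / c) ^ d := by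
  calc ∑ k ∈ (freqBox d N).erase 0, F k
      ≤ ∑ k ∈ (freqBox d N).erase 0, ∏ i, A * profile c (k i) :=
        Finset.sum_le_sum fun k hk => hF k (Finset.ne_of_mem_erase hk)
    _ ≤ ∑ k ∈ freqBox d N, ∏ i, A * profile c (k i) :=
        Finset.sum_le_sum_of_subset_of_nonneg (Finset.erase_subset _ _) fun k _ _ =>
          Finset.prod_nonneg fun i _ => mul_nonneg hA (profile_nonneg _ _)
    _ = ∏ _i : Fin d, ∑ j ∈ Finset.Icc (-(N : ℤ)) N, A * profile c j :=
        Finset.sum_prod_piFinset _ fun _ j => A * profile c j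
    _ ≤ (9 * A / c) ^ d := by
        rw [Finset.prod_const, Finset.card_univ, Fintype.card_fin, ← Finset.mul_sum]
        refine pow_le_pow_left₀ (mul_nonneg hA (Finset.sum_nonneg fun j _ => profile_nonneg _ _)) ?_ _
        refine (mul_le_mul_of_nonneg_left (sum_Icc_profile_le hc N) hA).trans (le_of_eq ?_)
        ring

theorem exists_subset_freqBox (s : Finset (Fin d → ℤ)) : ∃ N, s ⊆ freqBox d N := by
  refine ⟨s.sup fun k => Finset.univ.sup fun i => (k i).natAbs, fun k hk => ?_⟩
  have h1 := Finset.le_sup (f := fun k : Fin d → ℤ => Finset.univ.sup fun i => (k i).natAbs) hk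
  simp only [freqBox, Fintype.mem_piFinset, Finset.mem_Icc]
  intro i
  have h2 := Finset.le_sup (f := fun i => (k i).natAbs) (Finset.mem_univ i)
  have h3 := h2.trans h1
  omega

/-- A bound uniform in the finite set, hence a source of summability. The zero mode stays separate
because the symbol equals `1` there, and drops out for mean-zero data. -/
theorem sum_le_of_le_prod {c A : ℝ} (hc : 0 < c) (hA : 0 ≤ A) {F : (Fin d → ℤ) → ℝ}
    (h0 : ∀ k, 0 ≤ F k) (hF : ∀ k ≠ 0, F k ≤ ∏ i, A * profile c (k i))
    (s : Finset (Fin d → ℤ)) : ∑ k ∈ s, F k ≤ F 0 + (9 * A / c) ^ d := by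
  obtain ⟨N, hN⟩ := exists_subset_freqBox s
  have hbox : (0 : Fin d → ℤ) ∈ freqBox d N := by simp [freqBox]
  refine (Finset.sum_le_sum_of_subset_of_nonneg hN fun k _ _ => h0 k).trans ?_
  rw [← Finset.add_sum_erase _ _ hbox]
  exact add_le_add le_rfl (sum_erase_le_of_le_prod hc hA hF N)

theorem pow_le_one_add {y : ℝ} (hy : 0 ≤ y) {a b n : ℕ} (hab : a + b ≤ n) :
    y ^ a * (1 + y) ^ b ≤ 2 ^ b * (1 + y ^ n) := by
  rcases le_total y 1 with h | h
  · have h1 : y ^ a ≤ 1 := pow_le_one₀ hy h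
    have h2 : (1 + y) ^ b ≤ 2 ^ b := pow_le_pow_left₀ (by linarith) (by linarith) b
    have h3 : 0 ≤ y ^ n := by positivity
    have h4 : (0 : ℝ) < 2 ^ b := by positivity
    have h5 := mul_le_mul h1 h2 (by positivity) (by norm_num)
    nlinarith
  · have h2 : (1 + y) ^ b ≤ 2 ^ b * y ^ b := by
      rw [← mul_pow]; exact pow_le_pow_left₀ (by linarith) (by linarith) b
    have h3 : y ^ (a + b) ≤ y ^ n := pow_le_pow_right₀ h hab
    have h4 : (0 : ℝ) < 2 ^ b := by positivity
    calc y ^ a * (1 + y) ^ b ≤ y ^ a * (2 ^ b * y ^ b) := by gcongr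
      _ = 2 ^ b * y ^ (a + b) := by rw [pow_add]; ring
      _ ≤ 2 ^ b * (1 + y ^ n) := by gcongr; linarith

/-! ### Pointwise bounds for the multipliers, with `c¹² = ντ`. -/

/-- The multiplier of `(1 + c¹² Δ²)⁻¹` is dominated by squared profiles. -/
theorem symbol_le_sq_profile {c : ℝ} (hc : 0 < c) {k : Fin d → ℤ} (hk : k ≠ 0) (i : Fin d) :
    (1 + c ^ 12 * freqSq k ^ 2)⁻¹ ≤ (4 / c ^ 2 * profile c (k i)) ^ 2 := by
  have ht := one_le_cbrtAbs (k i)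
  have hq := cbrtAbs_pow_six_le hk i
  rw [profile]
  generalize cbrtAbs (k i) = t at *
  have ht0 : 0 < t := by linarith
  have h1 : (t ^ 6) ^ 2 ≤ freqSq k ^ 2 := pow_le_pow_left₀ (by positivity) hq 2
  have h2 := pow_le_one_add (y := c * t) (by positivity) (a := 4) (b := 4) (n := 12) (by norm_num)
  have e : (4 / c ^ 2 * (t ^ 2 * (1 + c * t) ^ 2)⁻¹) ^ 2 =
      16 / ((c * t) ^ 4 * (1 + c * t) ^ 4) := by field_simp; norm_num
  rw [e, inv_eq_one_div, div_le_div_iff₀ (by have := freqSq_nonneg k; positivity) (by positivity)]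
  have h3 : (c * t) ^ 12 ≤ c ^ 12 * freqSq k ^ 2 := by
    calc (c * t) ^ 12 = c ^ 12 * (t ^ 6) ^ 2 := by ring
      _ ≤ _ := by gcongr
  linarith

theorem symbol_nonneg {β : ℝ} (hβ : 0 < β) (k : Fin d → ℤ) : 0 ≤ (1 + β * freqSq k ^ 2)⁻¹ := by
  positivity

theorem symbol_le_one {β : ℝ} (hβ : 0 < β) (k : Fin d → ℤ) : (1 + β * freqSq k ^ 2)⁻¹ ≤ 1 :=
  inv_le_one_of_one_le₀ (by have := mul_nonneg hβ.le (sq_nonneg (freqSq k)); linarith)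

/-- The symbol is at most `1`, hence at most its own square root, which `symbol_le_sq_profile`
controls. -/
theorem symbol_le_profile {c : ℝ} (hc : 0 < c) {k : Fin d → ℤ} (hk : k ≠ 0) (i : Fin d) :
    (1 + c ^ 12 * freqSq k ^ 2)⁻¹ ≤ 4 / c ^ 2 * profile c (k i) := by
  have h1 := symbol_le_sq_profile hc hk i
  have h2 := symbol_le_one (pow_pos hc 12) k
  have h3 := symbol_nonneg (pow_pos hc 12) k
  have h4 : 0 ≤ 4 / c ^ 2 * profile c (k i) := mul_nonneg (by positivity) (profile_nonneg _ _)
  refine le_of_pow_le_pow_left₀ (n := 2) (by norm_num) h4 (le_trans ?_ h1)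
  nlinarith

/-- In two dimensions the symbol is at most the square of either directional factor, hence at most
their product. -/
theorem symbol_le_prod {c : ℝ} (hc : 0 < c) (hd : d = 1 ∨ d = 2) {k : Fin d → ℤ} (hk : k ≠ 0) :
    (1 + c ^ 12 * freqSq k ^ 2)⁻¹ ≤ ∏ i, 4 / c ^ 2 * profile c (k i) := by
  rcases hd with rfl | rfl
  · rw [Fin.prod_univ_one]; exact symbol_le_profile hc hk 0
  · rw [Fin.prod_univ_two]
    have h0 := symbol_le_sq_profile hc hk 0
    have h1 := symbol_le_sq_profile hc hk 1
    have h2 := symbol_nonneg (pow_pos hc 12) k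
    have h3 : ∀ i, 0 ≤ 4 / c ^ 2 * profile c (k i) :=
      fun i => mul_nonneg (by positivity) (profile_nonneg _ _)
    refine le_of_pow_le_pow_left₀ (n := 2) (by norm_num) (mul_nonneg (h3 0) (h3 1)) ?_
    rw [mul_pow, pow_two]
    exact mul_le_mul h0 h1 h2 (sq_nonneg _)

/-- A bound for the multiplier of `-Δ (1 + c¹² Δ²)⁻¹`. -/
theorem lapSymbol_mul_le {c : ℝ} (hc : 0 < c) (k : Fin d → ℤ) :
    (freqSq k * (1 + c ^ 12 * freqSq k ^ 2)⁻¹) * (c ^ 6 * (1 + c ^ 6 * freqSq k)) ≤ 2 := by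
  have hq := freqSq_nonneg k
  rw [mul_assoc, ← mul_assoc (_⁻¹), mul_comm, mul_assoc, ← div_eq_inv_mul, div_mul_eq_mul_div,
    div_le_iff₀ (by positivity)]
  -- With `z = c⁶ freqSq k` the claim is `z + z² ≤ 2(1 + z²)`.
  nlinarith [sq_nonneg (c ^ 6 * freqSq k - 1)]

/-- The cube root `e` of the symbol is the natural unknown: its `ℓ^{4/3}` norm involves `e⁴`, which
is two factors `e²`, and its `ℓ²` norm involves `e⁶`, which is three. Thus `d = 2` and `d = 3` get
one profile per coordinate. -/
theorem cbrt_lapSymbol_sq_le_profile {c e : ℝ} (hc : 0 < c) {k : Fin d → ℤ} (hk : k ≠ 0)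
    (he : e ^ 3 = freqSq k * (1 + c ^ 12 * freqSq k ^ 2)⁻¹) (i : Fin d) :
    e ^ 2 ≤ 8 / c ^ 6 * profile c (k i) := by
  have hq1 := one_le_freqSq hk
  have h1 := lapSymbol_mul_le hc k
  rw [← he] at h1
  have ht := one_le_cbrtAbs (k i)
  have hq := cbrtAbs_pow_six_le hk i
  rw [profile]
  generalize cbrtAbs (k i) = t at *
  have ht0 : 0 < t := by linarith
  have he0 : 0 ≤ e ^ 3 := by rw [he]; positivity
  have h2 := pow_le_one_add (y := c * t) (by positivity) (a := 3) (b := 3) (n := 6) (by norm_num)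
  have h3 : (c * t) ^ 6 ≤ c ^ 6 * freqSq k := by
    calc (c * t) ^ 6 = c ^ 6 * t ^ 6 := by ring
      _ ≤ _ := by gcongr
  have h4 : e ^ 3 * (c ^ 6 * ((c * t) ^ 3 * (1 + c * t) ^ 3)) ≤ 16 := by
    have : (c * t) ^ 3 * (1 + c * t) ^ 3 ≤ 8 * (1 + c ^ 6 * freqSq k) := by linarith
    calc e ^ 3 * (c ^ 6 * ((c * t) ^ 3 * (1 + c * t) ^ 3))
        ≤ e ^ 3 * (c ^ 6 * (8 * (1 + c ^ 6 * freqSq k))) := by gcongr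
      _ = 8 * (e ^ 3 * (c ^ 6 * (1 + c ^ 6 * freqSq k))) := by ring
      _ ≤ 16 := by linarith
  refine le_of_pow_le_pow_left₀ (n := 3) (by norm_num) (by positivity) ?_
  have e1 : (8 / c ^ 6 * (t ^ 2 * (1 + c * t) ^ 2)⁻¹) ^ 3 =
      512 / (c ^ 6 * ((c * t) ^ 3 * (1 + c * t) ^ 3)) ^ 2 := by field_simp; norm_num
  rw [e1, le_div_iff₀ (by positivity)]
  calc (e ^ 2) ^ 3 * (c ^ 6 * ((c * t) ^ 3 * (1 + c * t) ^ 3)) ^ 2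
      = (e ^ 3 * (c ^ 6 * ((c * t) ^ 3 * (1 + c * t) ^ 3))) ^ 2 := by ring
    _ ≤ 16 ^ 2 := by gcongr
    _ ≤ 512 := by norm_num

/-- In one dimension only one factor `e²` of `e⁴` is needed for summability; the other is bounded
uniformly by this. -/
theorem cbrt_lapSymbol_sq_le {c e : ℝ} (hc : 0 < c) {k : Fin d → ℤ}
    (he : e ^ 3 = freqSq k * (1 + c ^ 12 * freqSq k ^ 2)⁻¹) : e ^ 2 ≤ 2 / c ^ 4 := by
  have hq := freqSq_nonneg k
  have h1 := lapSymbol_mul_le hc k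
  rw [← he] at h1
  have he0 : 0 ≤ e ^ 3 := by rw [he]; positivity
  have h2 : e ^ 3 * c ^ 6 ≤ 2 := by
    refine le_trans ?_ h1
    gcongr
    have : 0 ≤ c ^ 6 * freqSq k := by positivity
    nlinarith [pow_pos hc 6]
  refine le_of_pow_le_pow_left₀ (n := 3) (by norm_num) (by positivity) ?_
  rw [div_pow, le_div_iff₀ (by positivity)]
  calc (e ^ 2) ^ 3 * (c ^ 4) ^ 3 = (e ^ 3 * c ^ 6) ^ 2 := by ring
    _ ≤ 2 ^ 2 := by gcongr
    _ ≤ 2 ^ 3 := by norm_num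

/-! ### One step of the scheme written with the resolvent. -/

theorem trigPoly_congr {a b : (Fin d → ℤ) → ℂ} (h : ∀ k ∈ freqBox d N, a k = b k) :
    trigPoly N a = trigPoly N b := by
  funext x
  simp only [trigPoly]
  rw [Finset.sum_congr rfl fun k hk => by rw [h k hk]]

theorem coeff_eq_zero_of_mem {φ : Torus d → ℝ} (hφ : φ ∈ trigSpace d N) {k : Fin d → ℤ}
    (hk : k ∉ freqBox d N) : coeff φ k = 0 := by
  rw [eq_trigPoly_of_mem hφ, coeff_trigPoly_eq_ite (hermitian_coeff φ), if_neg hk]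

theorem resolvent_of_mem (β : ℝ) {φ : Torus d → ℝ} (hφ : φ ∈ trigSpace d N) :
    resolvent β φ = trigPoly N fun k => (((1 + β * freqSq k ^ 2)⁻¹ : ℝ) : ℂ) * coeff φ k := by
  funext x
  rw [resolvent, trigPoly, tsum_eq_sum]
  intro k hk
  rw [coeff_eq_zero_of_mem hφ hk]; ring

theorem resolvent_piN (β : ℝ) (g : Torus d → ℝ) : resolvent β (piN N g) =
    trigPoly N fun k => (((1 + β * freqSq k ^ 2)⁻¹ : ℝ) : ℂ) * coeff g k := by
  rw [resolvent_of_mem β (piN_mem N g)]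
  exact trigPoly_congr fun k hk => by rw [coeff_piN N g hk]

theorem lap_resolvent_piN (β : ℝ) (g : Torus d → ℝ) : lap (resolvent β (piN N g)) =
    trigPoly N fun k => -((freqSq k * (1 + β * freqSq k ^ 2)⁻¹ : ℝ) : ℂ) * coeff g k := by
  rw [resolvent_piN, lap_trigPoly]
  congr 1; funext k; push_cast; ring

/-- The scheme solved for the new iterate, mode by mode. -/
theorem coeff_eq_of_step {ν τ q : ℝ} (hν : 0 < ν) (hτ : 0 < τ) {a b f : ℂ}
    (h : a - b = ((-(τ * ν * q ^ 2) : ℝ) : ℂ) * a - ((τ * q : ℝ) : ℂ) * f) :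
    a = (((1 + ν * τ * q ^ 2)⁻¹ : ℝ) : ℂ) * b +
      τ * (-((q * (1 + ν * τ * q ^ 2)⁻¹ : ℝ) : ℂ) * f) := by
  have hne : ((1 + ν * τ * q ^ 2 : ℝ) : ℂ) ≠ 0 := by
    have : 0 < 1 + ν * τ * q ^ 2 := by positivity
    exact_mod_cast this.ne'
  have h1 : ((1 + ν * τ * q ^ 2 : ℝ) : ℂ) * a = b - ((τ * q : ℝ) : ℂ) * f := by
    push_cast at h ⊢; linear_combination h
  have h2 : a = ((1 + ν * τ * q ^ 2 : ℝ) : ℂ)⁻¹ * (b - ((τ * q : ℝ) : ℂ) * f) := by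
    rw [← h1, inv_mul_cancel_left₀ hne]
  rw [h2]
  push_cast
  ring

theorem eq_resolvent_of_step {ν τ : ℝ} (hν : 0 < ν) (hτ : 0 < τ) {v w f : Torus d → ℝ}
    (hv : v ∈ trigSpace d N) (hw : w ∈ trigSpace d N)
    (hstep : ∀ k ∈ freqBox d N, coeff w k - coeff v k =
      ((-(τ * ν * freqSq k ^ 2) : ℝ) : ℂ) * coeff w k -
        ((τ * freqSq k : ℝ) : ℂ) * coeff f k) (x : Torus d) :
    w x = resolvent (ν * τ) v x + τ * lap (resolvent (ν * τ) (piN N f)) x := by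
  rw [lap_resolvent_piN, resolvent_of_mem _ hv, mul_trigPoly]
  conv_lhs => rw [eq_trigPoly_of_mem hw, trigPoly_congr fun k hk =>
    coeff_eq_of_step hν hτ (hstep k hk)]
  simp only [trigPoly, add_mul, Finset.sum_add_distrib, Complex.add_re]

/-! ### Norms controlled by the energy. -/

theorem integral_sq_sub_one_le {ν E : ℝ} (hν : 0 < ν) {v : Torus d → ℝ} (hv : v ∈ trigSpace d N)
    (hE : energy ν v ≤ E) : ∫ x, (v x ^ 2 - 1) ^ 2 ∂(torusVol d) ≤ 4 * E := by
  rw [energy_eq ν hv] at hE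
  have : 0 ≤ ∑ k ∈ freqBox d N, freqSq k * ‖coeff v k‖ ^ 2 :=
    Finset.sum_nonneg fun k _ => mul_nonneg (freqSq_nonneg k) (sq_nonneg _)
  have := mul_nonneg hν.le this
  linarith

theorem sum_freqSq_coeff_le {ν E : ℝ} {v : Torus d → ℝ} (hv : v ∈ trigSpace d N)
    (hE : energy ν v ≤ E) : ν * ∑ k ∈ freqBox d N, freqSq k * ‖coeff v k‖ ^ 2 ≤ 2 * E := by
  rw [energy_eq ν hv] at hE
  have : 0 ≤ ∫ x, (v x ^ 2 - 1) ^ 2 ∂(torusVol d) := integral_nonneg fun x => sq_nonneg _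
  linarith

theorem memLp_of_continuous {v : Torus d → ℝ} (hv : Continuous v) (p : ℝ≥0∞) :
    MemLp v p (torusVol d) :=
  hv.memLp_of_hasCompactSupport (HasCompactSupport.of_compactSpace _)

theorem eLpNorm_two_sq_sub_one_le {v : Torus d → ℝ} (hv : Continuous v) {E : ℝ}
    (hE : ∫ x, (v x ^ 2 - 1) ^ 2 ∂(torusVol d) ≤ 4 * E) :
    eLpNorm (fun x => v x ^ 2 - 1) 2 (torusVol d) ≤ ENNReal.ofReal (2 * √E) := by
  rw [(memLp_of_continuous (by fun_prop) 2).eLpNorm_eq_integral_rpow_norm (by norm_num)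
    (by norm_num)]
  refine ENNReal.ofReal_le_ofReal ?_
  have e : (ENNReal.toReal 2) = 2 := by norm_num
  simp only [e, Real.rpow_two, Real.norm_eq_abs, sq_abs]
  rw [← one_div, ← Real.sqrt_eq_rpow]
  refine Real.sqrt_le_iff.mpr ⟨by positivity, hE.trans ?_⟩
  have h0 : 0 ≤ E := by
    have : 0 ≤ ∫ x, (v x ^ 2 - 1) ^ 2 ∂(torusVol d) := integral_nonneg fun x => sq_nonneg _
    linarith
  rw [mul_pow, Real.sq_sqrt h0]; norm_num

/-- With `I = ∫v⁴` and `J = ∫v²`, total mass one gives `J ≤ √I`. Hence `(√I - 1)² ≤ I - 2J + 1 ≤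
4E`, so `‖v‖₄² = √I ≤ 1 + 2√E`. -/
theorem eLpNorm_four_le {v : Torus d → ℝ} (hv : Continuous v) {E : ℝ}
    (hE : ∫ x, (v x ^ 2 - 1) ^ 2 ∂(torusVol d) ≤ 4 * E) :
    eLpNorm v 4 (torusVol d) ≤ ENNReal.ofReal √(1 + 2 * √E) := by
  rw [(memLp_of_continuous hv 4).eLpNorm_eq_integral_rpow_norm (by norm_num) (by norm_num)]
  refine ENNReal.ofReal_le_ofReal ?_
  have e : (ENNReal.toReal 4) = ((4 : ℕ) : ℝ) := by norm_num
  have e4 : ∀ x, |v x| ^ 4 = v x ^ 4 := fun x => by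
    rw [show 4 = 2 * 2 by norm_num, pow_mul, sq_abs, ← pow_mul]
  simp only [e, Real.rpow_natCast, Real.norm_eq_abs, e4]
  have h0 : 0 ≤ E := by
    have : 0 ≤ ∫ x, (v x ^ 2 - 1) ^ 2 ∂(torusVol d) := integral_nonneg fun x => sq_nonneg _
    linarith
  set I := ∫ x, v x ^ 4 ∂(torusVol d) with hI
  set J := ∫ x, v x ^ 2 ∂(torusVol d) with hJ
  have hI0 : 0 ≤ I := integral_nonneg fun x => by positivity
  have h1 : ∫ x, (v x ^ 2 - 1) ^ 2 ∂(torusVol d) = I - 2 * J + 1 := by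
    have e : ∀ x, (v x ^ 2 - 1) ^ 2 = v x ^ 4 - 2 * v x ^ 2 + 1 := fun x => by ring
    simp only [e]
    rw [integral_add (integrable_of_continuous (by fun_prop)) (integrable_const _),
      integral_sub (integrable_of_continuous (by fun_prop))
      (integrable_of_continuous (by fun_prop)), integral_const_mul]
    simp [hI, hJ]
  have h2 : 0 ≤ I - J ^ 2 := by
    have : 0 ≤ ∫ x, (v x ^ 2 - J) ^ 2 ∂(torusVol d) := integral_nonneg fun x => sq_nonneg _
    have e : ∀ x, (v x ^ 2 - J) ^ 2 = v x ^ 4 - 2 * J * v x ^ 2 + J ^ 2 := fun x => by ring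
    simp only [e] at this
    rw [integral_add (integrable_of_continuous (by fun_prop)) (integrable_const _),
      integral_sub (integrable_of_continuous (by fun_prop))
      (integrable_of_continuous (by fun_prop)), integral_const_mul, ← hI, ← hJ] at this
    simp at this
    linarith
  have h3 : √I ≤ 1 + 2 * √E := by
    have hJI : J ≤ √I := Real.le_sqrt_of_sq_le (by linarith)
    have h4 : (√I - 1) ^ 2 ≤ (2 * √E) ^ 2 := by
      rw [mul_pow, Real.sq_sqrt h0, sub_sq, Real.sq_sqrt hI0]; linarith
    have := abs_le_of_sq_le_sq h4 (by positivity)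
    linarith [(abs_le.mp this).2]
  have h5 : I ^ (((4 : ℕ) : ℝ)⁻¹) = √√I := by
    rw [Real.sqrt_eq_rpow, Real.sqrt_eq_rpow, ← Real.rpow_mul hI0]; norm_num
  rw [h5]
  exact Real.sqrt_le_sqrt h3

theorem holderTriple_four_two : ENNReal.HolderTriple 4 2 (4 / 3) := by
  constructor
  rw [ENNReal.inv_div (by norm_num) (by norm_num)]
  have h4 : (4 : ℝ≥0∞)⁻¹ = ENNReal.ofReal (1 / 4) := by
    rw [ENNReal.ofReal_div_of_pos (by norm_num)]; norm_num
  have h2 : (2 : ℝ≥0∞)⁻¹ = ENNReal.ofReal (1 / 2) := by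
    rw [ENNReal.ofReal_div_of_pos (by norm_num)]; norm_num
  have h3 : (3 / 4 : ℝ≥0∞) = ENNReal.ofReal (3 / 4) := by
    rw [ENNReal.ofReal_div_of_pos (by norm_num)]; norm_num
  rw [h4, h2, h3, ← ENNReal.ofReal_add (by norm_num) (by norm_num)]
  norm_num

/-- Hölder's inequality for `f(v) = v(v² - 1)` with `3/4 = 1/4 + 1/2`. -/
theorem eLpNorm_nonlin_le {v : Torus d → ℝ} (hv : Continuous v) {E : ℝ}
    (hE : ∫ x, (v x ^ 2 - 1) ^ 2 ∂(torusVol d) ≤ 4 * E) :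
    eLpNorm (fun x => nonlin (v x)) (4 / 3) (torusVol d) ≤
      ENNReal.ofReal (2 * √E * √(1 + 2 * √E)) := by
  have e : (fun x => nonlin (v x)) = v • fun x => v x ^ 2 - 1 := by
    funext x; simp only [nonlin, Pi.smul_apply', smul_eq_mul]; ring
  have := holderTriple_four_two
  rw [e, mul_comm, ENNReal.ofReal_mul (by positivity)]
  refine (eLpNorm_smul_le_mul_eLpNorm (p := 4) (q := 2) (memLp_of_continuous (by fun_prop) 1).1
    (memLp_of_continuous hv 1).1).trans ?_
  exact mul_le_mul' (eLpNorm_four_le hv hE) (eLpNorm_two_sq_sub_one_le hv hE)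

/-! ### Dimensions one and two: stability from an admissible pair. -/

/-- The bound on `w` sees `v` only through its energy, so nothing accumulates from step to step. -/
theorem bounded_of_kernelBounds {a b B₁ B₂ : ℝ} (hB₁ : 0 < B₁) (hB₂ : 0 < B₂)
    (hK : KernelBounds d a b B₁ B₂) {ν τ E : ℝ} (hν : 0 < ν) (hτ : 0 < τ) (hN : 2 ≤ N)
    {v w : Torus d → ℝ} (hv : v ∈ trigSpace d N) (hw : w ∈ trigSpace d N) (hv0 : coeff v 0 = 0)
    (hstep : ∀ k ∈ freqBox d N, coeff w k - coeff v k =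
      ((-(τ * ν * freqSq k ^ 2) : ℝ) : ℂ) * coeff w k -
        ((τ * freqSq k : ℝ) : ℂ) * coeff (fun y => nonlin (v y)) k)
    (hE : energy ν v ≤ E) :
    ∀ᵐ x ∂(torusVol d), |w x| ≤ B₁ * √(1 + 2 * √E) * (ν * τ) ^ (-a) +
      2 * B₂ * √E * √(1 + 2 * √E) * (τ * (ν * τ) ^ (-b)) := by
  have cv := continuous_of_mem hv
  have hE' := integral_sq_sub_one_le hν hv hE
  have hmean : ∫ x, v x ∂(torusVol d) = 0 := by
    rw [coeff_eq_integral] at hv0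
    simp only [neg_zero, mFourier_zero, ContinuousMap.one_apply, one_mul] at hv0
    rw [integral_complex_ofReal] at hv0
    exact_mod_cast hv0
  obtain ⟨h1, h2⟩ := hK ν τ N hν hτ hN
  have b1 := (h1 v (memLp_of_continuous cv 4) hmean).trans
    (mul_le_mul' le_rfl (eLpNorm_four_le cv hE'))
  have b2 := (h2 _ (memLp_of_continuous (continuous_nonlin.comp cv) (4 / 3))).trans
    (mul_le_mul' le_rfl (eLpNorm_nonlin_le cv hE'))
  rw [← ENNReal.ofReal_mul (by positivity)] at b1 b2
  filter_upwards [bounded_of_eLpNorm_top_le (by positivity) b1,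
    bounded_of_eLpNorm_top_le (by positivity) b2] with x h1 h2
  rw [eq_resolvent_of_step hν hτ hv hw hstep x]
  refine (abs_add_le _ _).trans ((add_le_add h1 h2).trans (le_of_eq ?_))
  ring

/-- The comparison of the smoothing bound with the threshold `9 L⁴ τ = 8 ν`. -/
theorem le_threshold {ν τ L x y : ℝ} (hν : 0 < ν) (hτ : 0 < τ) (hL : 0 < L)
    (hL4 : 9 * L ^ 4 * τ = 8 * ν) (hx : x ≤ 0.67 * (ν / τ) ^ (1 / 4 : ℝ))
    (hy : y ≤ 0.67 ^ 3 * (ν / τ) ^ (1 / 4 : ℝ)) : x + y ≤ L := by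
  have hs : ((ν / τ) ^ (1 / 4 : ℝ)) ^ 4 = ν / τ := by
    rw [← Real.rpow_natCast, ← Real.rpow_mul (by positivity)]; norm_num
  have hs0 : 0 < (ν / τ) ^ (1 / 4 : ℝ) := by positivity
  set s := (ν / τ) ^ (1 / 4 : ℝ)
  have hL' : L ^ 4 = 8 / 9 * (ν / τ) := by field_simp; linarith
  -- The choice `0.67` works because `0.67 + 0.67³ = 0.970763` lies just below `(8/9)^{1/4} ≈
  -- 0.97098`. The cube is chosen so that both terms lead to the same numerical constant in the
  -- bound on `τ`.
  refine (add_le_add hx hy).trans ?_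
  refine le_of_pow_le_pow_left₀ (n := 4) (by norm_num) hL.le ?_
  rw [hL', ← hs, ← add_mul, mul_pow]
  refine mul_le_mul_of_nonneg_right ?_ (by positivity)
  norm_num

/-- Comparing `β₁(ντ)^{-1/16}` with `0.67(ν/τ)^{1/4}`, and `β₂τ(ντ)^{-11/16}` with
`0.67³(ν/τ)^{1/4}`, and solving for `τ`, gives `0.67^{16/3} ν^{5/3}` times `β₁^{-16/3}` and
`β₂^{-16/9}`; the constant `0.118` lies below `0.67^{16/3}`. In logarithms every comparison is
linear. The `βᵢ` may exceed the natural values, so that they can be kept positive. -/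
theorem stable_of_kernelBounds_one {B₁ B₂ : ℝ} (hB₁ : 0 < B₁) (hB₂ : 0 < B₂)
    (hK : KernelBounds 1 (1 / 16) (11 / 16) B₁ B₂) {β₁ β₂ : ℝ → ℝ}
    (h₁ : ∀ E, 0 ≤ E → B₁ * √(1 + 2 * √E) ≤ β₁ E)
    (h₂ : ∀ E, 0 ≤ E → 2 * B₂ * √E * √(1 + 2 * √E) ≤ β₂ E) :
    ConditionallyEnergyStable 1 (fun ν E₀ => 0.118 * ν ^ (5 / 3 : ℝ) *
      min (β₁ E₀ ^ (-(16 / 3) : ℝ)) (β₂ E₀ ^ (-(16 / 9) : ℝ))) := by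
  refine conditionallyEnergyStable_of_step ?_
  intro ν τ L E N hν hτ hN hL hL4 hE hτT v w hv hw hv0 hstep _ hEv
  have hb1 : 0 < β₁ E := lt_of_lt_of_le (by positivity) (h₁ E hE)
  -- If `β₂ E = 0`, the convention `0 ^ r = 0` for `r ≠ 0` makes the time step bound zero, against
  -- `τ > 0`.
  have hb2 : 0 < β₂ E := by
    refine lt_of_le_of_ne (le_trans (by positivity) (h₂ E hE)) fun h => ?_
    rw [← h, Real.zero_rpow (by norm_num)] at hτT
    have h3 := min_le_right (β₁ E ^ (-(16 / 3) : ℝ)) 0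
    have h4 : (0 : ℝ) < 0.118 * ν ^ (5 / 3 : ℝ) := by positivity
    nlinarith
  have hlog : 3 * Real.log 0.118 ≤ 16 * Real.log 0.67 := by
    have := Real.log_le_log (by norm_num) (show (0.118 : ℝ) ^ 3 ≤ 0.67 ^ 16 by norm_num)
    rw [Real.log_pow, Real.log_pow] at this
    exact_mod_cast this
  have hτ1 : Real.log τ ≤ Real.log 0.118 + 5 / 3 * Real.log ν + -(16 / 3) * Real.log (β₁ E) := by
    have h : τ ≤ 0.118 * ν ^ (5 / 3 : ℝ) * β₁ E ^ (-(16 / 3) : ℝ) :=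
      hτT.trans (mul_le_mul_of_nonneg_left (min_le_left _ _) (by positivity))
    have := Real.log_le_log hτ h
    rwa [Real.log_mul (by positivity) (by positivity), Real.log_mul (by norm_num) (by positivity),
      Real.log_rpow hν, Real.log_rpow hb1] at this
  have hτ2 : Real.log τ ≤ Real.log 0.118 + 5 / 3 * Real.log ν + -(16 / 9) * Real.log (β₂ E) := by
    have h : τ ≤ 0.118 * ν ^ (5 / 3 : ℝ) * β₂ E ^ (-(16 / 9) : ℝ) :=
      hτT.trans (mul_le_mul_of_nonneg_left (min_le_right _ _) (by positivity))
    have := Real.log_le_log hτ h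
    rwa [Real.log_mul (by positivity) (by positivity), Real.log_mul (by norm_num) (by positivity),
      Real.log_rpow hν, Real.log_rpow hb2] at this
  filter_upwards [bounded_of_kernelBounds hB₁ hB₂ hK hν hτ hN hv hw hv0 hstep hEv] with x hx
  refine hx.trans (le_threshold hν hτ hL hL4 ?_ ?_)
  · refine (mul_le_mul_of_nonneg_right (h₁ E hE) (by positivity)).trans ?_
    rw [← Real.log_le_log_iff (by positivity) (by positivity),
      Real.log_mul (by positivity) (by positivity), Real.log_mul (by positivity) (by positivity),
      Real.log_rpow (by positivity), Real.log_rpow (by positivity),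
      Real.log_mul (by positivity) (by positivity), Real.log_div (by positivity) (by positivity)]
    linarith
  · refine (mul_le_mul_of_nonneg_right (h₂ E hE) (by positivity)).trans ?_
    rw [← Real.log_le_log_iff (by positivity) (by positivity),
      Real.log_mul (by positivity) (by positivity), Real.log_mul (by positivity) (by positivity),
      Real.log_mul (by positivity) (by positivity),
      Real.log_rpow (by positivity), Real.log_rpow (by positivity), Real.log_pow,
      Real.log_mul (by positivity) (by positivity), Real.log_div (by positivity) (by positivity)]
    push_cast
    linarith

/-- The same computation with exponents `1/8` and `7/8` gives `0.67⁸ ν³` times `β₁^{-8}` and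
`β₂^{-8/3}`, and `0.04 ≤ 0.67⁸`. -/
theorem stable_of_kernelBounds_two {B₁ B₂ : ℝ} (hB₁ : 0 < B₁) (hB₂ : 0 < B₂)
    (hK : KernelBounds 2 (1 / 8) (7 / 8) B₁ B₂) {β₁ β₂ : ℝ → ℝ}
    (h₁ : ∀ E, 0 ≤ E → B₁ * √(1 + 2 * √E) ≤ β₁ E)
    (h₂ : ∀ E, 0 ≤ E → 2 * B₂ * √E * √(1 + 2 * √E) ≤ β₂ E) :
    ConditionallyEnergyStable 2 (fun ν E₀ => 0.04 * ν ^ 3 *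
      min (β₁ E₀ ^ (-8 : ℝ)) (β₂ E₀ ^ (-(8 / 3) : ℝ))) := by
  refine conditionallyEnergyStable_of_step ?_
  intro ν τ L E N hν hτ hN hL hL4 hE hτT v w hv hw hv0 hstep _ hEv
  have hb1 : 0 < β₁ E := lt_of_lt_of_le (by positivity) (h₁ E hE)
  have hb2 : 0 < β₂ E := by
    refine lt_of_le_of_ne (le_trans (by positivity) (h₂ E hE)) fun h => ?_
    rw [← h, Real.zero_rpow (by norm_num)] at hτT
    have h3 := min_le_right (β₁ E ^ (-8 : ℝ)) 0
    have h4 : (0 : ℝ) < 0.04 * ν ^ 3 := by positivity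
    nlinarith
  have hlog : Real.log 0.04 ≤ 8 * Real.log 0.67 := by
    have := Real.log_le_log (by norm_num) (show (0.04 : ℝ) ≤ 0.67 ^ 8 by norm_num)
    rw [Real.log_pow] at this
    exact_mod_cast this
  have hτ1 : Real.log τ ≤ Real.log 0.04 + 3 * Real.log ν + -8 * Real.log (β₁ E) := by
    have h : τ ≤ 0.04 * ν ^ 3 * β₁ E ^ (-8 : ℝ) :=
      hτT.trans (mul_le_mul_of_nonneg_left (min_le_left _ _) (by positivity))
    have := Real.log_le_log hτ h
    rw [Real.log_mul (by positivity) (by positivity), Real.log_mul (by norm_num) (by positivity),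
      Real.log_pow, Real.log_rpow hb1] at this
    exact_mod_cast this
  have hτ2 : Real.log τ ≤ Real.log 0.04 + 3 * Real.log ν + -(8 / 3) * Real.log (β₂ E) := by
    have h : τ ≤ 0.04 * ν ^ 3 * β₂ E ^ (-(8 / 3) : ℝ) :=
      hτT.trans (mul_le_mul_of_nonneg_left (min_le_right _ _) (by positivity))
    have := Real.log_le_log hτ h
    rw [Real.log_mul (by positivity) (by positivity), Real.log_mul (by norm_num) (by positivity),
      Real.log_pow, Real.log_rpow hb2] at this
    exact_mod_cast this
  filter_upwards [bounded_of_kernelBounds hB₁ hB₂ hK hν hτ hN hv hw hv0 hstep hEv] with x hx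
  refine hx.trans (le_threshold hν hτ hL hL4 ?_ ?_)
  · refine (mul_le_mul_of_nonneg_right (h₁ E hE) (by positivity)).trans ?_
    rw [← Real.log_le_log_iff (by positivity) (by positivity),
      Real.log_mul (by positivity) (by positivity), Real.log_mul (by positivity) (by positivity),
      Real.log_rpow (by positivity), Real.log_rpow (by positivity),
      Real.log_mul (by positivity) (by positivity), Real.log_div (by positivity) (by positivity)]
    linarith
  · refine (mul_le_mul_of_nonneg_right (h₂ E hE) (by positivity)).trans ?_
    rw [← Real.log_le_log_iff (by positivity) (by positivity),
      Real.log_mul (by positivity) (by positivity), Real.log_mul (by positivity) (by positivity),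
      Real.log_mul (by positivity) (by positivity),
      Real.log_rpow (by positivity), Real.log_rpow (by positivity), Real.log_pow,
      Real.log_mul (by positivity) (by positivity), Real.log_div (by positivity) (by positivity)]
    push_cast
    linarith

/-! ### Dimension three: direct propagation of the sup bound. -/

theorem abs_trigPoly_le (a : (Fin d → ℤ) → ℂ) (x : Torus d) :
    |trigPoly N a x| ≤ ∑ k ∈ freqBox d N, ‖a k‖ := by
  refine (Complex.abs_re_le_norm _).trans ((norm_sum_le _ _).trans (le_of_eq ?_))
  exact Finset.sum_congr rfl fun k _ => by rw [norm_mul, norm_mFourier_apply, mul_one]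

theorem sum_eq_sum_erase {F : (Fin d → ℤ) → ℝ} (h : F 0 = 0) :
    ∑ k ∈ freqBox d N, F k = ∑ k ∈ (freqBox d N).erase 0, F k := by
  have hbox : (0 : Fin d → ℤ) ∈ freqBox d N := by simp [freqBox]
  rw [← Finset.add_sum_erase _ _ hbox, h, zero_add]

/-- A quantity dominated in each of three directions is dominated by the geometric mean, which
splits the lattice sum into one-dimensional ones. -/
theorem le_prod_three {x : ℝ} {y : Fin 3 → ℝ} (hx : 0 ≤ x) (hy : ∀ i, 0 ≤ y i)
    (h : ∀ i, x ≤ y i ^ 3) : x ≤ ∏ i, y i := by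
  rw [Fin.prod_univ_three]
  have h0 := hy 0
  have h1 := hy 1
  have h2 := hy 2
  refine le_of_pow_le_pow_left₀ (n := 3) (by norm_num) (by positivity) ?_
  calc x ^ 3 = x * x * x := by ring
    _ ≤ y 0 ^ 3 * y 1 ^ 3 * y 2 ^ 3 := by
      have := h 0
      have := h 1
      have := h 2
      gcongr
    _ = (y 0 * y 1 * y 2) ^ 3 := by ring

theorem sum_symbol_sq_div_le {c : ℝ} (hc : 0 < c) (N : ℕ) :
    ∑ k ∈ (freqBox 3 N).erase 0, (1 + c ^ 12 * freqSq k ^ 2)⁻¹ ^ 2 / freqSq k ≤ (36 / c) ^ 3 := by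
  have h := sum_erase_le_of_le_prod (d := 3) (A := 4) hc (by norm_num)
    (F := fun k => (1 + c ^ 12 * freqSq k ^ 2)⁻¹ ^ 2 / freqSq k) ?_ N
  · norm_num at h ⊢; exact h
  intro k hk
  have hq1 := one_le_freqSq hk
  refine le_prod_three (by positivity)
    (fun i => mul_nonneg (by norm_num) (profile_nonneg _ _)) fun i => ?_
  have ht := one_le_cbrtAbs (k i)
  have hq := cbrtAbs_pow_six_le hk i
  rw [profile]
  generalize cbrtAbs (k i) = t at *
  have ht0 : 0 < t := by linarith
  have h2 := pow_le_one_add (y := c * t) (by positivity) (a := 0) (b := 3) (n := 12) (by norm_num)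
  have h3 : (c * t) ^ 12 ≤ c ^ 12 * freqSq k ^ 2 := by
    calc (c * t) ^ 12 = c ^ 12 * (t ^ 6) ^ 2 := by ring
      _ ≤ _ := by gcongr
  have h4 : (1 + c * t) ^ 3 ≤ 8 * (1 + c ^ 12 * freqSq k ^ 2) := by linarith
  have h5 : (1 + c ^ 12 * freqSq k ^ 2)⁻¹ ≤ 8 / (1 + c * t) ^ 3 := by
    rw [inv_eq_one_div, div_le_div_iff₀ (by positivity) (by positivity)]; linarith
  calc (1 + c ^ 12 * freqSq k ^ 2)⁻¹ ^ 2 / freqSq k ≤ (8 / (1 + c * t) ^ 3) ^ 2 / t ^ 6 := by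
        gcongr
    _ = (4 * (t ^ 2 * (1 + c * t) ^ 2)⁻¹) ^ 3 := by field_simp; norm_num

theorem sum_lapSymbol_sq_le {c : ℝ} (hc : 0 < c) (N : ℕ) :
    ∑ k ∈ (freqBox 3 N).erase 0, (freqSq k * (1 + c ^ 12 * freqSq k ^ 2)⁻¹) ^ 2 ≤
      (72 / c ^ 7) ^ 3 := by
  have h := sum_erase_le_of_le_prod (d := 3) (A := 8 / c ^ 6) hc (by positivity)
    (F := fun k => (freqSq k * (1 + c ^ 12 * freqSq k ^ 2)⁻¹) ^ 2) ?_ N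
  · refine h.trans (le_of_eq ?_)
    field_simp; norm_num
  intro k hk
  have hq0 := freqSq_nonneg k
  refine le_prod_three (by positivity)
    (fun i => mul_nonneg (by positivity) (profile_nonneg _ _)) fun i => ?_
  set z := freqSq k * (1 + c ^ 12 * freqSq k ^ 2)⁻¹ with hz
  have hz0 : 0 ≤ z := by positivity
  have he : (z ^ (1 / 3 : ℝ)) ^ 3 = z := by
    rw [← Real.rpow_natCast, ← Real.rpow_mul hz0]; norm_num
  have h1 := cbrt_lapSymbol_sq_le_profile hc hk (he.trans hz) i
  calc z ^ 2 = ((z ^ (1 / 3 : ℝ)) ^ 2) ^ 3 := by conv_lhs => rw [← he]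
                                                 ring
    _ ≤ _ := by gcongr

theorem integral_nonlin_sq_le {v : Torus d → ℝ} (hv : Continuous v) {E L : ℝ}
    (hE : ∫ x, (v x ^ 2 - 1) ^ 2 ∂(torusVol d) ≤ 4 * E)
    (hvL : ∀ᵐ x ∂(torusVol d), |v x| ≤ L) :
    ∫ x, nonlin (v x) ^ 2 ∂(torusVol d) ≤ L ^ 2 * (4 * E) := by
  have hn := continuous_nonlin
  calc ∫ x, nonlin (v x) ^ 2 ∂(torusVol d) ≤ ∫ x, L ^ 2 * (v x ^ 2 - 1) ^ 2 ∂(torusVol d) := by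
        refine integral_mono_ae (integrable_of_continuous (by fun_prop))
          (integrable_of_continuous (by fun_prop)) ?_
        filter_upwards [hvL] with x hx
        have e : nonlin (v x) ^ 2 = v x ^ 2 * (v x ^ 2 - 1) ^ 2 := by unfold nonlin; ring
        rw [e]
        exact mul_le_mul_of_nonneg_right (sq_le_sq.mpr (hx.trans (le_abs_self L))) (sq_nonneg _)
    _ ≤ L ^ 2 * (4 * E) := by rw [integral_const_mul]; gcongr

/-- In three dimensions the supremum bound propagates through one step of the scheme, since
`‖f(u)‖₂ ≤ ‖u‖_∞ ‖u² - 1‖₂`. -/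
theorem bounded_of_step_three {ν τ L E : ℝ} (hν : 0 < ν) (hτ : 0 < τ) (hL : 0 < L)
    (hL4 : 9 * L ^ 4 * τ = 8 * ν) (hT : (16 * 72 ^ 3) ^ 4 * E ^ 4 * τ ≤ ν ^ 7)
    {v w : Torus 3 → ℝ} (hv : v ∈ trigSpace 3 N) (hw : w ∈ trigSpace 3 N) (hv0 : coeff v 0 = 0)
    (hstep : ∀ k ∈ freqBox 3 N, coeff w k - coeff v k =
      ((-(τ * ν * freqSq k ^ 2) : ℝ) : ℂ) * coeff w k -
        ((τ * freqSq k : ℝ) : ℂ) * coeff (fun y => nonlin (v y)) k)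
    (hvL : ∀ᵐ x ∂(torusVol 3), |v x| ≤ L) (hEv : energy ν v ≤ E) (x : Torus 3) : |w x| ≤ L := by
  obtain ⟨c, hc, hc12⟩ : ∃ c : ℝ, 0 < c ∧ c ^ 12 = ν * τ := by
    refine ⟨(ν * τ) ^ (1 / 12 : ℝ), by positivity, ?_⟩
    rw [← Real.rpow_natCast, ← Real.rpow_mul (by positivity)]; norm_num
  have cv := continuous_of_mem hv
  have cf : Continuous fun y => nonlin (v y) := continuous_nonlin.comp cv
  have hE' := integral_sq_sub_one_le hν hv hEv
  have hD := sum_freqSq_coeff_le hv hEv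
  have hf := (sum_sq_coeff_le (N := N) (memLp_of_continuous cf 2)).trans
    (integral_nonlin_sq_le cv hE' hvL)
  have hm : ∀ k : Fin 3 → ℤ, 0 ≤ (1 + ν * τ * freqSq k ^ 2)⁻¹ := fun k => by positivity
  -- Cauchy–Schwarz after inserting `√(freqSq k)`, so that the second factor is the gradient part of
  -- the energy. The mean of `v` vanishes, so `k = 0` can be dropped.
  have h1 : |resolvent (ν * τ) v x| ≤ √((36 / c) ^ 3 * (2 * E / ν)) := by
    rw [resolvent_of_mem _ hv]
    refine (abs_trigPoly_le _ x).trans ?_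
    rw [sum_eq_sum_erase (by simp [hv0])]
    refine Real.le_sqrt_of_sq_le ?_
    have e : ∑ k ∈ (freqBox 3 N).erase 0, ‖(((1 + ν * τ * freqSq k ^ 2)⁻¹ : ℝ) : ℂ) * coeff v k‖ =
        ∑ k ∈ (freqBox 3 N).erase 0, ((1 + c ^ 12 * freqSq k ^ 2)⁻¹ / √(freqSq k)) *
          (√(freqSq k) * ‖coeff v k‖) := by
      refine Finset.sum_congr rfl fun k hk => ?_
      have hq := one_le_freqSq (Finset.ne_of_mem_erase hk)
      have : 0 < √(freqSq k) := Real.sqrt_pos.mpr (by linarith)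
      rw [norm_mul, Complex.norm_real, Real.norm_of_nonneg (hm k), hc12]
      field_simp
    rw [e]
    refine (Finset.sum_mul_sq_le_sq_mul_sq _ _ _).trans ?_
    simp only [div_pow _ (√ _), mul_pow (√ _), Real.sq_sqrt (freqSq_nonneg _)]
    have h3 : ∑ k ∈ (freqBox 3 N).erase 0, freqSq k * ‖coeff v k‖ ^ 2 ≤ 2 * E / ν := by
      rw [← sum_eq_sum_erase (by simp [hv0]), le_div_iff₀ hν]; linarith
    exact mul_le_mul (sum_symbol_sq_div_le hc N) h3
      (Finset.sum_nonneg fun k _ => mul_nonneg (freqSq_nonneg k) (sq_nonneg _)) (by positivity)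
  -- Cauchy–Schwarz again, now pairing the symbol in `ℓ²` with Bessel's inequality for `f(v)`.
  have h2 : |lap (resolvent (ν * τ) (piN N fun y => nonlin (v y))) x| ≤
      √((72 / c ^ 7) ^ 3 * (L ^ 2 * (4 * E))) := by
    rw [lap_resolvent_piN]
    refine (abs_trigPoly_le _ x).trans ?_
    rw [sum_eq_sum_erase (by simp [freqSq_zero])]
    refine Real.le_sqrt_of_sq_le ?_
    have e : ∀ k : Fin 3 → ℤ, ‖-((freqSq k * (1 + ν * τ * freqSq k ^ 2)⁻¹ : ℝ) : ℂ) *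
        coeff (fun y => nonlin (v y)) k‖ = freqSq k * (1 + c ^ 12 * freqSq k ^ 2)⁻¹ *
          ‖coeff (fun y => nonlin (v y)) k‖ := fun k => by
      rw [norm_mul, norm_neg, Complex.norm_real, Real.norm_of_nonneg
        (mul_nonneg (freqSq_nonneg k) (hm k)), hc12]
    simp only [e]
    refine (Finset.sum_mul_sq_le_sq_mul_sq _ _ _).trans ?_
    refine mul_le_mul (sum_lapSymbol_sq_le hc N) (le_trans ?_ hf)
      (Finset.sum_nonneg fun k _ => sq_nonneg _) (by positivity)
    exact Finset.sum_le_sum_of_subset_of_nonneg (Finset.erase_subset _ _) fun k _ _ => sq_nonneg _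
  have hE4 : 0 ≤ E ^ 4 * τ := by positivity
  have h3 : √((36 / c) ^ 3 * (2 * E / ν)) ≤ L / 2 := by
    refine Real.sqrt_le_iff.mpr ⟨by positivity, ?_⟩
    -- After a fourth power and a factor `τ`, the right side contains `c¹² = ντ` and `(L⁴τ)²`, hence
    -- equals `(64/81)ν⁷`. Since `16·72³ = 16·(8·36³)`, the assumed bound is more than enough.
    have h : 8 * 36 ^ 3 * E ≤ ν * c ^ 3 * L ^ 2 := by
      refine le_of_pow_le_pow_left₀ (n := 4) (by norm_num) (by positivity) ?_
      refine le_of_mul_le_mul_right ?_ hτ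
      have e : (ν * c ^ 3 * L ^ 2) ^ 4 * τ = 64 / 81 * ν ^ 7 := by
        have : (ν * c ^ 3 * L ^ 2) ^ 4 * τ * 81 = ν ^ 4 * c ^ 12 * L ^ 4 * 9 * (9 * L ^ 4 * τ) := by
          ring
        rw [hL4, hc12] at this
        have h' : ν ^ 4 * (ν * τ) * L ^ 4 * 9 * (8 * ν) = 8 * ν ^ 6 * (9 * L ^ 4 * τ) := by ring
        rw [h', hL4] at this
        linarith
      rw [e]
      have e2 : (8 * 36 ^ 3 * E) ^ 4 * τ = (8 * 36 ^ 3) ^ 4 * (E ^ 4 * τ) := by ring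
      rw [e2]
      norm_num at hT ⊢
      linarith
    have e : (36 / c) ^ 3 * (2 * E / ν) = 8 * 36 ^ 3 * E / (4 * (ν * c ^ 3)) := by
      field_simp; ring
    rw [e, div_le_iff₀ (by positivity)]
    nlinarith
  have h4 : τ * √((72 / c ^ 7) ^ 3 * (L ^ 2 * (4 * E))) ≤ L / 2 := by
    rw [← le_div_iff₀' hτ]
    refine Real.sqrt_le_iff.mpr ⟨by positivity, ?_⟩
    -- `L` has cancelled from both sides. The fourth power of the right side is `(ντ)⁷`, so this is
    -- exactly the assumed bound on `E⁴τ`.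
    have h : 16 * 72 ^ 3 * (τ ^ 2 * E) ≤ c ^ 21 := by
      refine le_of_pow_le_pow_left₀ (n := 4) (by norm_num) (by positivity) ?_
      have e : (c ^ 21) ^ 4 = ν ^ 7 * τ ^ 7 := by
        rw [← mul_pow, ← hc12]; ring
      rw [e]
      calc (16 * 72 ^ 3 * (τ ^ 2 * E)) ^ 4 = (16 * 72 ^ 3) ^ 4 * E ^ 4 * τ * τ ^ 7 := by ring
        _ ≤ _ := by gcongr
    have e : (72 / c ^ 7) ^ 3 * (L ^ 2 * (4 * E)) =
        16 * 72 ^ 3 * (τ ^ 2 * E) * (L / 2 / τ) ^ 2 / c ^ 21 := by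
      field_simp; ring
    rw [e, div_le_iff₀ (by positivity), mul_comm]
    gcongr
  rw [eq_resolvent_of_step hν hτ hv hw hstep x]
  refine (abs_add_le _ _).trans ?_
  rw [abs_mul, abs_of_pos hτ]
  have := mul_le_mul_of_nonneg_left h2 hτ.le
  linarith

theorem stable_three {T : ℝ → ℝ → ℝ} (hT : ∀ ν τ E, 0 < ν → 0 < τ → 0 ≤ E → τ ≤ T ν E →
    (16 * 72 ^ 3) ^ 4 * E ^ 4 * τ ≤ ν ^ 7) : ConditionallyEnergyStable 3 T := by
  refine conditionallyEnergyStable_of_step ?_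
  intro ν τ L E N hν hτ _ hL hL4 hE hτT v w hv hw hv0 hstep hvL hEv
  exact Filter.Eventually.of_forall (bounded_of_step_three hν hτ hL hL4
    (hT ν τ E hν hτ hE hτT) hv hw hv0 hstep hvL hEv)

theorem stable_three_simple : ConditionallyEnergyStable 3 (fun ν E₀ =>
    ((16 * 72 ^ 3) ^ 4 * (1 + E₀ ^ 4))⁻¹ * ν ^ 7) := by
  refine stable_three fun ν τ E hν hτ hE h => ?_
  rw [inv_mul_eq_div, le_div_iff₀ (by positivity)] at h
  nlinarith

/-- Since the supremum bound is propagated directly, without a Sobolev embedding, the first entry of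
the minimum already suffices, and the constants in the other two are immaterial. -/
theorem stable_three_explicit : ConditionallyEnergyStable 3 (fun ν E₀ => 0.0007 * ν ^ 7 *
    min (((16 * 72 ^ 3) * √E₀) ^ (-8 : ℝ)) (min ((1 * E₀ ^ (3 / 2 : ℝ)) ^ (-(8 / 3) : ℝ))
      ((1 * (1 + E₀) ^ (1 / 4 : ℝ)) ^ (-8 : ℝ)))) := by
  refine stable_three fun ν τ E hν hτ hE h => ?_
  have h1 := h.trans (mul_le_mul_of_nonneg_left (min_le_left _ _) (by positivity))
  rw [show (-8 : ℝ) = ((-8 : ℤ) : ℝ) by norm_num, Real.rpow_intCast, zpow_neg] at h1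
  -- The eighth power supplies the required `(16·72³)⁴E⁴` with a spare factor `(16·72³)⁴`, and
  -- `0.0007 ≤ 1`.
  have e : ((16 * 72 ^ 3) * √E) ^ (8 : ℤ) = (16 * 72 ^ 3) ^ 8 * E ^ 4 := by
    have : ((16 * 72 ^ 3) * √E) ^ (8 : ℤ) = (16 * 72 ^ 3) ^ 8 * (√E ^ 2) ^ 4 := by
      rw [mul_zpow, ← pow_mul]; norm_cast
    rw [this, Real.sq_sqrt hE]
  rw [e, ← div_eq_mul_inv] at h1
  rcases hE.eq_or_lt with rfl | hE
  · simp; positivity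
  rw [le_div_iff₀ (by positivity)] at h1
  have : 0 ≤ E ^ 4 * τ := by positivity
  norm_num at h1 ⊢
  nlinarith

/-! ### Translations and absolutely convergent Fourier series. -/

instance instIsAddLeftInvariantTorusVol (d : ℕ) : (torusVol d).IsAddLeftInvariant := by
  unfold torusVol; infer_instance

/-- Lets the value of a Fourier multiplier at `x` be written as the integral of a fixed kernel
against the translate of `g` by `x`. -/
theorem coeff_translate (g : Torus d → ℝ) (x : Torus d) (k : Fin d → ℤ) :
    coeff (fun y => g (x + y)) k = coeff g k * mFourier k x := by
  have e : ∀ y, mFourier (-k) y * ((g (x + y) : ℝ) : ℂ) =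
      mFourier k x * (mFourier (-k) (x + y) * (g (x + y) : ℂ)) := fun y => by
    have h : mFourier k x * mFourier (-k) x = 1 := by
      rw [← mFourier_add, add_neg_cancel, mFourier_zero, ContinuousMap.one_apply]
    rw [mFourier_apply_add]
    linear_combination -(mFourier (-k) y * (g (x + y) : ℂ)) * h
  rw [coeff_eq_integral, coeff_eq_integral]
  simp only [e, integral_const_mul]
  rw [integral_add_left_eq_self (fun y => mFourier (-k) y * (g y : ℂ)) x, mul_comm]

theorem measurePreserving_translate (x : Torus d) :
    MeasurePreserving (fun y => x + y) (torusVol d) (torusVol d) :=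
  measurePreserving_add_left (torusVol d) x

/-- The sum of an absolutely convergent Fourier series. -/
def fourierSum {d : ℕ} (a : (Fin d → ℤ) → ℂ) (y : Torus d) : ℂ := ∑' k, a k * mFourier k y

theorem norm_mul_mFourier (z : ℂ) (k : Fin d → ℤ) (y : Torus d) : ‖z * mFourier k y‖ = ‖z‖ := by
  rw [norm_mul, norm_mFourier_apply, mul_one]

theorem continuous_fourierSum {a : (Fin d → ℤ) → ℂ} (ha : Summable fun k => ‖a k‖) :
    Continuous (fourierSum a) :=
  continuous_tsum (fun k => by fun_prop) ha fun k y => (norm_mul_mFourier _ k y).le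

theorem summable_mul_mFourier {a : (Fin d → ℤ) → ℂ} (ha : Summable fun k => ‖a k‖) (y : Torus d) :
    Summable fun k => a k * mFourier k y := by
  refine Summable.of_norm ?_
  simpa only [norm_mul_mFourier] using ha

/-- Termwise integration of an absolutely convergent Fourier series. -/
theorem hasSum_integral_fourierSum_mul {a : (Fin d → ℤ) → ℂ} (ha : Summable fun k => ‖a k‖)
    {g : Torus d → ℂ} (hg : Integrable g (torusVol d)) :
    HasSum (fun k => a k * ∫ y, mFourier k y * g y ∂(torusVol d))
      (∫ y, fourierSum a y * g y ∂(torusVol d)) := by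
  have hi : ∀ k : Fin d → ℤ, Integrable (fun y => mFourier k y * g y) (torusVol d) := fun k =>
    hg.bdd_mul (c := 1) (mFourier k).continuous.aestronglyMeasurable
      (Filter.Eventually.of_forall fun x => (norm_mFourier_apply k x).le)
  have h := hasSum_integral_of_summable_integral_norm (μ := torusVol d)
    (F := fun k y => a k * (mFourier k y * g y)) (fun k => (hi k).const_mul _) ?_
  · have e : ∀ y, fourierSum a y * g y = ∑' k, a k * (mFourier k y * g y) := fun y => by
      rw [fourierSum, ← tsum_mul_right]
      simp only [mul_assoc]
    simpa only [e, integral_const_mul] using h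
  · have e : ∀ (k : Fin d → ℤ) (y : Torus d), ‖a k * (mFourier k y * g y)‖ = ‖a k‖ * ‖g y‖ :=
      fun k y => by rw [← mul_assoc, norm_mul, norm_mul_mFourier]
    simp only [e, integral_const_mul]
    exact ha.mul_right _

theorem integral_mFourier_neg_mul_fourierSum {a : (Fin d → ℤ) → ℂ} (ha : Summable fun k => ‖a k‖)
    (j : Fin d → ℤ) : ∫ y, fourierSum a y * mFourier (-j) y ∂(torusVol d) = a j := by
  have h := hasSum_integral_fourierSum_mul ha (g := fun y => mFourier (-j) y)
    (integrable_of_continuous (by fun_prop))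
  have e : ∀ k : Fin d → ℤ, a k * ∫ y, mFourier k y * mFourier (-j) y ∂(torusVol d) =
      if k = j then a j else 0 := fun k => by
    simp only [← mFourier_add, integral_mFourier, ← sub_eq_add_neg, sub_eq_zero]
    split_ifs with h
    · rw [h, mul_one]
    · rw [mul_zero]
  simp only [e] at h
  exact h.unique (hasSum_ite_eq j (a j))

/-- Parseval's identity for absolutely convergent Fourier series. -/
theorem hasSum_norm_sq_fourierSum {a : (Fin d → ℤ) → ℂ} (ha : Summable fun k => ‖a k‖) :
    HasSum (fun k => ‖a k‖ ^ 2) (∫ y, ‖fourierSum a y‖ ^ 2 ∂(torusVol d)) := by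
  have hc := continuous_fourierSum ha
  have h := hasSum_integral_fourierSum_mul ha (g := fun y => (starRingEnd ℂ) (fourierSum a y))
    (integrable_of_continuous (by fun_prop))
  have e : ∀ k : Fin d → ℤ,
      a k * ∫ y, mFourier k y * (starRingEnd ℂ) (fourierSum a y) ∂(torusVol d) =
        ((‖a k‖ ^ 2 : ℝ) : ℂ) := fun k => by
    have h1 := congrArg (starRingEnd ℂ) (integral_mFourier_neg_mul_fourierSum ha k)
    rw [← integral_conj] at h1
    simp only [map_mul, mFourier_neg, Complex.conj_conj] at h1
    simp only [mul_comm (mFourier k _), h1, Complex.mul_conj, Complex.normSq_eq_norm_sq]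
  simp only [e, Complex.mul_conj, Complex.normSq_eq_norm_sq] at h
  rw [integral_complex_ofReal] at h
  exact_mod_cast h

theorem integral_norm_sq_sum (t : Finset (Fin d → ℤ)) (a : (Fin d → ℤ) → ℂ) :
    ∫ y, ‖∑ k ∈ t, a k * mFourier k y‖ ^ 2 ∂(torusVol d) = ∑ k ∈ t, ‖a k‖ ^ 2 := by
  classical
  set b : (Fin d → ℤ) → ℂ := fun k => if k ∈ t then a k else 0 with hb
  have hb0 : ∀ k ∉ t, b k = 0 := fun k hk => by simp [hb, hk]
  have hb1 : ∀ k ∈ t, b k = a k := fun k hk => by simp [hb, hk]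
  have hs : Summable fun k => ‖b k‖ :=
    summable_of_ne_finset_zero (s := t) fun k hk => by rw [hb0 k hk, norm_zero]
  have h := (hasSum_norm_sq_fourierSum hs).tsum_eq
  rw [tsum_eq_sum (s := t) fun k hk => by rw [hb0 k hk, norm_zero]; norm_num] at h
  have e : ∀ y, fourierSum b y = ∑ k ∈ t, a k * mFourier k y := fun y => by
    rw [fourierSum, tsum_eq_sum (s := t) fun k hk => by rw [hb0 k hk, zero_mul]]
    exact Finset.sum_congr rfl fun k hk => by rw [hb1 k hk]
  simp only [e] at h
  rw [← h]
  exact Finset.sum_congr rfl fun k hk => by rw [hb1 k hk]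

/-- Multiplication by a character shifts the coefficients, so weights built from `1 - e^{2πi y_i}`
measure differences of coefficients. -/
theorem sub_mFourier_mul_fourierSum {a : (Fin d → ℤ) → ℂ} (ha : Summable fun k => ‖a k‖)
    (j : Fin d → ℤ) (y : Torus d) :
    (1 - mFourier j y) * fourierSum a y = fourierSum (fun k => a k - a (k - j)) y := by
  have ha' : Summable fun k => ‖a (k - j)‖ := (Equiv.subRight j).summable_iff.mpr ha
  have h : mFourier j y * fourierSum a y = fourierSum (fun k => a (k - j)) y := by
    rw [fourierSum, fourierSum, ← tsum_mul_left,
      ← (Equiv.addRight j).tsum_eq fun k => a (k - j) * mFourier k y]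
    refine tsum_congr fun k => ?_
    simp only [Equiv.coe_addRight, add_sub_cancel_right, mFourier_add]
    ring
  rw [sub_mul, one_mul, h, fourierSum, fourierSum, fourierSum,
    ← (summable_mul_mFourier ha y).tsum_sub (summable_mul_mFourier ha' y)]
  simp only [sub_mul]

/-! ### The bound from `L^{4/3}` to `L^∞` by a Hausdorff–Young argument. -/

/-- The discrete Young inequality `ℓ^{4/3} * ℓ^{4/3} ⊂ ℓ²` for `a = e³`. -/
theorem sum_convolution_sq_le (s t : Finset (Fin d → ℤ)) (e : (Fin d → ℤ) → ℝ) :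
    ∑ n ∈ t, (∑ p ∈ s ×ˢ s with p.1 + p.2 = n, e p.1 ^ 3 * e p.2 ^ 3) ^ 2 ≤
      (∑ k ∈ s, e k ^ 4) ^ 3 := by
  set S := ∑ k ∈ s, e k ^ 4 with hS
  have hS0 : 0 ≤ S := Finset.sum_nonneg fun k _ => by positivity
  -- On the fibre `p + q = n` each coordinate determines the other, so after `2ab ≤ a² + b²` each
  -- half sums to at most `S`.
  have h1 : ∀ n, ∑ p ∈ s ×ˢ s with p.1 + p.2 = n, (e p.1 * e p.2) ^ 2 ≤ S := by
    intro n
    have h2 : ∑ p ∈ s ×ˢ s with p.1 + p.2 = n, e p.1 ^ 4 ≤ S := by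
      rw [← Finset.sum_image (f := fun k => e k ^ 4) (g := Prod.fst)]
      · refine Finset.sum_le_sum_of_subset_of_nonneg ?_ fun k _ _ => by positivity
        intro k hk
        simp only [Finset.mem_image, Finset.mem_filter, Finset.mem_product] at hk
        obtain ⟨p, hp, rfl⟩ := hk
        exact hp.1.1
      · intro p hp q hq hpq
        simp only [Finset.coe_filter, Set.mem_ofPred_eq] at hp hq
        refine Prod.ext hpq ?_
        have := hp.2.trans hq.2.symm
        rw [hpq] at this
        exact add_left_cancel this
    have h3 : ∑ p ∈ s ×ˢ s with p.1 + p.2 = n, e p.2 ^ 4 ≤ S := by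
      rw [← Finset.sum_image (f := fun k => e k ^ 4) (g := Prod.snd)]
      · refine Finset.sum_le_sum_of_subset_of_nonneg ?_ fun k _ _ => by positivity
        intro k hk
        simp only [Finset.mem_image, Finset.mem_filter, Finset.mem_product] at hk
        obtain ⟨p, hp, rfl⟩ := hk
        exact hp.1.2
      · intro p hp q hq hpq
        simp only [Finset.coe_filter, Set.mem_ofPred_eq] at hp hq
        refine Prod.ext ?_ hpq
        have := hp.2.trans hq.2.symm
        rw [hpq] at this
        exact add_right_cancel this
    calc ∑ p ∈ s ×ˢ s with p.1 + p.2 = n, (e p.1 * e p.2) ^ 2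
        ≤ ∑ p ∈ s ×ˢ s with p.1 + p.2 = n, (e p.1 ^ 4 + e p.2 ^ 4) / 2 :=
          Finset.sum_le_sum fun p _ => by nlinarith [sq_nonneg (e p.1 ^ 2 - e p.2 ^ 2)]
      _ ≤ S := by rw [← Finset.sum_div, Finset.sum_add_distrib]; linarith
  calc ∑ n ∈ t, (∑ p ∈ s ×ˢ s with p.1 + p.2 = n, e p.1 ^ 3 * e p.2 ^ 3) ^ 2
      ≤ ∑ n ∈ t, (∑ p ∈ s ×ˢ s with p.1 + p.2 = n, e p.1 ^ 4 * e p.2 ^ 4) * S := by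
        refine Finset.sum_le_sum fun n _ => ?_
        -- Split `e³e³ = (e²e²)(ee)`: the first factor squares to `e⁴e⁴`, summing over all fibres to
        -- at most `S²`; the second is at most `S` on each fibre.
        have hcs := Finset.sum_mul_sq_le_sq_mul_sq (Finset.filter (fun p => p.1 + p.2 = n) (s ×ˢ s))
          (fun p => e p.1 ^ 2 * e p.2 ^ 2) (fun p => e p.1 * e p.2)
        refine le_trans (le_of_eq ?_) (hcs.trans (mul_le_mul (le_of_eq ?_) (h1 n)
          (Finset.sum_nonneg fun p _ => by positivity) (Finset.sum_nonneg fun p _ => by positivity)))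
        · congr 1; exact Finset.sum_congr rfl fun p _ => by ring
        · exact Finset.sum_congr rfl fun p _ => by ring
    _ ≤ (∑ p ∈ s ×ˢ s, e p.1 ^ 4 * e p.2 ^ 4) * S := by
        rw [← Finset.sum_mul]
        refine mul_le_mul_of_nonneg_right ?_ hS0
        exact Finset.sum_fiberwise_le_sum_of_sum_fiber_nonneg fun n _ =>
          Finset.sum_nonneg fun p _ => by positivity
    _ = S ^ 3 := by
        rw [Finset.sum_product]
        dsimp only
        rw [← Finset.sum_mul_sum, ← hS]; ring

/-- The Hausdorff-Young bound `‖∑ a_k e_k‖_4 ≤ ‖a‖_{ℓ^{4/3}}` for `a = e³`. -/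
theorem integral_norm_pow_four_le (s : Finset (Fin d → ℤ)) (e : (Fin d → ℤ) → ℝ) :
    ∫ y, ‖∑ k ∈ s, ((e k ^ 3 : ℝ) : ℂ) * mFourier k y‖ ^ 4 ∂(torusVol d) ≤
      (∑ k ∈ s, e k ^ 4) ^ 3 := by
  classical
  set t := (s ×ˢ s).image fun p => p.1 + p.2 with ht
  -- The fourth power is the square of the modulus of `K²`, whose coefficients are the
  -- self-convolution; Parseval then applies.
  have h : ∀ y : Torus d, ‖∑ k ∈ s, ((e k ^ 3 : ℝ) : ℂ) * mFourier k y‖ ^ 4 =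
      ‖∑ n ∈ t, ((∑ p ∈ s ×ˢ s with p.1 + p.2 = n, e p.1 ^ 3 * e p.2 ^ 3 : ℝ) : ℂ) *
        mFourier n y‖ ^ 2 := fun y => by
    rw [show 4 = 2 * 2 by norm_num, pow_mul, ← norm_pow, pow_two (∑ k ∈ s, _),
      Finset.sum_mul_sum, ← Finset.sum_product',
      ← Finset.sum_fiberwise_of_maps_to (t := t) (g := fun p => p.1 + p.2)
        fun p hp => Finset.mem_image_of_mem _ hp]
    congr 2
    refine Finset.sum_congr rfl fun n _ => ?_
    push_cast
    rw [Finset.sum_mul]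
    refine Finset.sum_congr rfl fun p hp => ?_
    rw [← (Finset.mem_filter.mp hp).2, mFourier_add]
    ring
  simp only [h, integral_norm_sq_sum, Complex.norm_real, Real.norm_eq_abs, sq_abs]
  exact sum_convolution_sq_le s t e

theorem enorm_integral_mul_le {p q : ℝ≥0∞} [ENNReal.HolderTriple p q 1] {g : Torus d → ℝ}
    {K : Torus d → ℂ} (hg : AEStronglyMeasurable g (torusVol d))
    (hK : AEStronglyMeasurable K (torusVol d)) :
    ‖∫ y, K y * (g y : ℂ) ∂(torusVol d)‖ₑ ≤ eLpNorm g p (torusVol d) * eLpNorm K q (torusVol d) := by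
  refine (enorm_integral_le_lintegral_enorm _).trans ?_
  refine le_trans (le_of_eq ?_) (eLpNorm_smul_le_mul_eLpNorm (p := p) (q := q) (r := 1) hK hg)
  rw [eLpNorm_one_eq_lintegral_enorm]
  refine lintegral_congr fun y => ?_
  rw [Pi.smul_apply', Complex.real_smul, mul_comm]

theorem eLpNorm_translate {g : Torus d → ℝ} (p : ℝ≥0∞) (hg : AEStronglyMeasurable g (torusVol d))
    (x : Torus d) : eLpNorm (fun y => g (x + y)) p (torusVol d) = eLpNorm g p (torusVol d) :=
  eLpNorm_comp_measurePreserving hg (measurePreserving_translate x)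

theorem memLp_translate {g : Torus d → ℝ} {p : ℝ≥0∞} (hg : MemLp g p (torusVol d)) (x : Torus d) :
    MemLp (fun y => g (x + y)) p (torusVol d) :=
  hg.comp_measurePreserving (measurePreserving_translate x)

theorem holderTriple_four_thirds_four : ENNReal.HolderTriple (4 / 3) 4 1 := by
  constructor
  rw [ENNReal.inv_div (by norm_num) (by norm_num)]
  have h4 : (4 : ℝ≥0∞)⁻¹ = ENNReal.ofReal (1 / 4) := by
    rw [ENNReal.ofReal_div_of_pos (by norm_num)]; norm_num
  have h3 : (3 / 4 : ℝ≥0∞) = ENNReal.ofReal (3 / 4) := by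
    rw [ENNReal.ofReal_div_of_pos (by norm_num)]; norm_num
  rw [h4, h3, ← ENNReal.ofReal_add (by norm_num) (by norm_num)]
  norm_num

theorem eLpNorm_four_sum_le (s : Finset (Fin d → ℤ)) (e : (Fin d → ℤ) → ℝ) {S : ℝ}
    (hS : ∑ k ∈ s, e k ^ 4 ≤ S) :
    eLpNorm (fun y => ∑ k ∈ s, ((e k ^ 3 : ℝ) : ℂ) * mFourier k y) 4 (torusVol d) ≤
      ENNReal.ofReal ((S ^ 3) ^ (1 / 4 : ℝ)) := by
  have hc : Continuous fun y : Torus d => ∑ k ∈ s, ((e k ^ 3 : ℝ) : ℂ) * mFourier k y := by fun_prop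
  rw [MemLp.eLpNorm_eq_integral_rpow_norm (by norm_num) (by norm_num)
    (hc.memLp_of_hasCompactSupport (HasCompactSupport.of_compactSpace _))]
  refine ENNReal.ofReal_le_ofReal ?_
  have h4 : (ENNReal.toReal 4) = ((4 : ℕ) : ℝ) := by norm_num
  simp only [h4, Real.rpow_natCast]
  have h0 : 0 ≤ ∑ k ∈ s, e k ^ 4 := Finset.sum_nonneg fun k _ => by positivity
  have e1 : ((4 : ℕ) : ℝ)⁻¹ = 1 / 4 := by norm_num
  rw [e1]
  refine Real.rpow_le_rpow (integral_nonneg fun y => by positivity) ?_ (by norm_num)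
  exact (integral_norm_pow_four_le s e).trans (pow_le_pow_left₀ h0 hS 3)

/-- The value at `x` is, up to sign, conjugation and real part, the integral of the kernel with
coefficients `e³` against a translate of `g`; Hölder with exponents `4/3` and `4` finishes. -/
theorem enorm_trigPoly_mul_coeff_le (e : (Fin d → ℤ) → ℝ) {S : ℝ}
    (hS : ∑ k ∈ freqBox d N, e k ^ 4 ≤ S) {g : Torus d → ℝ} (hg : MemLp g (4 / 3) (torusVol d))
    (x : Torus d) :
    ‖trigPoly N (fun k => -((e k ^ 3 : ℝ) : ℂ) * coeff g k) x‖ₑ ≤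
      ENNReal.ofReal ((S ^ 3) ^ (1 / 4 : ℝ)) * eLpNorm g (4 / 3) (torusVol d) := by
  have hx := memLp_translate hg x
  have h1 : (1 : ℝ≥0∞) ≤ 4 / 3 := by
    rw [ENNReal.le_div_iff_mul_le (by norm_num) (by norm_num)]; norm_num
  have hi : Integrable (fun y => g (x + y)) (torusVol d) := hx.integrable h1
  have e1 : ∑ k ∈ freqBox d N, -((e k ^ 3 : ℝ) : ℂ) * coeff g k * mFourier k x =
      -(starRingEnd ℂ) (∫ y, (∑ k ∈ freqBox d N, ((e k ^ 3 : ℝ) : ℂ) * mFourier k y) *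
        ((g (x + y) : ℝ) : ℂ) ∂(torusVol d)) := by
    simp only [Finset.sum_mul, mul_assoc]
    rw [integral_finsetSum _ fun k _ => (integrable_mul_mFourier hi k).const_mul _, map_sum,
      ← Finset.sum_neg_distrib]
    refine Finset.sum_congr rfl fun k _ => ?_
    rw [integral_const_mul, map_mul, Complex.conj_ofReal, integral_mFourier_mul, Complex.conj_conj,
      coeff_translate]
    ring
  rw [trigPoly, e1]
  calc _ ≤ ‖∫ y, (∑ k ∈ freqBox d N, ((e k ^ 3 : ℝ) : ℂ) * mFourier k y) *
        ((g (x + y) : ℝ) : ℂ) ∂(torusVol d)‖ₑ := by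
        rw [← ofReal_norm, ← ofReal_norm]
        refine ENNReal.ofReal_le_ofReal ((Complex.abs_re_le_norm _).trans (le_of_eq ?_))
        rw [norm_neg, RCLike.norm_conj]
    _ ≤ eLpNorm (fun y => g (x + y)) (4 / 3) (torusVol d) *
        eLpNorm (fun y => ∑ k ∈ freqBox d N, ((e k ^ 3 : ℝ) : ℂ) * mFourier k y) 4
          (torusVol d) := by
        have := holderTriple_four_thirds_four
        have hc : Continuous fun y : Torus d =>
          ∑ k ∈ freqBox d N, ((e k ^ 3 : ℝ) : ℂ) * mFourier k y := by fun_prop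
        exact enorm_integral_mul_le hx.1 hc.aestronglyMeasurable
    _ ≤ _ := by
        rw [eLpNorm_translate _ hg.1, mul_comm]
        exact mul_le_mul' (eLpNorm_four_sum_le _ e hS) le_rfl

/-- The `L^{4/3} → L^∞` bound for `Δ (1 + β Δ²)⁻¹ Π_N`, given an `ℓ^{4/3}` bound of its symbol. -/
theorem eLpNorm_lap_resolvent_le {β τ S : ℝ} (hβ : 0 < β) (hτ : 0 < τ)
    (hS : ∀ e : (Fin d → ℤ) → ℝ, (∀ k, e k ^ 3 = freqSq k * (1 + β * freqSq k ^ 2)⁻¹) →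
      ∑ k ∈ freqBox d N, e k ^ 4 ≤ S) {g : Torus d → ℝ} (hg : MemLp g (4 / 3) (torusVol d)) :
    eLpNorm (fun x => τ * lap (resolvent β (piN N g)) x) ∞ (torusVol d) ≤
      ENNReal.ofReal (τ * (S ^ 3) ^ (1 / 4 : ℝ)) * eLpNorm g (4 / 3) (torusVol d) := by
  rw [eLpNorm_exponent_top]
  refine eLpNormEssSup_le_of_ae_enorm_bound (Filter.Eventually.of_forall fun x => ?_)
  set e : (Fin d → ℤ) → ℝ := fun k => (freqSq k * (1 + β * freqSq k ^ 2)⁻¹) ^ (1 / 3 : ℝ) with he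
  have he3 : ∀ k, e k ^ 3 = freqSq k * (1 + β * freqSq k ^ 2)⁻¹ := fun k => by
    rw [he]; dsimp only
    rw [← Real.rpow_natCast, ← Real.rpow_mul (mul_nonneg (freqSq_nonneg k) (symbol_nonneg hβ k))]
    norm_num
  have h := enorm_trigPoly_mul_coeff_le e (hS e he3) hg x
  simp only [he3] at h
  rw [lap_resolvent_piN, enorm_mul, ENNReal.ofReal_mul hτ.le, mul_assoc]
  refine mul_le_mul' (le_of_eq ?_) h
  rw [← ofReal_norm, Real.norm_of_nonneg hτ.le]

theorem sum_cbrt_lapSymbol_le_one {c : ℝ} (hc : 0 < c) {e : (Fin 1 → ℤ) → ℝ}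
    (he : ∀ k, e k ^ 3 = freqSq k * (1 + c ^ 12 * freqSq k ^ 2)⁻¹) :
    ∑ k ∈ freqBox 1 N, e k ^ 4 ≤ 144 / c ^ 11 := by
  have e0 : e 0 = 0 := by
    have := he 0
    rw [freqSq_zero, zero_mul] at this
    exact pow_eq_zero_iff (n := 3) (by norm_num) |>.mp this
  rw [sum_eq_sum_erase (by rw [e0]; norm_num)]
  refine (sum_erase_le_of_le_prod (A := 16 / c ^ 10) hc (by positivity) ?_ N).trans (le_of_eq ?_)
  · intro k hk
    rw [Fin.prod_univ_one]
    have h1 := cbrt_lapSymbol_sq_le_profile hc hk (he k) 0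
    have h2 := cbrt_lapSymbol_sq_le hc (he k)
    calc e k ^ 4 = e k ^ 2 * e k ^ 2 := by ring
      _ ≤ 2 / c ^ 4 * (8 / c ^ 6 * profile c (k 0)) :=
        mul_le_mul h2 h1 (by positivity) (by positivity)
      _ = _ := by field_simp; ring
  · field_simp; norm_num

theorem sum_cbrt_lapSymbol_le_two {c : ℝ} (hc : 0 < c) {e : (Fin 2 → ℤ) → ℝ}
    (he : ∀ k, e k ^ 3 = freqSq k * (1 + c ^ 12 * freqSq k ^ 2)⁻¹) :
    ∑ k ∈ freqBox 2 N, e k ^ 4 ≤ 5184 / c ^ 14 := by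
  have e0 : e 0 = 0 := by
    have := he 0
    rw [freqSq_zero, zero_mul] at this
    exact pow_eq_zero_iff (n := 3) (by norm_num) |>.mp this
  rw [sum_eq_sum_erase (by rw [e0]; norm_num)]
  refine (sum_erase_le_of_le_prod (A := 8 / c ^ 6) hc (by positivity) ?_ N).trans (le_of_eq ?_)
  · intro k hk
    rw [Fin.prod_univ_two]
    have h1 := cbrt_lapSymbol_sq_le_profile hc hk (he k) 0
    have h2 := cbrt_lapSymbol_sq_le_profile hc hk (he k) 1
    calc e k ^ 4 = e k ^ 2 * e k ^ 2 := by ring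
      _ ≤ _ := mul_le_mul h1 h2 (by positivity) ((sq_nonneg _).trans h1)
  · field_simp; norm_num

theorem exists_pow_twelve_eq {β : ℝ} (hβ : 0 < β) : ∃ c : ℝ, 0 < c ∧ c ^ 12 = β := by
  refine ⟨β ^ (1 / 12 : ℝ), by positivity, ?_⟩
  rw [← Real.rpow_natCast, ← Real.rpow_mul (by positivity)]; norm_num

theorem rpow_pow_twelve {c : ℝ} (hc : 0 < c) (a : ℝ) : (c ^ 12) ^ a = c ^ (12 * a) := by
  rw [← Real.rpow_natCast, ← Real.rpow_mul hc.le]; norm_num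

/-- The exponent comes from `(c^{-11})^{3/4} = (c¹²)^{-11/16}`. -/
theorem lap_kernel_bound_one : ∃ B : ℝ, 0 < B ∧ ∀ (ν τ : ℝ) (N : ℕ), 0 < ν → 0 < τ →
    ∀ g : Torus 1 → ℝ, MemLp g (4 / 3) (torusVol 1) →
      eLpNorm (fun x => τ * lap (resolvent (ν * τ) (piN N g)) x) ∞ (torusVol 1) ≤
        ENNReal.ofReal (B * τ * (ν * τ) ^ (-(11 / 16) : ℝ)) * eLpNorm g (4 / 3) (torusVol 1) := by
  refine ⟨(144 ^ 3) ^ (1 / 4 : ℝ), by positivity, fun ν τ N hν hτ g hg => ?_⟩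
  obtain ⟨c, hc, hcβ⟩ := exists_pow_twelve_eq (mul_pos hν hτ)
  rw [← hcβ]
  refine (eLpNorm_lap_resolvent_le (S := 144 / c ^ 11) (by positivity) hτ
    (fun e he => sum_cbrt_lapSymbol_le_one hc he) hg).trans
    (mul_le_mul' (ENNReal.ofReal_le_ofReal (le_of_eq ?_)) le_rfl)
  rw [rpow_pow_twelve hc, div_pow, Real.div_rpow (by positivity) (by positivity), ← pow_mul,
    ← Real.rpow_natCast c, ← Real.rpow_mul hc.le, div_eq_mul_inv, ← Real.rpow_neg hc.le]
  norm_num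
  ring

/-- The exponent comes from `(c^{-14})^{3/4} = (c¹²)^{-7/8}`. -/
theorem lap_kernel_bound_two : ∃ B : ℝ, 0 < B ∧ ∀ (ν τ : ℝ) (N : ℕ), 0 < ν → 0 < τ →
    ∀ g : Torus 2 → ℝ, MemLp g (4 / 3) (torusVol 2) →
      eLpNorm (fun x => τ * lap (resolvent (ν * τ) (piN N g)) x) ∞ (torusVol 2) ≤
        ENNReal.ofReal (B * τ * (ν * τ) ^ (-(7 / 8) : ℝ)) * eLpNorm g (4 / 3) (torusVol 2) := by
  refine ⟨(5184 ^ 3) ^ (1 / 4 : ℝ), by positivity, fun ν τ N hν hτ g hg => ?_⟩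
  obtain ⟨c, hc, hcβ⟩ := exists_pow_twelve_eq (mul_pos hν hτ)
  rw [← hcβ]
  refine (eLpNorm_lap_resolvent_le (S := 5184 / c ^ 14) (by positivity) hτ
    (fun e he => sum_cbrt_lapSymbol_le_two hc he) hg).trans
    (mul_le_mul' (ENNReal.ofReal_le_ofReal (le_of_eq ?_)) le_rfl)
  rw [rpow_pow_twelve hc, div_pow, Real.div_rpow (by positivity) (by positivity), ← pow_mul,
    ← Real.rpow_natCast c, ← Real.rpow_mul hc.le, div_eq_mul_inv, ← Real.rpow_neg hc.le]
  norm_num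
  ring

/-! ### The Poisson kernel and the integral of the weight. -/

theorem integral_fourier (n : ℤ) :
    ∫ t : UnitAddCircle, fourier n t ∂AddCircle.haarAddCircle = if n = 0 then 1 else 0 := by
  have h := orthonormal_iff_ite.mp (orthonormal_fourier (T := (1 : ℝ))) 0 n
  rw [ContinuousMap.inner_toLp] at h
  simp only [fourier_zero] at h
  simp only [eq_comm (a := n)]
  rw [← h]
  simp

/-- In the geometric series only the constant term has nonzero mean. -/
theorem integral_inv_one_sub_mul_fourier {r : ℝ} (hr0 : 0 ≤ r) (hr : r < 1) :
    ∫ t : UnitAddCircle, (1 - (r : ℂ) * fourier 1 t)⁻¹ ∂AddCircle.haarAddCircle = 1 := by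
  have hpow : ∀ (n : ℕ) (t : UnitAddCircle), fourier 1 t ^ n = fourier (n : ℤ) t := fun n t => by
    induction n with
    | zero => simp
    | succ n ih => rw [pow_succ, ih, Nat.cast_succ, fourier_add]
  have hnorm : ∀ t : UnitAddCircle, ‖(fourier 1 t : ℂ)‖ = 1 := fun t => by
    rw [fourier_apply]; exact Circle.norm_coe _
  have hn : ∀ t : UnitAddCircle, ‖(r : ℂ) * fourier 1 t‖ = r := fun t => by
    rw [norm_mul, hnorm, mul_one, Complex.norm_real, Real.norm_of_nonneg hr0]
  have h := hasSum_integral_of_summable_integral_norm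
    (μ := (AddCircle.haarAddCircle : Measure UnitAddCircle))
    (F := fun (n : ℕ) t => ((r : ℂ) * fourier 1 t) ^ n) (fun n => by
      have hc : Continuous fun t : UnitAddCircle => ((r : ℂ) * fourier 1 t) ^ n := by fun_prop
      exact hc.integrable_of_hasCompactSupport (HasCompactSupport.of_compactSpace _)) (by
      simp only [norm_pow, hn]
      simpa using summable_geometric_of_lt_one hr0 hr)
  have e : ∀ n : ℕ, ∫ t : UnitAddCircle, ((r : ℂ) * fourier 1 t) ^ n ∂AddCircle.haarAddCircle =
      if n = 0 then 1 else 0 := fun n => by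
    simp only [mul_pow, hpow, integral_const_mul, integral_fourier]
    by_cases hn : n = 0
    · simp [hn]
    · simp [hn]
  have e2 : ∀ t : UnitAddCircle, ∑' n : ℕ, ((r : ℂ) * fourier 1 t) ^ n =
      (1 - (r : ℂ) * fourier 1 t)⁻¹ := fun t =>
    tsum_geometric_of_norm_lt_one (by rw [hn]; exact hr)
  simp only [e, e2] at h
  exact h.unique (hasSum_ite_eq 0 1)

/-- The mean of the Poisson kernel. -/
theorem integral_inv_norm_sq {r : ℝ} (hr0 : 0 ≤ r) (hr : r < 1) :
    ∫ t : UnitAddCircle, (‖1 - (r : ℂ) * fourier 1 t‖ ^ 2)⁻¹ ∂AddCircle.haarAddCircle =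
      (1 - r ^ 2)⁻¹ := by
  have hnorm : ∀ t : UnitAddCircle, Complex.normSq (fourier 1 t : ℂ) = 1 := fun t => by
    rw [Complex.normSq_eq_norm_sq, fourier_apply]; simp only [Circle.norm_coe, one_pow]
  have hne : ∀ t : UnitAddCircle, 1 - (r : ℂ) * fourier 1 t ≠ 0 := fun t h => by
    have h1 : (r : ℂ) * fourier 1 t = 1 := (sub_eq_zero.mp h).symm
    have h2 := congrArg Complex.normSq h1
    rw [map_mul, hnorm, Complex.normSq_ofReal, map_one] at h2
    nlinarith
  have e : ∀ t : UnitAddCircle, (‖1 - (r : ℂ) * fourier 1 t‖ ^ 2)⁻¹ =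
      (1 - r ^ 2)⁻¹ * (2 * RCLike.re ((1 - (r : ℂ) * fourier 1 t)⁻¹) - 1) := fun t => by
    have h1 := hnorm t
    have h2 : Complex.normSq (1 - (r : ℂ) * fourier 1 t) ≠ 0 := by
      rw [Ne, Complex.normSq_eq_zero]; exact hne t
    have h3 : 1 - r ^ 2 ≠ 0 := by nlinarith
    rw [RCLike.re_eq_complex_re, Complex.inv_re, ← Complex.normSq_eq_norm_sq]
    field_simp
    simp only [Complex.normSq_apply, Complex.sub_re, Complex.sub_im, Complex.one_re, Complex.one_im,
      Complex.re_ofReal_mul, Complex.im_ofReal_mul] at h1 ⊢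
    linear_combination r ^ 2 * h1
  have hc : Continuous fun t : UnitAddCircle => (1 - (r : ℂ) * fourier 1 t)⁻¹ :=
    Continuous.inv₀ (by fun_prop) hne
  have hi : Integrable (fun t : UnitAddCircle => (1 - (r : ℂ) * fourier 1 t)⁻¹)
      AddCircle.haarAddCircle :=
    hc.integrable_of_hasCompactSupport (HasCompactSupport.of_compactSpace _)
  simp only [e]
  rw [integral_const_mul, integral_sub (hi.re.const_mul 2) (integrable_const _),
    integral_const_mul, integral_re hi, integral_inv_one_sub_mul_fourier hr0 hr]
  norm_num

/-- The integrand is at most `γ²` times `|1 - rz|⁻²` with `r = 1 - γ/2`, since `γ² + |1 - z|² ≥ |1 -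
rz|²` on the unit circle. The mean of the latter is `(1 - r²)⁻¹`, of order `1/γ`. -/
theorem integral_weight_circle_le {γ : ℝ} (hγ : 0 < γ) (hγ1 : γ ≤ 1) :
    ∫ t : UnitAddCircle, (1 + (γ ^ 2)⁻¹ * ‖1 - (fourier 1 t : ℂ)‖ ^ 2)⁻¹ ∂AddCircle.haarAddCircle ≤
      2 * γ := by
  have hr0 : 0 ≤ 1 - γ / 2 := by linarith
  have hr : 1 - γ / 2 < 1 := by linarith
  have hnorm : ∀ t : UnitAddCircle, Complex.normSq (fourier 1 t : ℂ) = 1 := fun t => by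
    rw [Complex.normSq_eq_norm_sq, fourier_apply]; simp only [Circle.norm_coe, one_pow]
  have hpos : ∀ t : UnitAddCircle, 0 < ‖1 - ((1 - γ / 2 : ℝ) : ℂ) * fourier 1 t‖ ^ 2 := fun t => by
    rw [← Complex.normSq_eq_norm_sq]
    have h1 := hnorm t
    simp only [Complex.normSq_apply, Complex.sub_re, Complex.sub_im, Complex.one_re, Complex.one_im,
      Complex.re_ofReal_mul, Complex.im_ofReal_mul] at h1 ⊢
    have hx : (fourier 1 t : ℂ).re ≤ 1 := by nlinarith [sq_nonneg (fourier 1 t : ℂ).im]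
    have h2 : 0 < 1 - (1 - γ / 2) * (fourier 1 t : ℂ).re := by nlinarith
    nlinarith [mul_pos h2 h2, sq_nonneg ((1 - γ / 2) * (fourier 1 t : ℂ).im)]
  calc _ ≤ ∫ t : UnitAddCircle, γ ^ 2 * (‖1 - ((1 - γ / 2 : ℝ) : ℂ) * fourier 1 t‖ ^ 2)⁻¹
        ∂AddCircle.haarAddCircle := by
        have c1 : Continuous fun t : UnitAddCircle =>
            (1 + (γ ^ 2)⁻¹ * ‖1 - (fourier 1 t : ℂ)‖ ^ 2)⁻¹ :=
          Continuous.inv₀ (by fun_prop) fun t => by positivity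
        have c2 : Continuous fun t : UnitAddCircle =>
            γ ^ 2 * (‖1 - ((1 - γ / 2 : ℝ) : ℂ) * fourier 1 t‖ ^ 2)⁻¹ :=
          continuous_const.mul (Continuous.inv₀ (by fun_prop) fun t => (hpos t).ne')
        refine integral_mono
          (c1.integrable_of_hasCompactSupport (HasCompactSupport.of_compactSpace _))
          (c2.integrable_of_hasCompactSupport (HasCompactSupport.of_compactSpace _)) fun t => ?_
        dsimp only
        have e : (1 + (γ ^ 2)⁻¹ * ‖1 - (fourier 1 t : ℂ)‖ ^ 2)⁻¹ =
            γ ^ 2 * (γ ^ 2 + ‖1 - (fourier 1 t : ℂ)‖ ^ 2)⁻¹ := by field_simp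
        rw [e]
        refine mul_le_mul_of_nonneg_left (inv_anti₀ (hpos t) ?_) (by positivity)
        have h1 := hnorm t
        simp only [← Complex.normSq_eq_norm_sq]
        simp only [Complex.normSq_apply, Complex.sub_re, Complex.sub_im, Complex.one_re,
          Complex.one_im, Complex.re_ofReal_mul, Complex.im_ofReal_mul] at h1 ⊢
        have hx : (fourier 1 t : ℂ).re ≤ 1 := by nlinarith [sq_nonneg (fourier 1 t : ℂ).im]
        nlinarith
    _ = γ ^ 2 * (1 - (1 - γ / 2) ^ 2)⁻¹ := by
        rw [integral_const_mul, integral_inv_norm_sq hr0 hr]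
    _ ≤ 2 * γ := by
        rw [← div_eq_mul_inv, div_le_iff₀ (by nlinarith)]
        nlinarith

/-- The weight `1 + γ⁻² ∑_i |1 - e^{2πi y_i}|²`. -/
def weight {d : ℕ} (γ : ℝ) (y : Torus d) : ℝ :=
  1 + (γ ^ 2)⁻¹ * ∑ i, ‖1 - mFourier (Pi.single i 1) y‖ ^ 2

theorem continuous_weight (γ : ℝ) : Continuous (weight (d := d) γ) := by
  unfold weight; fun_prop

theorem one_le_weight (γ : ℝ) (y : Torus d) : 1 ≤ weight γ y := by
  unfold weight
  have : 0 ≤ (γ ^ 2)⁻¹ * ∑ i, ‖1 - mFourier (Pi.single i 1) y‖ ^ 2 := by positivity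
  linarith

/-- The square of the weight dominates the product of the one-dimensional factors, as `(1 + A + B)²
≥ (1 + A)(1 + B)`; the integral then factorises. -/
theorem integral_inv_weight_sq_le (hd : d = 1 ∨ d = 2) {γ : ℝ} (hγ : 0 < γ) (hγ1 : γ ≤ 1) :
    ∫ y, (weight γ y ^ 2)⁻¹ ∂(torusVol d) ≤ (2 * γ) ^ d := by
  set f : UnitAddCircle → ℝ := fun t => (1 + (γ ^ 2)⁻¹ * ‖1 - (fourier 1 t : ℂ)‖ ^ 2)⁻¹ with hf
  have cf : Continuous f := Continuous.inv₀ (by fun_prop) fun t => by positivity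
  have hf0 : ∀ t, 0 ≤ f t := fun t => by rw [hf]; positivity
  calc ∫ y, (weight γ y ^ 2)⁻¹ ∂(torusVol d) ≤ ∫ y : Torus d, ∏ i, f (y i) ∂(torusVol d) := by
        refine integral_mono (integrable_of_continuous (Continuous.inv₀
            ((continuous_weight γ).pow 2) fun y => ?_))
          (integrable_of_continuous (by fun_prop)) fun y => ?_
        · have := one_le_weight γ y
          positivity
        · dsimp only
          simp only [hf]
          rw [Finset.prod_inv_distrib]
          refine inv_anti₀ (by positivity) ?_
          have h1 := one_le_weight γ y
          simp only [weight, mFourier_single] at h1 ⊢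
          rcases hd with rfl | rfl
          · rw [Fin.prod_univ_one]
            simp only [Fin.sum_univ_one] at h1 ⊢
            nlinarith
          · rw [Fin.prod_univ_two]
            simp only [Fin.sum_univ_two] at h1 ⊢
            have hA : 0 ≤ (γ ^ 2)⁻¹ * ‖1 - (fourier 1 (y 0) : ℂ)‖ ^ 2 := by positivity
            have hB : 0 ≤ (γ ^ 2)⁻¹ * ‖1 - (fourier 1 (y 1) : ℂ)‖ ^ 2 := by positivity
            rw [mul_add (γ ^ 2)⁻¹]
            generalize (γ ^ 2)⁻¹ * ‖1 - (fourier 1 (y 0) : ℂ)‖ ^ 2 = A at *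
            generalize (γ ^ 2)⁻¹ * ‖1 - (fourier 1 (y 1) : ℂ)‖ ^ 2 = B at *
            nlinarith [mul_nonneg hA hB]
    _ = ∏ _i : Fin d, ∫ t, f t ∂AddCircle.haarAddCircle :=
        integral_fintype_prod_eq_prod (fun _ => f)
    _ ≤ (2 * γ) ^ d := by
        rw [Finset.prod_const, Finset.card_univ, Fintype.card_fin]
        exact pow_le_pow_left₀ (integral_nonneg hf0) (integral_weight_circle_le hγ hγ1) d

/-! ### Slow variation of the symbol and the weighted `L²` norm of the kernel. -/

theorem summable_symbol (hd : d = 1 ∨ d = 2) {c : ℝ} (hc : 0 < c) :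
    Summable (fun k : Fin d → ℤ => (1 + c ^ 12 * freqSq k ^ 2)⁻¹) ∧
      ∑' k : Fin d → ℤ, (1 + c ^ 12 * freqSq k ^ 2)⁻¹ ≤ 1 + (36 / c ^ 3) ^ d := by
  have h0 := symbol_nonneg (d := d) (pow_pos hc 12)
  have h : ∀ s : Finset (Fin d → ℤ), ∑ k ∈ s, (1 + c ^ 12 * freqSq k ^ 2)⁻¹ ≤
      1 + (36 / c ^ 3) ^ d := fun s => by
    refine (sum_le_of_le_prod hc (A := 4 / c ^ 2) (by positivity) h0
      (fun k hk => symbol_le_prod hc hd hk) s).trans (le_of_eq ?_)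
    have e : 9 * (4 / c ^ 2) / c = 36 / c ^ 3 := by field_simp; norm_num
    rw [e, freqSq_zero]; norm_num
  exact ⟨summable_of_sum_le h0 h, Real.tsum_le_of_sum_le h0 h⟩

/-- Only the `i`-th entry changes, by one, so the difference is `(2π)²` times the sum of the two
entries, and `2π|k_i| ≤ √(freqSq k)`. -/
theorem abs_freqSq_sub_le (k : Fin d → ℤ) (i : Fin d) :
    |freqSq k - freqSq (k - Pi.single i 1)| ≤
      2 * Real.pi * (√(freqSq k) + √(freqSq (k - Pi.single i 1))) := by
  have hle : ∀ l : Fin d → ℤ, 2 * Real.pi * |(l i : ℝ)| ≤ √(freqSq l) := fun l => by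
    refine Real.le_sqrt_of_sq_le ?_
    rw [mul_pow, sq_abs, freqSq]
    refine mul_le_mul_of_nonneg_left ?_ (by positivity)
    exact Finset.single_le_sum (f := fun i => (l i : ℝ) ^ 2) (fun _ _ => sq_nonneg _)
      (Finset.mem_univ i)
  have e : freqSq k - freqSq (k - Pi.single i 1) =
      (2 * Real.pi) ^ 2 * ((k i : ℝ) + ((k - Pi.single i 1 : Fin d → ℤ) i : ℝ)) := by
    rw [freqSq, freqSq, ← mul_sub, ← Finset.sum_sub_distrib]
    congr 1
    rw [Finset.sum_eq_single i]
    · simp only [Pi.sub_apply, Pi.single_eq_same]; push_cast; ring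
    · intro j _ hj; simp [Pi.single_eq_of_ne hj]
    · simp
  rw [e, abs_mul, abs_of_nonneg (by positivity), pow_two, mul_assoc]
  refine mul_le_mul_of_nonneg_left ?_ (by positivity)
  have h1 := hle k
  have h2 := hle (k - Pi.single i 1)
  have h3 := abs_add_le (k i : ℝ) ((k - Pi.single i 1 : Fin d → ℤ) i : ℝ)
  have h4 : 0 < 2 * Real.pi := by positivity
  nlinarith

/-- The multiplier of the resolvent varies slowly. -/
theorem abs_symbol_sub_le {c : ℝ} (hc : 0 < c) (k : Fin d → ℤ) (i : Fin d) :
    |(1 + c ^ 12 * freqSq k ^ 2)⁻¹ - (1 + c ^ 12 * freqSq (k - Pi.single i 1) ^ 2)⁻¹| ≤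
      13 * c ^ 3 * ((1 + c ^ 12 * freqSq k ^ 2)⁻¹ +
        (1 + c ^ 12 * freqSq (k - Pi.single i 1) ^ 2)⁻¹) := by
  have h := abs_freqSq_sub_le k i
  have hp := freqSq_nonneg k
  have hq := freqSq_nonneg (k - Pi.single i 1)
  generalize freqSq k = p at *
  generalize freqSq (k - Pi.single i 1) = q at *
  have hA := Real.sqrt_nonneg p
  have hB := Real.sqrt_nonneg q
  obtain ⟨hpA, hqB⟩ : p = √p ^ 2 ∧ q = √q ^ 2 := ⟨(Real.sq_sqrt hp).symm, (Real.sq_sqrt hq).symm⟩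
  generalize √p = A at *
  generalize √q = B at *
  subst hpA hqB
  have hpi : 2 * Real.pi ≤ 13 / 2 := by linarith [Real.pi_lt_d2]
  have e : (1 + c ^ 12 * (A ^ 2) ^ 2)⁻¹ - (1 + c ^ 12 * (B ^ 2) ^ 2)⁻¹ =
      -(c ^ 12 * ((A ^ 2 - B ^ 2) * (A ^ 2 + B ^ 2))) /
        ((1 + c ^ 12 * (A ^ 2) ^ 2) * (1 + c ^ 12 * (B ^ 2) ^ 2)) := by
    field_simp; ring
  have e2 : 13 * c ^ 3 * ((1 + c ^ 12 * (A ^ 2) ^ 2)⁻¹ + (1 + c ^ 12 * (B ^ 2) ^ 2)⁻¹) =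
      13 * c ^ 3 * ((1 + c ^ 12 * (A ^ 2) ^ 2) + (1 + c ^ 12 * (B ^ 2) ^ 2)) /
        ((1 + c ^ 12 * (A ^ 2) ^ 2) * (1 + c ^ 12 * (B ^ 2) ^ 2)) := by
    field_simp; ring
  rw [e, e2, abs_div, abs_of_pos (a := (1 + c ^ 12 * (A ^ 2) ^ 2) * _) (by positivity)]
  refine div_le_div_of_nonneg_right ?_ (by positivity)
  rw [abs_neg, abs_mul, abs_mul, abs_of_pos (a := c ^ 12) (by positivity),
    abs_of_nonneg (a := A ^ 2 + B ^ 2) (by positivity)]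
  have h1 : |A ^ 2 - B ^ 2| ≤ 13 / 2 * (A + B) :=
    h.trans (mul_le_mul_of_nonneg_right hpi (by positivity))
  have h2 : (A + B) * (A ^ 2 + B ^ 2) ≤ 2 * (A ^ 3 + B ^ 3) := by
    nlinarith [mul_nonneg (add_nonneg hA hB) (sq_nonneg (A - B))]
  -- With `y = c³X` this is `y³ ≤ 1 + y⁴`. It turns the numerator `c¹²X³ = c³·y³` into `c³` times a
  -- denominator of the symbol, which is where the small factor `c³` arises.
  have h3 : ∀ X : ℝ, 0 ≤ X → (c ^ 3) ^ 3 * X ^ 3 ≤ 1 + c ^ 12 * (X ^ 2) ^ 2 := fun X hX => by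
    have := pow_le_one_add (y := c ^ 3 * X) (by positivity) (a := 3) (b := 0) (n := 4) (by norm_num)
    nlinarith
  calc c ^ 12 * (|A ^ 2 - B ^ 2| * (A ^ 2 + B ^ 2))
      ≤ c ^ 12 * (13 / 2 * (A + B) * (A ^ 2 + B ^ 2)) := by gcongr
    _ = 13 / 2 * c ^ 12 * ((A + B) * (A ^ 2 + B ^ 2)) := by ring
    _ ≤ 13 / 2 * c ^ 12 * (2 * (A ^ 3 + B ^ 3)) := by gcongr
    _ = 13 * c ^ 3 * ((c ^ 3) ^ 3 * A ^ 3 + (c ^ 3) ^ 3 * B ^ 3) := by ring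
    _ ≤ _ := by
      have := h3 A hA
      have := h3 B hB
      gcongr

/-- The multiplier `m` may differ from the symbol wherever the coefficient of `g` vanishes; this
allows removing the zero mode for mean-zero `g`. -/
theorem enorm_resolvent_le {β : ℝ} {g : Torus d → ℝ} (hg : Integrable g (torusVol d))
    {m : (Fin d → ℤ) → ℝ} (hm : Summable fun k => ‖(m k : ℂ)‖)
    (hmg : ∀ k, (((1 + β * freqSq k ^ 2)⁻¹ : ℝ) : ℂ) * coeff g k = m k * coeff g k) (x : Torus d) :
    ‖resolvent β g x‖ₑ ≤
      ‖∫ y, fourierSum (fun k => (m k : ℂ)) y * ((g (x + y) : ℝ) : ℂ) ∂(torusVol d)‖ₑ := by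
  have hx : Integrable (fun y => ((g (x + y) : ℝ) : ℂ)) (torusVol d) :=
    ((measurePreserving_translate x).integrable_comp_of_integrable hg).ofReal
  have h := (hasSum_integral_fourierSum_mul hm hx).tsum_eq
  have e : ∀ k : Fin d → ℤ, (m k : ℂ) * ∫ y, mFourier k y * ((g (x + y) : ℝ) : ℂ) ∂(torusVol d) =
      (starRingEnd ℂ) ((((1 + β * freqSq k ^ 2)⁻¹ : ℝ) : ℂ) * coeff g k * mFourier k x) :=
    fun k => by
      rw [integral_mFourier_mul (fun y => g (x + y)), coeff_translate, hmg]
      simp only [map_mul, Complex.conj_ofReal]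
      ring
  simp only [e] at h
  rw [← Complex.conj_tsum] at h
  rw [resolvent, ← h, ← ofReal_norm, ← ofReal_norm, RCLike.norm_conj]
  exact ENNReal.ofReal_le_ofReal (Complex.abs_re_le_norm _)

theorem eLpNorm_two_eq_sqrt {E : Type*} [NormedAddCommGroup E] {f : Torus d → E}
    (hf : Continuous f) :
    eLpNorm f 2 (torusVol d) = ENNReal.ofReal √(∫ y, ‖f y‖ ^ 2 ∂(torusVol d)) := by
  rw [(hf.memLp_of_hasCompactSupport
    (HasCompactSupport.of_compactSpace _)).eLpNorm_eq_integral_rpow_norm (by norm_num)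
    (by norm_num)]
  have e : (ENNReal.toReal 2) = 2 := by norm_num
  simp only [e, Real.rpow_two]
  rw [← one_div, ← Real.sqrt_eq_rpow]

/-- The weighted `L²` norm of a kernel with slowly varying coefficients. -/
theorem integral_norm_sq_mul_weight_le_tsum {c : ℝ} (hc : 0 < c) {m : (Fin d → ℤ) → ℝ}
    (hs : Summable m) (h0 : ∀ k, 0 ≤ m k) (h1 : ∀ k, m k ≤ 1)
    (hdiff : ∀ k i, |m k - m (k - Pi.single i 1)| ≤ 13 * c ^ 3 * (m k + m (k - Pi.single i 1))) :
    ∫ y, ‖fourierSum (fun k => (m k : ℂ)) y‖ ^ 2 * weight (c ^ 3) y ∂(torusVol d) ≤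
      (1 + 676 * d) * ∑' k, m k := by
  have hn : Summable fun k => ‖(m k : ℂ)‖ := by
    simpa only [Complex.norm_real, Real.norm_of_nonneg (h0 _)] using hs
  have hn' : ∀ j, Summable fun k => ‖(m (k - j) : ℂ)‖ := fun j =>
    (Equiv.subRight j).summable_iff.mpr hn
  have hs' : ∀ j, Summable fun k => m (k - j) := fun j => (Equiv.subRight j).summable_iff.mpr hs
  have hnd : ∀ j, Summable fun k => ‖(m k : ℂ) - (m (k - j) : ℂ)‖ := fun j =>
    Summable.of_nonneg_of_le (fun _ => norm_nonneg _) (fun k => norm_sub_le _ _) (hn.add (hn' j))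
  have hc1 := continuous_fourierSum hn
  have hsq : ∫ y, ‖fourierSum (fun k => (m k : ℂ)) y‖ ^ 2 ∂(torusVol d) ≤ ∑' k, m k := by
    rw [← (hasSum_norm_sq_fourierSum hn).tsum_eq]
    refine (hasSum_norm_sq_fourierSum hn).summable.tsum_le_tsum (fun k => ?_) hs
    rw [Complex.norm_real, Real.norm_of_nonneg (h0 k)]
    have := h0 k
    have := h1 k
    nlinarith
  -- The slow variation produces a factor `c⁶`, which cancels the `γ⁻² = c⁻⁶` of the weight; `m ≤ 1`
  -- reduces squares to first powers.
  have hsd : ∀ i : Fin d, ∫ y, ‖1 - mFourier (Pi.single i 1) y‖ ^ 2 *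
      ‖fourierSum (fun k => (m k : ℂ)) y‖ ^ 2 ∂(torusVol d) ≤ 676 * c ^ 6 * ∑' k, m k := fun i => by
    simp only [← mul_pow, ← norm_mul, sub_mFourier_mul_fourierSum hn]
    rw [← (hasSum_norm_sq_fourierSum (hnd (Pi.single i 1))).tsum_eq]
    have hle : ∀ k, ‖(m k : ℂ) - (m (k - Pi.single i 1) : ℂ)‖ ^ 2 ≤
        338 * c ^ 6 * (m k + m (k - Pi.single i 1)) := fun k => by
      rw [← Complex.ofReal_sub, Complex.norm_real, Real.norm_eq_abs]
      have hk := hdiff k i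
      have a0 := h0 k
      have b0 := h0 (k - Pi.single i 1)
      have a1 := h1 k
      have b1 := h1 (k - Pi.single i 1)
      calc |m k - m (k - Pi.single i 1)| ^ 2
          ≤ (13 * c ^ 3 * (m k + m (k - Pi.single i 1))) ^ 2 := by
            exact pow_le_pow_left₀ (abs_nonneg _) hk 2
        _ = 169 * c ^ 6 * (m k + m (k - Pi.single i 1)) ^ 2 := by ring
        _ ≤ 169 * c ^ 6 * (2 * (m k + m (k - Pi.single i 1))) := by
            refine mul_le_mul_of_nonneg_left ?_ (by positivity)
            nlinarith
        _ = _ := by ring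
    refine ((hasSum_norm_sq_fourierSum (hnd (Pi.single i 1))).summable.tsum_le_tsum hle
      ((hs.add (hs' _)).mul_left _)).trans (le_of_eq ?_)
    have hshift : ∑' k, m (k - Pi.single i 1) = ∑' k, m k :=
      (Equiv.subRight (Pi.single i 1)).tsum_eq m
    rw [tsum_mul_left, hs.tsum_add (hs' _), hshift]
    ring
  have e : ∀ y, ‖fourierSum (fun k => (m k : ℂ)) y‖ ^ 2 * weight (c ^ 3) y =
      ‖fourierSum (fun k => (m k : ℂ)) y‖ ^ 2 + (c ^ 6)⁻¹ * ∑ i : Fin d,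
        ‖1 - mFourier (Pi.single i 1) y‖ ^ 2 * ‖fourierSum (fun k => (m k : ℂ)) y‖ ^ 2 :=
    fun y => by
      rw [weight, ← Finset.sum_mul, ← pow_mul]; ring
  simp only [e]
  rw [integral_add (integrable_of_continuous (by fun_prop)) (integrable_of_continuous (by fun_prop)),
    integral_const_mul, integral_finsetSum _ fun i _ => integrable_of_continuous (by fun_prop)]
  have hsum := Finset.sum_le_sum fun (i : Fin d) (_ : i ∈ Finset.univ) => hsd i
  rw [Finset.sum_const, Finset.card_univ, Fintype.card_fin, nsmul_eq_mul] at hsum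
  have hmul := mul_le_mul_of_nonneg_left hsum (inv_nonneg.mpr (pow_pos hc 6).le)
  refine (add_le_add hsq hmul).trans (le_of_eq ?_)
  field_simp

theorem integral_norm_sq_mul_weight_le (hd : d = 1 ∨ d = 2) {c : ℝ} (hc : 0 < c) :
    ∫ y, ‖fourierSum (fun k : Fin d → ℤ => (((1 + c ^ 12 * freqSq k ^ 2)⁻¹ : ℝ) : ℂ)) y‖ ^ 2 *
      weight (c ^ 3) y ∂(torusVol d) ≤ (1 + 676 * d) * (1 + (36 / c ^ 3) ^ d) := by
  obtain ⟨hs, hM⟩ := summable_symbol hd hc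
  exact (integral_norm_sq_mul_weight_le_tsum hc hs (symbol_nonneg (pow_pos hc 12))
    (symbol_le_one (pow_pos hc 12)) (abs_symbol_sub_le hc)).trans
    (mul_le_mul_of_nonneg_left hM (by positivity))

/-! ### The bound from `L⁴` to `L^∞` for the resolvent. -/

theorem holderTriple_four_four : ENNReal.HolderTriple 4 4 2 := by
  constructor
  have h4 : (4 : ℝ≥0∞)⁻¹ = ENNReal.ofReal (1 / 4) := by
    rw [ENNReal.ofReal_div_of_pos (by norm_num)]; norm_num
  have h2 : (2 : ℝ≥0∞)⁻¹ = ENNReal.ofReal (1 / 2) := by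
    rw [ENNReal.ofReal_div_of_pos (by norm_num)]; norm_num
  rw [h4, h2, ← ENNReal.ofReal_add (by norm_num) (by norm_num)]
  norm_num

/-- Hölder's inequality with a weight: `|∫ K g| ≤ (∫ |K|² w)^{1/2} (∫ w⁻²)^{1/4} ‖g‖_4`. -/
theorem enorm_integral_mul_le_weight {K : Torus d → ℂ} (hK : Continuous K) {w : Torus d → ℝ}
    (hw : Continuous w) (hw1 : ∀ y, 1 ≤ w y) {g : Torus d → ℝ}
    (hg : AEStronglyMeasurable g (torusVol d)) :
    ‖∫ y, K y * (g y : ℂ) ∂(torusVol d)‖ₑ ≤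
      ENNReal.ofReal (√(∫ y, ‖K y‖ ^ 2 * w y ∂(torusVol d)) *
        (∫ y, (w y ^ 2)⁻¹ ∂(torusVol d)) ^ (1 / 4 : ℝ)) * eLpNorm g 4 (torusVol d) := by
  have hs : ∀ y, 0 < √(w y) := fun y => Real.sqrt_pos.mpr (by linarith [hw1 y])
  have hsw : Continuous fun y => √(w y) := hw.sqrt
  have hsi : Continuous fun y => (√(w y))⁻¹ := hsw.inv₀ fun y => (hs y).ne'
  have e : ∀ y, K y * (g y : ℂ) = (√(w y) • K y) * (((g • fun y => (√(w y))⁻¹) y : ℝ) : ℂ) :=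
    fun y => by
      have : ((√(w y) : ℝ) : ℂ) ≠ 0 := by exact_mod_cast (hs y).ne'
      simp only [Pi.smul_apply', smul_eq_mul, Complex.real_smul, Complex.ofReal_mul,
        Complex.ofReal_inv]
      field_simp
  simp only [e]
  have hKw : Continuous fun y => √(w y) • K y := hsw.smul hK
  refine (enorm_integral_mul_le (p := 2) (q := 2) (hg.smul hsi.aestronglyMeasurable)
    hKw.aestronglyMeasurable).trans ?_
  have h1 : eLpNorm (fun y => √(w y) • K y) 2 (torusVol d) =
      ENNReal.ofReal √(∫ y, ‖K y‖ ^ 2 * w y ∂(torusVol d)) := by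
    rw [eLpNorm_two_eq_sqrt hKw]
    congr 2
    refine integral_congr_ae (Filter.Eventually.of_forall fun y => ?_)
    dsimp only
    rw [norm_smul, mul_pow, Real.norm_of_nonneg (hs y).le, Real.sq_sqrt (by linarith [hw1 y]),
      mul_comm]
  have h2 : eLpNorm (fun y => (√(w y))⁻¹) 4 (torusVol d) =
      ENNReal.ofReal ((∫ y, (w y ^ 2)⁻¹ ∂(torusVol d)) ^ (1 / 4 : ℝ)) := by
    rw [(memLp_of_continuous hsi 4).eLpNorm_eq_integral_rpow_norm (by norm_num) (by norm_num)]
    have h4 : (ENNReal.toReal 4) = ((4 : ℕ) : ℝ) := by norm_num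
    simp only [h4, Real.rpow_natCast]
    congr 2
    · refine integral_congr_ae (Filter.Eventually.of_forall fun y => ?_)
      dsimp only
      rw [norm_inv, Real.norm_of_nonneg (hs y).le, inv_pow, show 4 = 2 * 2 by norm_num, pow_mul,
        Real.sq_sqrt (by linarith [hw1 y])]
    · norm_num
  have := holderTriple_four_four
  have h3 := eLpNorm_smul_le_mul_eLpNorm (p := 4) (q := 4) (r := 2) (μ := torusVol d)
    hsi.aestronglyMeasurable hg
  rw [h2] at h3
  rw [h1, ENNReal.ofReal_mul (by positivity)]
  calc _ ≤ (eLpNorm g 4 (torusVol d) * ENNReal.ofReal ((∫ y, (w y ^ 2)⁻¹ ∂(torusVol d)) ^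
        (1 / 4 : ℝ))) * ENNReal.ofReal √(∫ y, ‖K y‖ ^ 2 * w y ∂(torusVol d)) :=
        mul_le_mul' h3 le_rfl
    _ = _ := by ring

/-- The `L⁴ → L^∞` smoothing bound for the resolvent on mean-zero functions. -/
theorem resolvent_kernel_bound (hd : d = 1 ∨ d = 2) : ∃ B : ℝ, 0 < B ∧ ∀ β : ℝ, 0 < β →
    ∀ g : Torus d → ℝ, MemLp g 4 (torusVol d) → ∫ x, g x ∂(torusVol d) = 0 →
      eLpNorm (resolvent β g) ∞ (torusVol d) ≤
        ENNReal.ofReal (B * β ^ (-(d / 16) : ℝ)) * eLpNorm g 4 (torusVol d) := by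
  set D : ℝ := (1 + 676 * d) * (2 * 36 ^ d) with hD
  have hD0 : 0 < D := by positivity
  refine ⟨√D * (2 ^ d) ^ (1 / 4 : ℝ) + √(36 ^ d), by positivity, fun β hβ g hg hg0 => ?_⟩
  obtain ⟨c, hc, rfl⟩ := exists_pow_twelve_eq hβ
  have h0 := symbol_nonneg (d := d) hβ
  have h1 := symbol_le_one (d := d) hβ
  obtain ⟨hs, hM⟩ := summable_symbol hd hc
  have hgi : Integrable g (torusVol d) := hg.integrable (by norm_num)
  set G : ℝ := (c ^ 3) ^ d with hG
  have hG0 : 0 < G := by positivity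
  have hGβ : (c ^ 12) ^ (-(d / 16) : ℝ) = G ^ (-(1 / 4) : ℝ) := by
    rw [hG, ← pow_mul, rpow_pow_twelve hc, ← Real.rpow_natCast, ← Real.rpow_mul hc.le]
    congr 1; push_cast; ring
  have hGd : (36 / c ^ 3) ^ d = 36 ^ d / G := by rw [div_pow]
  rw [eLpNorm_exponent_top, hGβ]
  refine eLpNormEssSup_le_of_ae_enorm_bound (Filter.Eventually.of_forall fun x => ?_)
  have hgx := memLp_translate hg x
  -- For `c ≤ 1` the kernel is concentrated at scale `c³`: the weighted estimate gives
  -- `G^{-1/2}·G^{1/4} = G^{-1/4}`, the constant mode being absorbed in `36^d/G ≥ 1`. For `c ≥ 1`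
  -- the constant mode would spoil the decay, so mean zero is used to remove it; plain `L²` then
  -- gives `G^{-1/2} ≤ G^{-1/4}`.
  rcases le_total c 1 with hc1 | hc1
  · have hc31 : c ^ 3 ≤ 1 := pow_le_one₀ hc.le hc1
    have hn : Summable fun k : Fin d → ℤ => ‖(((1 + c ^ 12 * freqSq k ^ 2)⁻¹ : ℝ) : ℂ)‖ := by
      simpa only [Complex.norm_real, Real.norm_of_nonneg (h0 _)] using hs
    refine (enorm_resolvent_le hgi hn (fun _ => rfl) x).trans ?_
    refine (enorm_integral_mul_le_weight (continuous_fourierSum hn) (continuous_weight (c ^ 3))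
      (one_le_weight _) hgx.1).trans ?_
    rw [eLpNorm_translate _ hg.1]
    refine mul_le_mul' (ENNReal.ofReal_le_ofReal ?_) le_rfl
    have hP := integral_norm_sq_mul_weight_le hd hc
    have hQ := integral_inv_weight_sq_le hd (pow_pos hc 3) hc31
    have hGle : 1 ≤ 36 ^ d / G := by
      rw [le_div_iff₀ hG0, one_mul]
      exact (pow_le_one₀ (by positivity) hc31).trans (one_le_pow₀ (by norm_num))
    have hP' : (1 + 676 * (d : ℝ)) * (1 + (36 / c ^ 3) ^ d) ≤ D / G := by
      rw [hGd, hD, mul_div_assoc]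
      refine mul_le_mul_of_nonneg_left ?_ (by positivity)
      rw [mul_div_assoc]; linarith
    have hQ0 : 0 ≤ ∫ y : Torus d, (weight (c ^ 3) y ^ 2)⁻¹ ∂(torusVol d) :=
      integral_nonneg fun y => by positivity
    calc _ ≤ √(D / G) * ((2 * c ^ 3) ^ d) ^ (1 / 4 : ℝ) :=
          mul_le_mul (Real.sqrt_le_sqrt (hP.trans hP')) (Real.rpow_le_rpow hQ0 hQ (by norm_num))
            (by positivity) (by positivity)
      _ = √D * (2 ^ d) ^ (1 / 4 : ℝ) * G ^ (-(1 / 4) : ℝ) := by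
          rw [mul_pow, ← hG, Real.mul_rpow (by positivity) hG0.le, Real.sqrt_div hD0.le,
            Real.sqrt_eq_rpow G, div_eq_mul_inv, ← Real.rpow_neg hG0.le]
          have : G ^ (-(1 / 4) : ℝ) = G ^ (-(1 / 2) : ℝ) * G ^ (1 / 4 : ℝ) := by
            rw [← Real.rpow_add hG0]; norm_num
          rw [this]; ring
      _ ≤ _ := by
          refine mul_le_mul_of_nonneg_right ?_ (by positivity)
          linarith [Real.sqrt_nonneg ((36 : ℝ) ^ d)]
  · classical
    set m : (Fin d → ℤ) → ℝ := fun k => if k = 0 then 0 else (1 + c ^ 12 * freqSq k ^ 2)⁻¹ with hm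
    have hm0 : ∀ k, 0 ≤ m k := fun k => by
      rw [hm]; dsimp only; split_ifs
      · exact le_rfl
      · exact h0 k
    have hm1 : ∀ k, m k ≤ 1 := fun k => by
      rw [hm]; dsimp only; split_ifs
      · exact zero_le_one
      · exact h1 k
    have hle : ∀ s : Finset (Fin d → ℤ), ∑ k ∈ s, m k ≤ 36 ^ d / G := fun s => by
      refine (sum_le_of_le_prod hc (A := 4 / c ^ 2) (by positivity) hm0
        (fun k hk => ?_) s).trans (le_of_eq ?_)
      · simp only [hm, if_neg hk]
        exact symbol_le_prod hc hd hk
      · have e : 9 * (4 / c ^ 2) / c = 36 / c ^ 3 := by field_simp; norm_num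
        rw [e, hGd]; simp [hm]
    have hms := summable_of_sum_le hm0 hle
    have hmt := Real.tsum_le_of_sum_le hm0 hle
    have hn : Summable fun k => ‖(m k : ℂ)‖ := by
      simpa only [Complex.norm_real, Real.norm_of_nonneg (hm0 _)] using hms
    have hg00 : coeff g 0 = 0 := by
      rw [coeff_eq_integral]
      simp [mFourier_zero, hg0, integral_complex_ofReal]
    refine (enorm_resolvent_le hgi hn (fun k => ?_) x).trans ?_
    · by_cases hk : k = 0
      · rw [hk, hg00]; ring
      · simp only [hm, if_neg hk]
    refine (enorm_integral_mul_le (p := 2) (q := 2) hgx.1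
      (continuous_fourierSum hn).aestronglyMeasurable).trans ?_
    rw [eLpNorm_translate _ hg.1, mul_comm, eLpNorm_two_eq_sqrt (continuous_fourierSum hn),
      ← (hasSum_norm_sq_fourierSum hn).tsum_eq]
    refine mul_le_mul' (ENNReal.ofReal_le_ofReal ?_)
      (eLpNorm_le_eLpNorm_of_exponent_le (by norm_num) hg.1)
    have hG1 : 1 ≤ G := one_le_pow₀ (one_le_pow₀ hc1)
    have hsq : ∑' k, ‖(m k : ℂ)‖ ^ 2 ≤ 36 ^ d / G := by
      refine ((hasSum_norm_sq_fourierSum hn).summable.tsum_le_tsum (fun k => ?_) hms).trans hmt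
      rw [Complex.norm_real, Real.norm_of_nonneg (hm0 k)]
      nlinarith [hm0 k, hm1 k]
    calc √(∑' k, ‖(m k : ℂ)‖ ^ 2) ≤ √(36 ^ d / G) := Real.sqrt_le_sqrt hsq
      _ = √(36 ^ d) * G ^ (-(1 / 2) : ℝ) := by
          rw [Real.sqrt_div (by positivity), Real.sqrt_eq_rpow G, div_eq_mul_inv,
            ← Real.rpow_neg hG0.le]
      _ ≤ √(36 ^ d) * G ^ (-(1 / 4) : ℝ) := by
          refine mul_le_mul_of_nonneg_left ?_ (by positivity)
          exact Real.rpow_le_rpow_of_exponent_le hG1 (by norm_num)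
      _ ≤ _ := by
          refine mul_le_mul_of_nonneg_right ?_ (by positivity)
          have : 0 ≤ √D * (2 ^ d) ^ (1 / 4 : ℝ) := by positivity
          linarith

/-! ### Admissible pairs and constants depending only on the initial energy. -/

theorem exists_kernelBounds_one :
    ∃ B₁ B₂ : ℝ, 0 < B₁ ∧ 0 < B₂ ∧ KernelBounds 1 (1 / 16) (11 / 16) B₁ B₂ := by
  obtain ⟨B₁, h₁, H₁⟩ := resolvent_kernel_bound (d := 1) (Or.inl rfl)
  obtain ⟨B₂, h₂, H₂⟩ := lap_kernel_bound_one
  refine ⟨B₁, B₂, h₁, h₂, fun ν τ N hν hτ _ => ⟨fun g hg hg0 => ?_, H₂ ν τ N hν hτ⟩⟩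
  have h := H₁ (ν * τ) (mul_pos hν hτ) g hg hg0
  rwa [show (((1 : ℕ) : ℝ) / 16) = 1 / 16 by norm_num] at h

theorem exists_kernelBounds_two :
    ∃ B₁ B₂ : ℝ, 0 < B₁ ∧ 0 < B₂ ∧ KernelBounds 2 (1 / 8) (7 / 8) B₁ B₂ := by
  obtain ⟨B₁, h₁, H₁⟩ := resolvent_kernel_bound (d := 2) (Or.inr rfl)
  obtain ⟨B₂, h₂, H₂⟩ := lap_kernel_bound_two
  refine ⟨B₁, B₂, h₁, h₂, fun ν τ N hν hτ _ => ⟨fun g hg hg0 => ?_, H₂ ν τ N hν hτ⟩⟩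
  have h := H₁ (ν * τ) (mul_pos hν hτ) g hg hg0
  rwa [show (((2 : ℕ) : ℝ) / 16) = 1 / 8 by norm_num] at h

theorem exists_stable_one : ∃ C₁ : ℝ → ℝ, (∀ E, 0 < C₁ E) ∧
    ConditionallyEnergyStable 1 (fun ν E₀ => C₁ E₀ * ν ^ (5 / 3 : ℝ)) := by
  obtain ⟨B₁, B₂, h₁, h₂, hK⟩ := exists_kernelBounds_one
  have hE : ∀ E : ℝ, 0 < √(max E 1) := fun E => Real.sqrt_pos.mpr (by positivity)
  -- Replacing `√E` by `√(max E 1)` keeps the constant positive for every `E`, at the price of a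
  -- larger `β₂`.
  refine ⟨fun E => 0.118 * min ((B₁ * √(1 + 2 * √E)) ^ (-(16 / 3) : ℝ))
    ((2 * B₂ * √(max E 1) * √(1 + 2 * √E)) ^ (-(16 / 9) : ℝ)), fun E => ?_, ?_⟩
  · have := hE E
    positivity
  · have h := stable_of_kernelBounds_one h₁ h₂ hK (β₁ := fun E => B₁ * √(1 + 2 * √E))
      (β₂ := fun E => 2 * B₂ * √(max E 1) * √(1 + 2 * √E)) (fun E _ => le_rfl) fun E _ => by
        gcongr
        exact le_max_left _ _
    simpa only [mul_right_comm] using h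

theorem exists_stable_two : ∃ C₂ : ℝ → ℝ, (∀ E, 0 < C₂ E) ∧
    ConditionallyEnergyStable 2 (fun ν E₀ => C₂ E₀ * ν ^ 3) := by
  obtain ⟨B₁, B₂, h₁, h₂, hK⟩ := exists_kernelBounds_two
  have hE : ∀ E : ℝ, 0 < √(max E 1) := fun E => Real.sqrt_pos.mpr (by positivity)
  refine ⟨fun E => 0.04 * min ((B₁ * √(1 + 2 * √E)) ^ (-8 : ℝ))
    ((2 * B₂ * √(max E 1) * √(1 + 2 * √E)) ^ (-(8 / 3) : ℝ)), fun E => ?_, ?_⟩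
  · have := hE E
    positivity
  · have h := stable_of_kernelBounds_two h₁ h₂ hK (β₁ := fun E => B₁ * √(1 + 2 * √E))
      (β₂ := fun E => 2 * B₂ * √(max E 1) * √(1 + 2 * √E)) (fun E _ => le_rfl) fun E _ => by
        gcongr
        exact le_max_left _ _
    simpa only [mul_right_comm] using h

end CahnHilliard

end

theorem theorem1 :
    -- the time step restriction, with constants depending only on the initial energy
    (∃ C₁ : ℝ → ℝ, (∀ E, 0 < C₁ E) ∧
      ConditionallyEnergyStable 1 (fun ν E₀ => C₁ E₀ * ν ^ (5 / 3 : ℝ))) ∧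
    (∃ C₂ : ℝ → ℝ, (∀ E, 0 < C₂ E) ∧
      ConditionallyEnergyStable 2 (fun ν E₀ => C₂ E₀ * ν ^ 3)) ∧
    (∃ C₃ : ℝ → ℝ, (∀ E, 0 < C₃ E) ∧
      ConditionallyEnergyStable 3 (fun ν E₀ => C₃ E₀ * ν ^ 7)) ∧
    -- explicit form of the constant, d = 1
    (∃ B₁ B₂ : ℝ, 0 < B₁ ∧ 0 < B₂ ∧ KernelBounds 1 (1 / 16) (11 / 16) B₁ B₂) ∧
    (∀ B₁ B₂ : ℝ, 0 < B₁ → 0 < B₂ → KernelBounds 1 (1 / 16) (11 / 16) B₁ B₂ →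
      ConditionallyEnergyStable 1 (fun ν E₀ =>
        0.118 * ν ^ (5 / 3 : ℝ) *
          min ((B₁ * √(1 + 2 * √E₀)) ^ (-(16 / 3) : ℝ))
            ((2 * B₂ * √E₀ * √(1 + 2 * √E₀)) ^ (-(16 / 9) : ℝ)))) ∧
    -- explicit form of the constant, d = 2
    (∃ B₁ B₂ : ℝ, 0 < B₁ ∧ 0 < B₂ ∧ KernelBounds 2 (1 / 8) (7 / 8) B₁ B₂) ∧
    (∀ B₁ B₂ : ℝ, 0 < B₁ → 0 < B₂ → KernelBounds 2 (1 / 8) (7 / 8) B₁ B₂ →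
      ConditionallyEnergyStable 2 (fun ν E₀ =>
        0.04 * ν ^ 3 *
          min ((B₁ * √(1 + 2 * √E₀)) ^ (-8 : ℝ))
            ((2 * B₂ * √E₀ * √(1 + 2 * √E₀)) ^ (-(8 / 3) : ℝ)))) ∧
    -- explicit form of the constant, d = 3
    (∃ B₃ B₄ B₅ : ℝ, 0 < B₃ ∧ 0 < B₄ ∧ 0 < B₅ ∧
      ConditionallyEnergyStable 3 (fun ν E₀ =>
        0.0007 * ν ^ 7 *
          min ((B₃ * √E₀) ^ (-8 : ℝ))
            (min ((B₄ * E₀ ^ (3 / 2 : ℝ)) ^ (-(8 / 3) : ℝ))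
              ((B₅ * (1 + E₀) ^ (1 / 4 : ℝ)) ^ (-8 : ℝ))))) := by
  exact ⟨exists_stable_one, exists_stable_two,
    ⟨_, fun E => by positivity, stable_three_simple⟩,
    exists_kernelBounds_one,
    fun B₁ B₂ h₁ h₂ hK =>
      stable_of_kernelBounds_one h₁ h₂ hK (fun _ _ => le_rfl) fun _ _ => le_rfl,
    exists_kernelBounds_two,
    fun B₁ B₂ h₁ h₂ hK =>
      stable_of_kernelBounds_two h₁ h₂ hK (fun _ _ => le_rfl) fun _ _ => le_rfl,
    ⟨16 * 72 ^ 3, 1, 1, by norm_num, one_pos, one_pos, stable_three_explicit⟩⟩
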